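/- Let $\Lambda\subset\mathbb{R}^3$ be a bounded closed convex set with non-empty interior and $0\in\Lambda$, let $E>0$ and $\ell>0$, and let $f:\mathbb{R}\to\mathbb{R}$ be an even function with $f(x)=1-\frac{x^2}{2\ell^2}+o(x^2)$ as $x\to0$, such that $f'''(x)$ exists for all small $x\neq 0$ and $\lim_{x\to0}xf'''(x)=0$. For ${\bm x}\in\mathbb{R}^3$ write $x=|{\bm x}|$ and ${\bm e}_x={\bm x}/x$, and put $$C_{\mu\nu}({\bm x})=\frac{2E}{3}f(x)\,\delta_{\mu\nu}+\frac{E}{3}\,xf'(x)\Big(\delta_{\mu\nu}-\frac{x_\mu x_\nu}{x^2}\Big).$$ Let ${\bm v}$ be a zero-mean Gaussian random element of $L^2(\Lambda)\otimes\mathbb{R}^3$ whose covariance operator is the integral operator with kernel $C_{\mu\nu}({\bm x}-{\bm y})$. Let $\|\cdot\|_2$ be the norm of $L^2(\Lambda)\otimes\mathbb{R}^3$. If $f$ is $C^2$ at $|{\bm x}-{\bm y}|$ for all ${\bm x},{\bm y}\in\Lambda$, then: (i) The local helicity $h(0)={\bm v}(0)\cdot{\rm curl}\,{\bm v}(0)$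 exists almost surely: almost surely ${\bm v}$ has a (necessarily unique) representative that is continuous on $\Lambda$ and differentiable at $0$ (relative to $\Lambda$, if $0$ is a boundary point), and $h(0)$, which is computed from it, is a random variable. (ii) There is a random unit vector ${\bm e}_t$, uniformly distributed over the unit sphere, both unconditionally and conditionally on $|h(0)|>u$ for every $u\ge0$, such that, with $\pm$ the sign of $h(0)$ and $${\bm u}_\pm({\bm x})=f(x)\,{\bm e}_t+\frac{x}{2}f'(x)\big[{\bm e}_t-({\bm e}_x\cdot{\bm e}_t)\,{\bm e}_x\big]\pm\frac{\ell}{\sqrt5}\Big[2f'(x)+\frac{x}{2}f''(x)\Big]({\bm e}_x\times{\bm e}_t),$$ the normalized field ${\bm v}/\|{\bm v}\|_2$ converges to ${\bm u}_\pm/\|{\bm u}_\pm\|_2$ in $L^2$ and in probability as $|h(0)|\to\infty$, that is, for every $\varepsilon>0$, $$\lim_{u\to+\infty}\mathbb{P}\left(\left.\left\|\frac{{\bm v}}{\|{\bm v}\|_2}-\frac{{\bm u}_\pm}{\|{\bm u}_\pm\|_2}\right\|_2>\varepsilon\ \right|\ |h(0)|>u\right)=0 .$$ -/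

import Mathlib

open MeasureTheory ProbabilityTheory Filter Topology Asymptotics
open scoped ENNReal Matrix

namespace GaussianFlow

noncomputable section

/-- Euclidean three-space. -/
abbrev R3 : Type := EuclideanSpace ℝ (Fin 3)

/-- The real Hilbert space `L²(Λ) ⊗ ℝ³` of square-integrable vector fields on `Λ`. -/
abbrev L2Field (Λ : Set R3) : Type := Lp R3 2 (volume.restrict Λ)

/-- The covariance tensor
`C_{μν}(x) = (2E/3) f(|x|) δ_{μν} + (E/3) |x| f'(|x|) (δ_{μν} - x_μ x_ν / |x|²)`.
At `x = 0` the second term is zero because of its factor `|x|`. -/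
def covTensor (E : ℝ) (f : ℝ → ℝ) (x : R3) : Matrix (Fin 3) (Fin 3) ℝ := fun μ ν =>
  2 * E / 3 * f ‖x‖ * (if μ = ν then 1 else 0)
    + E / 3 * ‖x‖ * deriv f ‖x‖ * ((if μ = ν then 1 else 0) - x μ * x ν / ‖x‖ ^ 2)

/-- `v` is a zero-mean Gaussian random element of `L²(Λ) ⊗ ℝ³` whose covariance operator is the
integral operator with kernel `C_{μν}(x - y)`. -/
structure IsGaussianFlow {Ω : Type*} [MeasurableSpace Ω] (P : Measure Ω) (Λ : Set R3)
    (E : ℝ) (f : ℝ → ℝ) (v : Ω → L2Field Λ) : Prop where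
  aestronglyMeasurable : AEStronglyMeasurable v P
  gaussian : ∀ φ : L2Field Λ, HasGaussianLaw (fun ω => inner ℝ φ (v ω)) P
  mean_zero : ∀ φ : L2Field Λ, ∫ ω, inner ℝ φ (v ω) ∂P = 0
  covariance : ∀ φ ψ : L2Field Λ,
    ∫ ω, inner ℝ φ (v ω) * inner ℝ ψ (v ω) ∂P
      = ∫ x in Λ, ∫ y in Λ, ∑ μ, ∑ ν, φ x μ * covTensor E f (x - y) μ ν * ψ y ν

/-- The partial derivative `∂_b w_c` at `x`, relative to `Λ` (one-sided if `x` is a boundary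
point of `Λ`). -/
def partialWithin (Λ : Set R3) (w : R3 → R3) (x : R3) (b c : Fin 3) : ℝ :=
  fderivWithin ℝ w Λ x (EuclideanSpace.single b 1) c

/-- The curl of `w` at `x`, relative to `Λ`. -/
def curlWithin (Λ : Set R3) (w : R3 → R3) (x : R3) : R3 :=
  !₂[partialWithin Λ w x 1 2 - partialWithin Λ w x 2 1,
     partialWithin Λ w x 2 0 - partialWithin Λ w x 0 2,
     partialWithin Λ w x 0 1 - partialWithin Λ w x 1 0]

/-- The square-integrable field `g` has a local helicity at the origin, and its value is `h`:
`g` has a representative `w` that is continuous on `Λ` and differentiable at `0`, and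
`h = w(0) · curl w(0)`. -/
def HasLocalHelicity (Λ : Set R3) (g : L2Field Λ) (h : ℝ) : Prop :=
  ∃ w : R3 → R3, w =ᵐ[volume.restrict Λ] g ∧ ContinuousOn w Λ ∧ DifferentiableWithinAt ℝ w Λ 0 ∧
    h = inner ℝ (w 0) (curlWithin Λ w 0)

/-- The local helicity does not depend on the representative. -/
theorem HasLocalHelicity.unique {Λ : Set R3} (hconv : Convex ℝ Λ)
    (hint : (interior Λ).Nonempty) (h0 : (0 : R3) ∈ Λ) {g : L2Field Λ} {h h' : ℝ}
    (H : HasLocalHelicity Λ g h) (H' : HasLocalHelicity Λ g h') : h = h' := by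
  obtain ⟨w, hw, hwc, -, rfl⟩ := H
  obtain ⟨w', hw', hwc', -, rfl⟩ := H'
  have hE : Set.EqOn w w' Λ := Measure.eqOn_of_ae_eq (hw.trans hw'.symm) hwc hwc'
    (by rw [hconv.closure_interior_eq_closure_of_nonempty_interior hint]; exact subset_closure)
  have hD : fderivWithin ℝ w Λ 0 = fderivWithin ℝ w' Λ 0 := fderivWithin_congr hE (hE h0)
  simp only [curlWithin, partialWithin, hD, hE h0]

/-- The cross product on `ℝ³`. -/
def cross (x y : R3) : R3 := WithLp.toLp 2 (crossProduct x.ofLp y.ofLp)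

/-- The field
`u(x) = f(|x|) e + (|x|/2) f'(|x|) [e - (eₓ·e) eₓ]
  + σ (ℓ/√5) [2 f'(|x|) + (|x|/2) f''(|x|)] (eₓ × e)`, with `eₓ = x/|x|` and a sign `σ`. -/
def profile (f : ℝ → ℝ) (ℓ σ : ℝ) (e x : R3) : R3 :=
  let ex : R3 := ‖x‖⁻¹ • x
  f ‖x‖ • e + (‖x‖ / 2 * deriv f ‖x‖) • (e - inner ℝ ex e • ex)
    + (σ * (ℓ / √5) * (2 * deriv f ‖x‖ + ‖x‖ / 2 * deriv (deriv f) ‖x‖)) • cross ex e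

/-- The field `g / ‖g‖₂`, where `‖·‖₂` is the norm of `L²(Λ) ⊗ ℝ³`. -/
def normalized (Λ : Set R3) (g : R3 → R3) : R3 → R3 := fun x =>
  (eLpNorm g 2 (volume.restrict Λ)).toReal⁻¹ • g x

/-- The uniform probability distribution on the unit sphere of `ℝ³`. -/
def uniformSphere : Measure (Metric.sphere (0 : R3) 1) :=
  ((volume : Measure R3).toSphere Set.univ)⁻¹ • (volume : Measure R3).toSphere

end

end GaussianFlow

namespace GaussianFlow

/-! ### Radial functions as functions of `s = r²` -/

/-- `f'(r) / r` as a function of `s = r²`. -/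
noncomputable def radial (f : ℝ → ℝ) (s : ℝ) : ℝ := deriv f (√s) / √s

/-- The derivative of `radial f`. -/
noncomputable def radialD (f : ℝ → ℝ) (s : ℝ) : ℝ :=
  (deriv (deriv f) (√s) - radial f s) / (2 * s)

/-- The second derivative of `radial f`. -/
noncomputable def radialDD (f : ℝ → ℝ) (s : ℝ) : ℝ :=
  (deriv (deriv (deriv f)) (√s) * (1 / (2 * √s)) - radialD f s) / (2 * s)
    - (deriv (deriv f) (√s) - radial f s) / (2 * s ^ 2)

/-- The variable `s = ‖z‖²` is used because it is quadratic along lines `z + t h`: derivatives of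
the kernel then involve only inner products and the functions `radial`, `radialD`, `radialDD`. -/
theorem hasDerivAt_comp_sqrt {f : ℝ → ℝ} {s : ℝ} (hs : 0 < s)
    (hf : DifferentiableAt ℝ f (√s)) :
    HasDerivAt (fun s => f (√s)) (radial f s / 2) s := by
  have h := hf.hasDerivAt.comp s (Real.hasDerivAt_sqrt hs.ne')
  have hr : √s ≠ 0 := (Real.sqrt_pos.2 hs).ne'
  convert! h using 1
  rw [radial]; field_simp

theorem hasDerivAt_radial {f : ℝ → ℝ} {s : ℝ} (hs : 0 < s)
    (hf : DifferentiableAt ℝ (deriv f) (√s)) :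
    HasDerivAt (radial f) (radialD f s) s := by
  have hr : √s ≠ 0 := (Real.sqrt_pos.2 hs).ne'
  have h := (hf.hasDerivAt.comp s (Real.hasDerivAt_sqrt hs.ne')).div
    (Real.hasDerivAt_sqrt hs.ne') hr
  convert! h using 1
  have h2 : s = √s ^ 2 := (Real.sq_sqrt hs.le).symm
  simp only [radialD, radial, Function.comp]
  generalize deriv (deriv f) (√s) = a
  generalize deriv f (√s) = b
  rw [h2]
  rw [Real.sqrt_sq (Real.sqrt_nonneg s)]
  field_simp

theorem hasDerivAt_radialD {f : ℝ → ℝ} {s : ℝ} (hs : 0 < s)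
    (hf : DifferentiableAt ℝ (deriv f) (√s)) (hf' : DifferentiableAt ℝ (deriv (deriv f)) (√s)) :
    HasDerivAt (radialD f) (radialDD f s) s := by
  have h := (((hf'.hasDerivAt.comp s (Real.hasDerivAt_sqrt hs.ne'))).sub
    (hasDerivAt_radial hs hf)).div ((hasDerivAt_id s).const_mul 2) (by simpa using hs.ne')
  convert! h using 1
  simp only [radialDD, id]
  have := hs.ne'
  simp only [Pi.sub_apply, Function.comp]
  field_simp

/-- The regularity of `f` at the origin which the kernel inherits. -/
structure RegularAtZero (f : ℝ → ℝ) (c : ℝ) : Prop where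
  contDiffAt : ContDiffAt ℝ 2 f 0
  deriv_zero : deriv f 0 = 0
  deriv_deriv_zero : deriv (deriv f) 0 = -c
  third : ∀ᶠ r in 𝓝[≠] (0 : ℝ), DifferentiableAt ℝ (deriv (deriv f)) r
  third_lim : Tendsto (fun r : ℝ => r * deriv (deriv (deriv f)) r) (𝓝[≠] 0) (𝓝 0)

theorem _root_.ContDiffAt.deriv_of_two {f : ℝ → ℝ} {r : ℝ} (h : ContDiffAt ℝ 2 f r) :
    ContDiffAt ℝ 1 (deriv f) r := by
  have := h.fderiv_right (m := 1) (by norm_num)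
  exact this.clm_apply contDiffAt_const

theorem _root_.ContDiffAt.continuousAt_deriv_deriv {f : ℝ → ℝ} {r : ℝ}
    (h : ContDiffAt ℝ 2 f r) : ContinuousAt (deriv (deriv f)) r := by
  have := h.deriv_of_two.fderiv_right (m := 0) (by norm_num)
  exact (this.clm_apply contDiffAt_const).continuousAt

theorem taylor_value_zero {f : ℝ → ℝ} {ℓ : ℝ}
    (hf : (fun r : ℝ => f r - (1 - r ^ 2 / (2 * ℓ ^ 2))) =o[𝓝 0] fun r : ℝ => r ^ 2) :
    f 0 = 1 := by
  -- The full neighbourhood filter contains the point 0, where the comparison function `r ^ 2`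
  -- vanishes.
  have := (hf.bound one_pos).self_of_nhds
  simp at this
  linarith

/-- Evenness gives `f'(0) = 0`. The limit of `(f r - 1)/r²` is then computed twice, as `f''(0)/2` by
l'Hôpital's rule and as `-1/(2ℓ²)` from the Taylor hypothesis. -/
theorem regularAtZero {f : ℝ → ℝ} {ℓ : ℝ} (hℓ : 0 < ℓ) (hf_even : ∀ r, f (-r) = f r)
    (hf_C2 : ContDiffAt ℝ 2 f 0)
    (hf_taylor : (fun r : ℝ => f r - (1 - r ^ 2 / (2 * ℓ ^ 2))) =o[𝓝 0] fun r : ℝ => r ^ 2)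
    (hf_third : ∀ᶠ r in 𝓝[≠] (0 : ℝ), DifferentiableAt ℝ (deriv (deriv f)) r)
    (hf_third_lim : Tendsto (fun r : ℝ => r * deriv (deriv (deriv f)) r) (𝓝[≠] 0) (𝓝 0)) :
    RegularAtZero f (1 / ℓ ^ 2) := by
  have h0 : deriv f 0 = 0 := by
    have h1 := deriv_comp_neg f 0
    rw [show (fun x => f (-x)) = f from funext hf_even, neg_zero] at h1
    linarith
  refine ⟨hf_C2, h0, ?_, hf_third, hf_third_lim⟩
  have hdiff : ∀ᶠ r in 𝓝[>] (0 : ℝ), HasDerivAt f (deriv f r) r := by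
    have : ∀ᶠ r in 𝓝 (0 : ℝ), ContDiffAt ℝ 2 f r := hf_C2.eventually (by simp)
    filter_upwards [this.filter_mono nhdsWithin_le_nhds] with r hr
    exact (hr.differentiableAt (by norm_num)).hasDerivAt
  have hslope : Tendsto (fun r => deriv f r / (2 * r)) (𝓝[>] 0) (𝓝 (deriv (deriv f) 0 / 2)) := by
    have h1 := ((hf_C2.deriv_of_two.differentiableAt (by norm_num)).hasDerivAt).tendsto_slope
    have h2 := (h1.mono_left (nhdsWithin_mono 0 (fun x (hx : (0:ℝ) < x) => hx.ne'))).div_const 2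
    refine h2.congr' ?_
    filter_upwards [self_mem_nhdsWithin] with r (hr : 0 < r)
    simp [slope_def_field, h0]
    field_simp
  have hlop : Tendsto (fun r => (f r - 1) / r ^ 2) (𝓝[>] 0) (𝓝 (deriv (deriv f) 0 / 2)) := by
    refine HasDerivAt.lhopital_zero_nhdsGT (f' := deriv f) (g' := fun r => 2 * r) ?_ ?_ ?_ ?_ ?_
      hslope
    · filter_upwards [hdiff] with r hr using hr.sub_const 1
    · exact Eventually.of_forall fun r => by simpa using hasDerivAt_pow 2 r
    · filter_upwards [self_mem_nhdsWithin] with r (hr : 0 < r)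
      positivity
    · have : Tendsto (fun r => f r - 1) (𝓝 0) (𝓝 (f 0 - 1)) := hf_C2.continuousAt.sub_const 1
      simp only [taylor_value_zero hf_taylor, sub_self] at this
      exact this.mono_left nhdsWithin_le_nhds
    · have : ContinuousAt (fun r : ℝ => r ^ 2) 0 := by fun_prop
      simpa [ContinuousAt] using this.tendsto.mono_left nhdsWithin_le_nhds
  have htay : Tendsto (fun r => (f r - 1) / r ^ 2) (𝓝[>] 0) (𝓝 (-(1 / (2 * ℓ ^ 2)))) := by
    have h1 := (hf_taylor.tendsto_div_nhds_zero).mono_left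
      (nhdsWithin_le_nhds (s := Set.Ioi (0 : ℝ)))
    have h2 := h1.add_const (-(1 / (2 * ℓ ^ 2)))
    rw [zero_add] at h2
    refine h2.congr' ?_
    filter_upwards [self_mem_nhdsWithin] with r (hr : 0 < r)
    field_simp
    ring
  have := tendsto_nhds_unique hlop htay
  have hℓ' := hℓ.ne'
  field_simp at this ⊢
  linarith

theorem tendsto_sqrt_nhdsGT : Tendsto Real.sqrt (𝓝[>] 0) (𝓝[>] 0) := by
  refine tendsto_nhdsWithin_iff.2 ⟨?_, ?_⟩
  · have := Real.continuous_sqrt.tendsto 0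
    rw [Real.sqrt_zero] at this
    exact this.mono_left nhdsWithin_le_nhds
  · filter_upwards [self_mem_nhdsWithin] with s hs using Real.sqrt_pos.2 hs

namespace RegularAtZero
variable {f : ℝ → ℝ} {c : ℝ} (hf : RegularAtZero f c)
include hf

theorem tendsto_radial : Tendsto (radial f) (𝓝[>] 0) (𝓝 (-c)) := by
  have h1 := ((hf.contDiffAt.deriv_of_two.differentiableAt (by norm_num)).hasDerivAt).tendsto_slope
  have h2 := (h1.mono_left (nhdsWithin_mono 0 (fun x (hx : (0:ℝ) < x) => hx.ne')))
  rw [hf.deriv_deriv_zero] at h2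
  refine (h2.comp tendsto_sqrt_nhdsGT).congr fun s => ?_
  simp [slope_def_field, hf.deriv_zero, radial]

theorem tendsto_deriv_deriv_sqrt :
    Tendsto (fun s => deriv (deriv f) (√s)) (𝓝[>] 0) (𝓝 (-c)) := by
  have h := (hf.contDiffAt.continuousAt_deriv_deriv).tendsto.mono_left
    (nhdsWithin_le_nhds (s := Set.Ioi (0 : ℝ)))
  rw [hf.deriv_deriv_zero] at h
  exact h.comp tendsto_sqrt_nhdsGT

/-- With `B = f'/r` one has `s B' = (f'' - B)/2`, and both terms in the difference tend to `-c`. -/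
theorem tendsto_mul_radialD : Tendsto (fun s => s * radialD f s) (𝓝[>] 0) (𝓝 0) := by
  have h := (hf.tendsto_deriv_deriv_sqrt.sub hf.tendsto_radial).div_const 2
  rw [sub_self, zero_div] at h
  refine h.congr' ?_
  filter_upwards [self_mem_nhdsWithin] with s (hs : 0 < s)
  simp only [radialD]; field_simp

/-- Here the hypothesis `r f'''(r) → 0` enters: `s² B'' = (r f'''/2 - s B')/2 - (f'' - B)/2`. -/
theorem tendsto_sq_mul_radialDD : Tendsto (fun s => s ^ 2 * radialDD f s) (𝓝[>] 0) (𝓝 0) := by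
  have h3 := (hf.third_lim.mono_left
    (nhdsWithin_mono 0 (fun x (hx : (0:ℝ) < x) => hx.ne'))).comp tendsto_sqrt_nhdsGT
  have h := (((h3.div_const 2).sub hf.tendsto_mul_radialD).div_const 2).sub
    ((hf.tendsto_deriv_deriv_sqrt.sub hf.tendsto_radial).div_const 2)
  simp only [sub_self, zero_div] at h
  refine h.congr' ?_
  filter_upwards [self_mem_nhdsWithin] with s (hs : 0 < s)
  have hr : √s ≠ 0 := (Real.sqrt_pos.2 hs).ne'
  have h2 : √s ^ 2 = s := Real.sq_sqrt hs.le
  simp only [radialDD, Function.comp]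
  generalize deriv (deriv (deriv f)) (√s) = a
  generalize (deriv (deriv f)) (√s) = b
  field_simp
  linear_combination a * h2

end RegularAtZero

/-! ### The scalar kernels `⟨a, C(z) b⟩` -/

/-- `⟨a, C(z) b⟩`. -/
noncomputable def ker (E : ℝ) (f : ℝ → ℝ) (a b z : R3) : ℝ :=
  E / 3 * ((2 * f ‖z‖ + ‖z‖ ^ 2 * radial f (‖z‖ ^ 2)) * inner ℝ a b
    - radial f (‖z‖ ^ 2) * inner ℝ z a * inner ℝ z b)

/-- The derivative of `ker` at `z` in the direction `h`. -/
noncomputable def kerD (E : ℝ) (f : ℝ → ℝ) (a b z h : R3) : ℝ :=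
  E / 3 * (2 * (2 * radial f (‖z‖ ^ 2) + ‖z‖ ^ 2 * radialD f (‖z‖ ^ 2)) * inner ℝ z h * inner ℝ a b
    - 2 * radialD f (‖z‖ ^ 2) * inner ℝ z h * inner ℝ z a * inner ℝ z b
    - radial f (‖z‖ ^ 2) * (inner ℝ h a * inner ℝ z b + inner ℝ z a * inner ℝ h b))

/-- The second derivative of `ker` at the origin. -/
noncomputable def kerQ (E c : ℝ) (a b h k : R3) : ℝ :=
  E / 3 * (-4 * c * inner ℝ h k * inner ℝ a b
    + c * (inner ℝ h a * inner ℝ k b + inner ℝ k a * inner ℝ h b))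

theorem hasDerivAt_norm_sq_line (z h : R3) (t : ℝ) :
    HasDerivAt (fun t : ℝ => ‖z + t • h‖ ^ 2) (2 * inner ℝ (z + t • h) h) t := by
  have h1 : HasDerivAt (fun t : ℝ => z + t • h) h t := by
    simpa using ((hasDerivAt_id t).smul_const h).const_add z
  exact h1.norm_sq

theorem hasDerivAt_inner_line (z h a : R3) (t : ℝ) :
    HasDerivAt (fun t : ℝ => inner ℝ (z + t • h) a) (inner ℝ h a) t := by
  have h1 : HasDerivAt (fun t : ℝ => z + t • h) h t := by
    simpa using ((hasDerivAt_id t).smul_const h).const_add z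
  simpa using h1.inner ℝ (hasDerivAt_const t a)

theorem sqrt_norm_sq (z : R3) : √(‖z‖ ^ 2) = ‖z‖ := Real.sqrt_sq (norm_nonneg z)

theorem hasDerivAt_ker_line_of_ne {E : ℝ} {f : ℝ → ℝ} (a b z h : R3) (t : ℝ) (hz : z + t • h ≠ 0)
    (hf : ContDiffAt ℝ 2 f ‖z + t • h‖) :
    HasDerivAt (fun t : ℝ => ker E f a b (z + t • h)) (kerD E f a b (z + t • h) h) t := by
  have hs : 0 < ‖z + t • h‖ ^ 2 := by positivity
  have hS := hasDerivAt_norm_sq_line z h t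
  have hψ : HasDerivAt (fun s => f (√s)) (radial f (‖z + t • h‖ ^ 2) / 2) (‖z + t • h‖ ^ 2) :=
    hasDerivAt_comp_sqrt hs (by rw [sqrt_norm_sq]; exact hf.differentiableAt (by norm_num))
  have hB := hasDerivAt_radial (f := f) hs
    (by rw [sqrt_norm_sq]; exact hf.deriv_of_two.differentiableAt (by norm_num))
  have h1 := hψ.comp t hS
  have h2 := hB.comp t hS
  have h3 := hasDerivAt_inner_line z h a t
  have h4 := hasDerivAt_inner_line z h b t
  have := (((h1.const_mul 2).add (hS.mul h2)).mul_const (inner ℝ a b)).sub ((h2.mul h3).mul h4)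
    |>.const_mul (E / 3)
  refine (this.congr_deriv ?_).congr_of_eventuallyEq (Eventually.of_forall fun t => ?_)
  · simp only [kerD, Function.comp, Pi.mul_apply]
    ring
  · simp only [ker, Function.comp, Pi.mul_apply, Pi.add_apply, Pi.sub_apply, sqrt_norm_sq]

theorem abs_inner_le (a b : R3) : |inner ℝ a b| ≤ ‖a‖ * ‖b‖ := abs_real_inner_le_norm a b

theorem sq_mul_radial (f : ℝ → ℝ) (z : R3) : ‖z‖ ^ 2 * radial f (‖z‖ ^ 2) = ‖z‖ * deriv f ‖z‖ := by
  rw [radial, sqrt_norm_sq]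
  rcases eq_or_ne ‖z‖ 0 with h | h
  · simp [h]
  · field_simp

/-- No singular factor survives: by Cauchy–Schwarz `⟨z, a⟩⟨z, b⟩` supplies the `‖z‖²` that turns
`radial` back into `‖z‖ f'(‖z‖)`. The estimate yields continuity and differentiability of the kernel
at the origin and its uniform boundedness. -/
theorem abs_ker_sub_zero_le {E : ℝ} (hE : 0 < E) {f : ℝ → ℝ} (a b z : R3) :
    |ker E f a b z - ker E f a b 0| ≤
      E / 3 * (2 * |f ‖z‖ - f 0| + 2 * (‖z‖ * |deriv f ‖z‖|)) * (‖a‖ * ‖b‖) := by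
  have h0 : ker E f a b 0 = E / 3 * (2 * f 0 * inner ℝ a b) := by simp [ker]
  have h1 : |radial f (‖z‖ ^ 2) * inner ℝ z a * inner ℝ z b| ≤
      ‖z‖ * |deriv f ‖z‖| * (‖a‖ * ‖b‖) := by
    calc _ = |radial f (‖z‖ ^ 2)| * |inner ℝ z a| * |inner ℝ z b| := by rw [abs_mul, abs_mul]
      _ ≤ |radial f (‖z‖ ^ 2)| * (‖z‖ * ‖a‖) * (‖z‖ * ‖b‖) := by
        gcongr <;> exact abs_inner_le _ _
      _ = |‖z‖ ^ 2 * radial f (‖z‖ ^ 2)| * (‖a‖ * ‖b‖) := by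
        rw [abs_mul, abs_of_nonneg (sq_nonneg ‖z‖)]; ring
      _ = _ := by rw [sq_mul_radial, abs_mul, abs_norm]
  have h2 : |(2 * (f ‖z‖ - f 0) + ‖z‖ * deriv f ‖z‖) * inner ℝ a b| ≤
      (2 * |f ‖z‖ - f 0| + ‖z‖ * |deriv f ‖z‖|) * (‖a‖ * ‖b‖) := by
    rw [abs_mul]
    gcongr
    · refine (abs_add_le _ _).trans ?_
      rw [abs_mul, abs_mul, abs_norm, abs_two]
    · exact abs_inner_le _ _
  rw [h0, ker, sq_mul_radial]
  calc _ = |E / 3 * ((2 * (f ‖z‖ - f 0) + ‖z‖ * deriv f ‖z‖) * inner ℝ a b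
        - radial f (‖z‖ ^ 2) * inner ℝ z a * inner ℝ z b)| := by congr 1; ring
    _ ≤ E / 3 * ((2 * |f ‖z‖ - f 0| + ‖z‖ * |deriv f ‖z‖|) * (‖a‖ * ‖b‖)
        + ‖z‖ * |deriv f ‖z‖| * (‖a‖ * ‖b‖)) := by
        rw [abs_mul, abs_of_pos (by positivity : 0 < E / 3)]
        gcongr
        exact (abs_sub _ _).trans (add_le_add h2 h1)
    _ = _ := by ring

theorem kerD_zero (E : ℝ) (f : ℝ → ℝ) (a b h : R3) : kerD E f a b 0 h = 0 := by simp [kerD]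

theorem continuousAt_ker {E : ℝ} (hE : 0 < E) {f : ℝ → ℝ} {a b z : R3}
    (hf : ContDiffAt ℝ 2 f ‖z‖) : ContinuousAt (ker E f a b) z := by
  have hf0 : ContinuousAt (fun z : R3 => f ‖z‖) z :=
    ContinuousAt.comp (g := f) hf.continuousAt continuous_norm.continuousAt
  have hf1 : ContinuousAt (fun z : R3 => deriv f ‖z‖) z :=
    ContinuousAt.comp (g := deriv f) hf.deriv_of_two.continuousAt continuous_norm.continuousAt
  rcases eq_or_ne z 0 with rfl | hz
  · rw [ContinuousAt, tendsto_iff_norm_sub_tendsto_zero]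
    refine squeeze_zero (fun _ => norm_nonneg _) (fun z => abs_ker_sub_zero_le hE a b z) ?_
    have : ContinuousAt (fun z : R3 => E / 3 * (2 * |f ‖z‖ - f 0| + 2 * (‖z‖ * |deriv f ‖z‖|))
        * (‖a‖ * ‖b‖)) 0 := by fun_prop
    simpa [ContinuousAt] using this.tendsto
  · unfold ker radial
    simp only [sqrt_norm_sq]
    have : ‖z‖ ≠ 0 := norm_ne_zero_iff.2 hz
    fun_prop (disch := assumption)

/-- Lines through the origin are included: as `f'(0) = 0`, the kernel differs from its value there
by `o(‖z‖)`, and `kerD` vanishes at 0. -/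
theorem hasDerivAt_ker_line {E : ℝ} (hE : 0 < E) {f : ℝ → ℝ} {c : ℝ} (h0 : RegularAtZero f c)
    (a b z h : R3) (t : ℝ) (hf : ContDiffAt ℝ 2 f ‖z + t • h‖) :
    HasDerivAt (fun t : ℝ => ker E f a b (z + t • h)) (kerD E f a b (z + t • h) h) t := by
  by_cases hz : z + t • h ≠ 0
  · exact hasDerivAt_ker_line_of_ne a b z h t hz hf
  push Not at hz
  have hd : HasDerivAt f 0 0 := by
    have := (h0.contDiffAt.differentiableAt (by norm_num)).hasDerivAt
    rwa [h0.deriv_zero] at this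
  have hc : ContinuousAt (deriv f) 0 := h0.contDiffAt.deriv_of_two.continuousAt
  have hn : Tendsto (fun z : R3 => ‖z‖) (𝓝 0) (𝓝 0) := by
    simpa using (continuous_norm (E := R3)).tendsto 0
  have h1 : (fun z : R3 => f ‖z‖ - f 0) =o[𝓝 0] fun z => ‖z‖ := by
    have := hd.isLittleO.comp_tendsto hn
    simpa [Function.comp_def] using this
  have h2 : (fun z : R3 => ‖z‖ * |deriv f ‖z‖|) =o[𝓝 0] fun z => ‖z‖ := by
    have h3 : (fun z : R3 => |deriv f ‖z‖|) =o[𝓝 0] fun _ => (1 : ℝ) := by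
      rw [isLittleO_one_iff]
      have := (hc.tendsto.comp hn).abs
      simpa [h0.deriv_zero, Function.comp_def] using this
    simpa using (isBigO_refl (fun z : R3 => ‖z‖) (𝓝 0)).mul_isLittleO h3
  have h3 : (fun z : R3 => ker E f a b z - ker E f a b 0) =o[𝓝 0] fun z => z := by
    refine IsBigO.trans_isLittleO (g := fun z : R3 =>
      E / 3 * (2 * |f ‖z‖ - f 0| + 2 * (‖z‖ * |deriv f ‖z‖|)) * (‖a‖ * ‖b‖)) ?_ ?_
    · refine IsBigO.of_bound 1 (Eventually.of_forall fun z => ?_)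
      rw [one_mul]
      exact (abs_ker_sub_zero_le hE a b z).trans (le_abs_self _)
    · have := ((((h1.norm_left.const_mul_left 2).add (h2.const_mul_left 2)).const_mul_left
        (E / 3)).const_mul_left (‖a‖ * ‖b‖)).of_norm_right
      simpa [mul_comm, mul_left_comm] using this
  have h4 : HasFDerivAt (ker E f a b) (0 : R3 →L[ℝ] ℝ) (z + t • h) := by
    rw [hz, hasFDerivAt_iff_isLittleO]
    simpa using h3
  have h5 : HasDerivAt (fun t : ℝ => z + t • h) h t := by
    simpa using ((hasDerivAt_id t).smul_const h).const_add z
  have := h4.comp_hasDerivAt t h5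
  rw [hz, kerD_zero]
  convert! this using 1


theorem abs_mul₃_le {x y z X Y Z : ℝ} (hx : |x| ≤ X) (hy : |y| ≤ Y) (hz : |z| ≤ Z) :
    |x * y * z| ≤ X * Y * Z := by
  have := (abs_nonneg x).trans hx
  have := (abs_nonneg y).trans hy
  rw [abs_mul, abs_mul]; gcongr

theorem abs_mul₄_le {w x y z W X Y Z : ℝ} (hw : |w| ≤ W) (hx : |x| ≤ X) (hy : |y| ≤ Y)
    (hz : |z| ≤ Z) : |w * x * y * z| ≤ W * X * Y * Z := by
  have := (abs_nonneg w).trans hw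
  have := (abs_nonneg x).trans hx
  have := (abs_nonneg y).trans hy
  rw [abs_mul, abs_mul, abs_mul]; gcongr

/-- The derivative of `kerD` along lines is close to `kerQ` where `B + c`, `s B'`, `s² B''` are
small. -/
theorem kerD_line_error {E : ℝ} (hE : 0 < E) {f : ℝ → ℝ} {c η : ℝ} (a b z h k : R3) (t : ℝ)
    (hz : z + t • k ≠ 0)
    (hf : DifferentiableAt ℝ (deriv f) ‖z + t • k‖)
    (hf' : DifferentiableAt ℝ (deriv (deriv f)) ‖z + t • k‖)
    (h0 : |radial f (‖z + t • k‖ ^ 2) + c| ≤ η)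
    (h1 : |‖z + t • k‖ ^ 2 * radialD f (‖z + t • k‖ ^ 2)| ≤ η)
    (h2 : |(‖z + t • k‖ ^ 2) ^ 2 * radialDD f (‖z + t • k‖ ^ 2)| ≤ η) :
    ∃ d : ℝ, HasDerivAt (fun t : ℝ => kerD E f a b (z + t • k) h - kerQ E c a b h (z + t • k)) d t
      ∧ |d| ≤ 13 * E * η * (‖h‖ * ‖k‖ * (‖a‖ * ‖b‖)) := by
  have hs : 0 < ‖z + t • k‖ ^ 2 := by positivity
  have hS := hasDerivAt_norm_sq_line z k t
  have hB := (hasDerivAt_radial (f := f) hs (by rwa [sqrt_norm_sq])).comp t hS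
  have hB1 := (hasDerivAt_radialD (f := f) hs (by rwa [sqrt_norm_sq])
    (by rwa [sqrt_norm_sq])).comp t hS
  have hh := hasDerivAt_inner_line z k h t
  have ha := hasDerivAt_inner_line z k a t
  have hb := hasDerivAt_inner_line z k b t
  -- Subtracting `kerQ` amounts to replacing `B` by `B + c` in the formula for `kerD`, so only small
  -- quantities are differentiated.
  have key := ((((((hB.add_const c).const_mul 2).add (hS.mul hB1)).const_mul 2).mul hh
    |>.mul_const (inner ℝ a b)).sub ((((hB1.const_mul 2).mul hh).mul ha).mul hb)).sub
    ((hB.add_const c).mul ((hb.const_mul (inner ℝ h a)).add (ha.mul_const (inner ℝ h b))))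
    |>.const_mul (E / 3)
  refine ⟨_, key.congr_of_eventuallyEq (Eventually.of_forall fun t => ?_), ?_⟩
  · simp only [kerD, kerQ, Function.comp, Pi.mul_apply, Pi.add_apply, Pi.sub_apply,
      real_inner_comm h (z + t • k)]
    ring
  · simp only [Function.comp, Pi.mul_apply, Pi.add_apply]
    set y := z + t • k with hy
    set r := ‖y‖ with hr
    have hr0 : 0 < r := norm_pos_iff.2 hz
    set B := radial f (r ^ 2)
    set B1 := radialD f (r ^ 2)
    set B2 := radialDD f (r ^ 2)
    have hη : 0 ≤ η := (abs_nonneg _).trans h0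
    -- Each inner product with `y` is paired with a factor `1/r`; the remaining powers of `r`
    -- combine with `B'` and `B''` into the small quantities `s B'` and `s² B''`.
    have unit : ∀ x : R3, |inner ℝ y x / r| ≤ ‖x‖ := fun x => by
      rw [abs_div, abs_of_pos hr0, div_le_iff₀ hr0, mul_comm]
      exact abs_inner_le y x
    have e1 : |(3 * (r ^ 2 * B1) + (r ^ 2) ^ 2 * B2) * (inner ℝ y k / r) * (inner ℝ y h / r)
        * inner ℝ a b| ≤ 4 * η * ‖k‖ * ‖h‖ * (‖a‖ * ‖b‖) := by
      refine abs_mul₄_le ?_ (unit k) (unit h) (abs_inner_le a b)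
      refine (abs_add_le _ _).trans ?_
      rw [abs_mul 3, abs_of_pos (by norm_num : (0 : ℝ) < 3)]
      linarith
    have e2 : |(2 * (B + c) + r ^ 2 * B1) * inner ℝ k h * inner ℝ a b|
        ≤ 3 * η * (‖k‖ * ‖h‖) * (‖a‖ * ‖b‖) := by
      refine abs_mul₃_le ?_ (abs_inner_le k h) (abs_inner_le a b)
      refine (abs_add_le _ _).trans ?_
      rw [abs_mul 2, abs_of_pos (by norm_num : (0 : ℝ) < 2)]
      linarith
    have e3 : |((r ^ 2) ^ 2 * B2 * (inner ℝ y k / r)) * (inner ℝ y h / r) * (inner ℝ y a / r)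
        * (inner ℝ y b / r)| ≤ (η * ‖k‖) * ‖h‖ * ‖a‖ * ‖b‖ := by
      refine abs_mul₄_le ?_ (unit h) (unit a) (unit b)
      rw [abs_mul]; gcongr; exact unit k
    have e4 : |r ^ 2 * B1 * inner ℝ k h * (inner ℝ y a / r) * (inner ℝ y b / r)|
        ≤ η * (‖k‖ * ‖h‖) * ‖a‖ * ‖b‖ := abs_mul₄_le h1 (abs_inner_le _ _) (unit a) (unit b)
    have e5 : |r ^ 2 * B1 * inner ℝ k a * (inner ℝ y h / r) * (inner ℝ y b / r)|
        ≤ η * (‖k‖ * ‖a‖) * ‖h‖ * ‖b‖ := abs_mul₄_le h1 (abs_inner_le _ _) (unit h) (unit b)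
    have e6 : |r ^ 2 * B1 * inner ℝ k b * (inner ℝ y h / r) * (inner ℝ y a / r)|
        ≤ η * (‖k‖ * ‖b‖) * ‖h‖ * ‖a‖ := abs_mul₄_le h1 (abs_inner_le _ _) (unit h) (unit a)
    have e7 : |r ^ 2 * B1 * inner ℝ h a * (inner ℝ y k / r) * (inner ℝ y b / r)|
        ≤ η * (‖h‖ * ‖a‖) * ‖k‖ * ‖b‖ := abs_mul₄_le h1 (abs_inner_le _ _) (unit k) (unit b)
    have e8 : |r ^ 2 * B1 * inner ℝ h b * (inner ℝ y k / r) * (inner ℝ y a / r)|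
        ≤ η * (‖h‖ * ‖b‖) * ‖k‖ * ‖a‖ := abs_mul₄_le h1 (abs_inner_le _ _) (unit k) (unit a)
    have e9 : |(B + c) * inner ℝ h a * inner ℝ k b| ≤ η * (‖h‖ * ‖a‖) * (‖k‖ * ‖b‖) :=
      abs_mul₃_le h0 (abs_inner_le _ _) (abs_inner_le _ _)
    have e10 : |(B + c) * inner ℝ k a * inner ℝ h b| ≤ η * (‖k‖ * ‖a‖) * (‖h‖ * ‖b‖) :=
      abs_mul₃_le h0 (abs_inner_le _ _) (abs_inner_le _ _)
    rw [abs_mul, abs_of_pos (by positivity : 0 < E / 3)]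
    have hr0' : r ≠ 0 := hr0.ne'
    rw [abs_le] at e1 e2 e3 e4 e5 e6 e7 e8 e9 e10
    have hN : 0 ≤ η * ‖h‖ * ‖k‖ * (‖a‖ * ‖b‖) := by positivity
    -- The weights add up to `4·4 + 2·3 + 4·1 + 5·2 + 2 = 38`. Rounding up to 39 gives the constant
    -- 13 after multiplication by `E / 3`.
    suffices |4 * ((3 * (r ^ 2 * B1) + (r ^ 2) ^ 2 * B2) * (inner ℝ y k / r) * (inner ℝ y h / r)
        * inner ℝ a b) + 2 * ((2 * (B + c) + r ^ 2 * B1) * inner ℝ k h * inner ℝ a b)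
        - 4 * (((r ^ 2) ^ 2 * B2 * (inner ℝ y k / r)) * (inner ℝ y h / r) * (inner ℝ y a / r)
        * (inner ℝ y b / r)) - 2 * (r ^ 2 * B1 * inner ℝ k h * (inner ℝ y a / r)
        * (inner ℝ y b / r)) - 2 * (r ^ 2 * B1 * inner ℝ k a * (inner ℝ y h / r)
        * (inner ℝ y b / r)) - 2 * (r ^ 2 * B1 * inner ℝ k b * (inner ℝ y h / r)
        * (inner ℝ y a / r)) - 2 * (r ^ 2 * B1 * inner ℝ h a * (inner ℝ y k / r)
        * (inner ℝ y b / r)) - 2 * (r ^ 2 * B1 * inner ℝ h b * (inner ℝ y k / r)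
        * (inner ℝ y a / r)) - (B + c) * inner ℝ h a * inner ℝ k b
        - (B + c) * inner ℝ k a * inner ℝ h b| ≤ 38 * (η * ‖h‖ * ‖k‖ * (‖a‖ * ‖b‖)) by
      have h39 : 38 * (η * ‖h‖ * ‖k‖ * (‖a‖ * ‖b‖)) ≤ 39 * (η * ‖h‖ * ‖k‖ * (‖a‖ * ‖b‖)) := by
        linarith
      calc _ ≤ E / 3 * (39 * (η * ‖h‖ * ‖k‖ * (‖a‖ * ‖b‖))) := by
            refine mul_le_mul_of_nonneg_left (le_trans (le_of_eq ?_) (this.trans h39))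
              (by positivity)
            congr 1
            field_simp
            ring
        _ = _ := by ring
    rw [abs_le]
    constructor <;> linarith

/-- Near the origin, `z ↦ kerD E f a b z h` differs from its linear part by a function with small
Lipschitz constant. -/
theorem kerD_strict {E : ℝ} (hE : 0 < E) {f : ℝ → ℝ} {c : ℝ} (hf : RegularAtZero f c) {η : ℝ}
    (hη : 0 < η) : ∃ δ > 0, ∀ a b h z z' : R3, ‖z‖ < δ → ‖z'‖ < δ →
      |kerD E f a b z' h - kerD E f a b z h - kerQ E c a b h (z' - z)|
        ≤ η * (‖h‖ * ‖z' - z‖ * (‖a‖ * ‖b‖)) := by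
  have small : ∀ η > 0, ∃ δ > 0, ∀ y : R3, y ≠ 0 → ‖y‖ < δ →
      DifferentiableAt ℝ (deriv f) ‖y‖ ∧ DifferentiableAt ℝ (deriv (deriv f)) ‖y‖ ∧
      |radial f (‖y‖ ^ 2) + c| ≤ η ∧ |‖y‖ ^ 2 * radialD f (‖y‖ ^ 2)| ≤ η ∧
      |(‖y‖ ^ 2) ^ 2 * radialDD f (‖y‖ ^ 2)| ≤ η := by
    intro η hη
    have hnorm : Tendsto (fun y : R3 => ‖y‖) (𝓝[≠] 0) (𝓝[>] 0) := by
      refine tendsto_nhdsWithin_iff.2 ⟨?_, ?_⟩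
      · simpa using ((continuous_norm (E := R3)).tendsto 0).mono_left nhdsWithin_le_nhds
      · filter_upwards [self_mem_nhdsWithin] with y hy using norm_pos_iff.2 hy
    have hsq : Tendsto (fun y : R3 => ‖y‖ ^ 2) (𝓝[≠] 0) (𝓝[>] 0) := by
      refine tendsto_nhdsWithin_iff.2 ⟨?_, ?_⟩
      · have : ContinuousAt (fun y : R3 => ‖y‖ ^ 2) 0 := by fun_prop
        simpa [ContinuousAt] using this.tendsto.mono_left nhdsWithin_le_nhds
      · filter_upwards [self_mem_nhdsWithin] with y (hy : y ≠ 0)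
        have : 0 < ‖y‖ := norm_pos_iff.2 hy
        exact (pow_pos this 2 :)
    have h1 : ∀ᶠ r in 𝓝[>] (0 : ℝ), DifferentiableAt ℝ (deriv f) r := by
      have : ∀ᶠ r in 𝓝 (0 : ℝ), ContDiffAt ℝ 2 f r := hf.contDiffAt.eventually (by simp)
      filter_upwards [this.filter_mono nhdsWithin_le_nhds] with r hr
      exact hr.deriv_of_two.differentiableAt (by norm_num)
    have h2 := hf.third.filter_mono
      (nhdsWithin_mono 0 (fun x (hx : (0:ℝ) < x) => hx.ne'))
    have h3 : ∀ᶠ s in 𝓝[>] (0 : ℝ), |radial f s + c| ≤ η := by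
      have := (hf.tendsto_radial.add_const c).abs
      rw [neg_add_cancel, abs_zero] at this
      exact this.eventually (Iic_mem_nhds hη)
    have h4 : ∀ᶠ s in 𝓝[>] (0 : ℝ), |s * radialD f s| ≤ η := by
      have := hf.tendsto_mul_radialD.abs
      rw [abs_zero] at this
      exact this.eventually (Iic_mem_nhds hη)
    have h5 : ∀ᶠ s in 𝓝[>] (0 : ℝ), |s ^ 2 * radialDD f s| ≤ η := by
      have := hf.tendsto_sq_mul_radialDD.abs
      rw [abs_zero] at this
      exact this.eventually (Iic_mem_nhds hη)
    have := (hnorm.eventually h1).and ((hnorm.eventually h2).and ((hsq.eventually h3).and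
      ((hsq.eventually h4).and (hsq.eventually h5))))
    rw [eventually_nhdsWithin_iff, Metric.eventually_nhds_iff] at this
    obtain ⟨δ, hδ, H⟩ := this
    exact ⟨δ, hδ, fun y hy0 hy => H (by simpa using hy) hy0⟩
  -- Needed for segments through the origin, where `kerD_line_error` says nothing: the difference is
  -- `o(‖y‖)` there, so its derivative at that point is 0.
  have size : ∀ η > 0, ∃ δ > 0, ∀ a b h y : R3, ‖y‖ < δ →
      |kerD E f a b y h - kerQ E c a b h y| ≤ η * (‖h‖ * (‖a‖ * ‖b‖)) * ‖y‖ := by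
    intro η hη
    obtain ⟨δ, hδ, H⟩ := small (η / (4 * E)) (by positivity)
    refine ⟨δ, hδ, fun a b h y hy => ?_⟩
    rcases eq_or_ne y 0 with rfl | hy0
    · simp [kerD, kerQ]
    obtain ⟨-, -, h0, h1, -⟩ := H y hy0 hy
    set η' := η / (4 * E) with hη'
    have hη'0 : 0 < η' := by positivity
    have hr0 : 0 < ‖y‖ := norm_pos_iff.2 hy0
    set r := ‖y‖ with hr
    have unit : ∀ x : R3, |inner ℝ y x / r| ≤ ‖x‖ := fun x => by
      rw [abs_div, abs_of_pos hr0, div_le_iff₀ hr0, mul_comm]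
      exact abs_inner_le y x
    set B := radial f (r ^ 2)
    set B1 := radialD f (r ^ 2)
    have e1 : |(2 * (B + c) + r ^ 2 * B1) * inner ℝ y h * inner ℝ a b|
        ≤ 3 * η' * (r * ‖h‖) * (‖a‖ * ‖b‖) := by
      refine abs_mul₃_le ?_ (abs_inner_le y h) (abs_inner_le a b)
      refine (abs_add_le _ _).trans ?_
      rw [abs_mul 2, abs_of_pos (by norm_num : (0 : ℝ) < 2)]
      linarith
    have e2 : |r ^ 2 * B1 * inner ℝ y h * (inner ℝ y a / r) * (inner ℝ y b / r)|
        ≤ η' * (r * ‖h‖) * ‖a‖ * ‖b‖ := abs_mul₄_le h1 (abs_inner_le _ _) (unit a) (unit b)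
    have e3 : |(B + c) * inner ℝ h a * inner ℝ y b| ≤ η' * (‖h‖ * ‖a‖) * (r * ‖b‖) :=
      abs_mul₃_le h0 (abs_inner_le _ _) (abs_inner_le _ _)
    have e4 : |(B + c) * inner ℝ y a * inner ℝ h b| ≤ η' * (r * ‖a‖) * (‖h‖ * ‖b‖) :=
      abs_mul₃_le h0 (abs_inner_le _ _) (abs_inner_le _ _)
    rw [abs_le] at e1 e2 e3 e4
    have hrn : r ≠ 0 := hr0.ne'
    have e : kerD E f a b y h - kerQ E c a b h y = E / 3 *
        (2 * ((2 * (B + c) + r ^ 2 * B1) * inner ℝ y h * inner ℝ a b)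
        - 2 * (r ^ 2 * B1 * inner ℝ y h * (inner ℝ y a / r) * (inner ℝ y b / r))
        - (B + c) * inner ℝ h a * inner ℝ y b - (B + c) * inner ℝ y a * inner ℝ h b) := by
      simp only [kerD, kerQ, real_inner_comm h y]
      change E / 3 * (2 * (2 * B + r ^ 2 * B1) * _ * _ - 2 * B1 * _ * _ * _ - B * _) - _ = _
      rw [real_inner_comm y h]
      field_simp
      ring
    rw [e, abs_mul, abs_of_pos (by positivity : 0 < E / 3)]
    have hN : 0 ≤ η' * (r * ‖h‖) * (‖a‖ * ‖b‖) := by positivity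
    -- The four terms weigh `2·3 + 2·1 + 1 + 1 = 10`; the round number 12 matches `η' = η / (4 E)`.
    calc _ ≤ E / 3 * (12 * (η' * (r * ‖h‖) * (‖a‖ * ‖b‖))) := by
          refine mul_le_mul_of_nonneg_left ?_ (by positivity)
          rw [abs_le]
          constructor <;> linarith
      _ = _ := by rw [hη']; field_simp; ring
  obtain ⟨δ, hδ, H⟩ := small (η / (13 * E)) (by positivity)
  refine ⟨δ, hδ, fun a b h z z' hz hz' => ?_⟩
  set N := ‖h‖ * ‖z' - z‖ * (‖a‖ * ‖b‖) with hN
  set k := z' - z with hk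
  have hderiv : ∀ t ∈ Set.Icc (0 : ℝ) 1, ∃ d : ℝ,
      HasDerivAt (fun t : ℝ => kerD E f a b (z + t • k) h - kerQ E c a b h (z + t • k)) d t
      ∧ |d| ≤ η * N := by
    intro t ht
    have hyδ : ‖z + t • k‖ < δ := by
      have : z + t • k ∈ Metric.ball (0 : R3) δ := by
        refine (convex_ball (0 : R3) δ).add_smul_sub_mem (x := z) (y := z') ?_ ?_ ht
        · simpa using hz
        · simpa using hz'
      simpa using this
    by_cases hy : z + t • k = 0
    · refine ⟨0, ?_, by simpa using by positivity⟩
      have h4 : HasFDerivAt (fun y => kerD E f a b y h - kerQ E c a b h y)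
          (0 : R3 →L[ℝ] ℝ) (z + t • k) := by
        rw [hy, hasFDerivAt_iff_isLittleO, isLittleO_iff]
        intro C hC
        obtain ⟨δ', hδ', H'⟩ := size (C / (‖h‖ * (‖a‖ * ‖b‖) + 1)) (by positivity)
        rw [Metric.eventually_nhds_iff]
        refine ⟨δ', hδ', fun y hy => ?_⟩
        have h0 : kerD E f a b 0 h - kerQ E c a b h 0 = 0 := by simp [kerD, kerQ]
        rw [h0]
        simp only [sub_zero, _root_.zero_apply, Real.norm_eq_abs]
        refine (H' a b h y (by simpa using hy)).trans ?_
        gcongr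
        rw [div_mul_eq_mul_div, div_le_iff₀ (by positivity)]
        nlinarith [show 0 ≤ ‖h‖ * (‖a‖ * ‖b‖) by positivity]
      have h5 : HasDerivAt (fun t : ℝ => z + t • k) k t := by
        simpa using ((hasDerivAt_id t).smul_const k).const_add z
      have := h4.comp_hasDerivAt t h5
      convert! this using 1
    · obtain ⟨d1, d2, d3, d4, d5⟩ := H _ hy hyδ
      obtain ⟨d, hd, hd'⟩ := kerD_line_error hE a b z h k t hy d1 d2 d3 d4 d5
      refine ⟨d, hd, hd'.trans (le_of_eq ?_)⟩
      rw [hN]; field_simp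
  choose! d hd hd' using hderiv
  have := norm_image_sub_le_of_norm_deriv_le_segment_01'
    (fun t ht => (hd t ht).hasDerivWithinAt) (C := η * N)
    (fun t ht => hd' t (Set.Ico_subset_Icc_self ht))
  rw [Real.norm_eq_abs] at this
  convert this using 2
  simp only [one_smul, zero_smul, add_zero, hk, add_sub_cancel, kerQ, inner_sub_right,
    inner_sub_left]
  ring

/-- Near the origin, the second difference of `ker` is close to `kerQ`. -/
theorem ker_second_difference {E : ℝ} (hE : 0 < E) {f : ℝ → ℝ} {c : ℝ} (hf : RegularAtZero f c)
    {η : ℝ} (hη : 0 < η) : ∃ δ > 0, ∀ a b z h k : R3, ‖z‖ < δ → ‖h‖ < δ → ‖k‖ < δ →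
      |ker E f a b (z + h + k) - ker E f a b (z + h) - ker E f a b (z + k) + ker E f a b z
        - kerQ E c a b h k| ≤ η * (‖h‖ * ‖k‖ * (‖a‖ * ‖b‖)) := by
  obtain ⟨δ₁, hδ₁, H₁⟩ := kerD_strict hE hf hη
  have : ∀ᶠ r in 𝓝 (0 : ℝ), ContDiffAt ℝ 2 f r := hf.contDiffAt.eventually (by simp)
  obtain ⟨δ₂, hδ₂, H₂⟩ := Metric.eventually_nhds_iff.1 this
  set δ := min δ₁ δ₂ with hδ
  have hδ0 : 0 < δ := lt_min hδ₁ hδ₂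
  -- A third of the radius for each of `z`, `h`, `k` keeps the four corners and the two segments
  -- inside the ball.
  refine ⟨δ / 3, by positivity, fun a b z h k hz hh hk => ?_⟩
  have bound : ∀ t ∈ Set.Icc (0 : ℝ) 1, ‖z + t • h‖ < δ ∧ ‖z + k + t • h‖ < δ := by
    intro t ht
    have h1 : ‖t • h‖ ≤ ‖h‖ := by
      rw [norm_smul, Real.norm_eq_abs, abs_of_nonneg ht.1]
      exact mul_le_of_le_one_left (norm_nonneg _) ht.2
    have h2 := norm_add_le z (t • h)
    have h3 := norm_add_le (z + k) (t • h)
    have h4 := norm_add_le z k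
    constructor <;> linarith
  have hC2 : ∀ y : R3, ‖y‖ < δ → ContDiffAt ℝ 2 f ‖y‖ := fun y hy =>
    H₂ (by simpa using hy.trans_le (min_le_right _ _))
  -- The second difference is the increment over `[0, 1]` of a first difference in the direction
  -- `k`, so the mean value inequality reduces it to `kerD_strict`.
  have hd : ∀ t ∈ Set.Icc (0 : ℝ) 1, HasDerivAt (fun t : ℝ => ker E f a b (z + k + t • h)
      - ker E f a b (z + t • h) - t * kerQ E c a b h k)
      (kerD E f a b (z + k + t • h) h - kerD E f a b (z + t • h) h - 1 * kerQ E c a b h k) t := by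
    intro t ht
    exact ((hasDerivAt_ker_line hE hf a b (z + k) h t (hC2 _ (bound t ht).2)).sub
      (hasDerivAt_ker_line hE hf a b z h t (hC2 _ (bound t ht).1))).sub
      ((hasDerivAt_id t).mul_const _)
  have := norm_image_sub_le_of_norm_deriv_le_segment_01'
    (fun t ht => (hd t ht).hasDerivWithinAt) (C := η * (‖h‖ * ‖k‖ * (‖a‖ * ‖b‖))) (fun t ht => by
      have ht' := Set.Ico_subset_Icc_self ht
      have := H₁ a b h (z + t • h) (z + k + t • h) ((bound t ht').1.trans_le (min_le_left _ _))
        ((bound t ht').2.trans_le (min_le_left _ _))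
      have e : z + k + t • h - (z + t • h) = k := by abel
      rwa [e, ← Real.norm_eq_abs, ← one_mul (kerQ E c a b h k)] at this)
  rw [Real.norm_eq_abs] at this
  convert this using 2
  simp only [one_smul, zero_smul, add_zero, one_mul, zero_mul, sub_zero,
    add_right_comm z h k]
  ring


/-! ### Algebra of the scalar kernels -/

theorem sum_mul_covTensor (E : ℝ) (f : ℝ → ℝ) (a b z : R3) :
    ∑ μ, ∑ ν, a μ * covTensor E f z μ ν * b ν = ker E f a b z := by
  have h1 : ∀ μ ν : Fin 3, ‖z‖ * deriv f ‖z‖ * ((if μ = ν then 1 else 0) - z μ * z ν / ‖z‖ ^ 2)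
      = ‖z‖ * deriv f ‖z‖ * (if μ = ν then 1 else 0) - radial f (‖z‖ ^ 2) * (z μ * z ν) := by
    intro μ ν
    rcases eq_or_ne z 0 with rfl | hz
    · simp
    · have : ‖z‖ ≠ 0 := norm_ne_zero_iff.2 hz
      rw [radial, sqrt_norm_sq]
      field_simp
  have h2 : ∀ x y : R3, inner ℝ x y = x 0 * y 0 + x 1 * y 1 + x 2 * y 2 := by
    intro x y
    simp [PiLp.inner_apply, Fin.sum_univ_three, mul_comm]
  have h3 : ∀ μ ν : Fin 3, covTensor E f z μ ν =
      E / 3 * ((2 * f ‖z‖ + ‖z‖ * deriv f ‖z‖) * (if μ = ν then 1 else 0)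
        - radial f (‖z‖ ^ 2) * (z μ * z ν)) := by
    intro μ ν
    rw [covTensor, mul_assoc (E / 3 * ‖z‖), mul_assoc (E / 3), ← mul_assoc ‖z‖, h1]
    ring
  simp only [h3, ker, sq_mul_radial, h2, Fin.sum_univ_three]
  norm_num [Fin.ext_iff]
  ring

theorem ker_comm (E : ℝ) (f : ℝ → ℝ) (a b z : R3) : ker E f a b z = ker E f b a z := by
  simp only [ker, real_inner_comm a b]; ring

theorem kerD_neg (E : ℝ) (f : ℝ → ℝ) (a b z h : R3) : kerD E f a b (-z) h = -kerD E f a b z h := by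
  simp only [kerD, norm_neg, inner_neg_left]; ring

theorem ker_smul_left (E : ℝ) (f : ℝ → ℝ) (t : ℝ) (a b z : R3) :
    ker E f (t • a) b z = t * ker E f a b z := by
  simp only [ker, inner_smul_left, inner_smul_right, conj_trivial]; ring

theorem ker_smul_right (E : ℝ) (f : ℝ → ℝ) (t : ℝ) (a b z : R3) :
    ker E f a (t • b) z = t * ker E f a b z := by
  rw [ker_comm, ker_smul_left, ker_comm]

theorem kerQ_comm (E c : ℝ) (a b h k : R3) : kerQ E c a b h k = kerQ E c a b k h := by
  simp only [kerQ, real_inner_comm h k]; ring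

theorem kerQ_smul_left (E c t : ℝ) (a b h k : R3) :
    kerQ E c a b (t • h) k = t * kerQ E c a b h k := by
  simp only [kerQ, inner_smul_left, conj_trivial]; ring

theorem kerQ_smul_right (E c t : ℝ) (a b h k : R3) :
    kerQ E c a b h (t • k) = t * kerQ E c a b h k := by
  rw [kerQ_comm, kerQ_smul_left, kerQ_comm]

/-- The standing assumptions on the domain and on the correlation function. -/
structure KernelDomain (Λ : Set R3) (E c : ℝ) (f : ℝ → ℝ) : Prop where
  isClosed : IsClosed Λ
  convex : Convex ℝ Λ
  bounded : Bornology.IsBounded Λ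
  zero_mem : (0 : R3) ∈ Λ
  interior_nonempty : (interior Λ).Nonempty
  pos : 0 < E
  regular : RegularAtZero f c
  contDiffAt : ∀ x ∈ Λ, ∀ y ∈ Λ, ContDiffAt ℝ 2 f ‖x - y‖

namespace KernelDomain
variable {Λ : Set R3} {E c : ℝ} {f : ℝ → ℝ} (K : KernelDomain Λ E c f)
include K

theorem isCompact : IsCompact Λ := Metric.isCompact_of_isClosed_isBounded K.isClosed K.bounded

theorem measurableSet : MeasurableSet Λ := K.isClosed.measurableSet

theorem volume_lt_top : volume Λ < ∞ := K.isCompact.measure_lt_top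

theorem volume_pos : 0 < volume Λ :=
  (isOpen_interior.measure_pos volume K.interior_nonempty).trans_le (measure_mono interior_subset)

theorem isFiniteMeasure : IsFiniteMeasure (volume.restrict Λ) :=
  ⟨by simpa using K.volume_lt_top⟩

theorem continuousOn_ker (a b : R3) :
    ContinuousOn (fun p : R3 × R3 => ker E f a b (p.1 - p.2)) (Λ ×ˢ Λ) := by
  rintro ⟨x, y⟩ ⟨hx, hy⟩
  have h1 : Tendsto (ker E f a b) (𝓝 (x - y)) (𝓝 (ker E f a b (x - y))) :=
    continuousAt_ker K.pos (K.contDiffAt x hx y hy)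
  have h2 : Tendsto (fun p : R3 × R3 => p.1 - p.2) (𝓝 (x, y)) (𝓝 (x - y)) :=
    (continuous_fst.sub continuous_snd).tendsto (x, y)
  exact (h1.comp h2).mono_left nhdsWithin_le_nhds

theorem exists_ker_bound : ∃ M > 0, ∀ x ∈ Λ, ∀ y ∈ Λ, ∀ a b : R3,
    |ker E f a b (x - y)| ≤ M * (‖a‖ * ‖b‖) := by
  have hcont : ContinuousOn (fun p : R3 × R3 =>
      E / 3 * (2 * |f ‖p.1 - p.2‖ - f 0| + 2 * (‖p.1 - p.2‖ * |deriv f ‖p.1 - p.2‖|)))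
      (Λ ×ˢ Λ) := by
    rintro ⟨x, y⟩ ⟨hx, hy⟩
    have h := K.contDiffAt x hx y hy
    have hn : ContinuousAt (fun p : R3 × R3 => ‖p.1 - p.2‖) (x, y) := by fun_prop
    have h1 : ContinuousAt (fun p : R3 × R3 => f ‖p.1 - p.2‖) (x, y) :=
      ContinuousAt.comp (g := f) h.continuousAt hn
    have h2 : ContinuousAt (fun p : R3 × R3 => deriv f ‖p.1 - p.2‖) (x, y) :=
      ContinuousAt.comp (g := deriv f) h.deriv_of_two.continuousAt hn
    refine ContinuousAt.continuousWithinAt ?_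
    fun_prop
  obtain ⟨M, hM⟩ := (K.isCompact.prod K.isCompact).exists_bound_of_continuousOn hcont
  have hM0 : 0 ≤ M := (norm_nonneg _).trans (hM (0, 0) ⟨K.zero_mem, K.zero_mem⟩)
  have hE := K.pos
  refine ⟨M + E / 3 * (2 * |f 0|) + 1, by positivity, fun x hx y hy a b => ?_⟩
  have h1 := abs_ker_sub_zero_le K.pos (f := f) a b (x - y)
  have h2 := (le_abs_self _).trans (hM (x, y) ⟨hx, hy⟩)
  have h3 : |ker E f a b 0| ≤ E / 3 * (2 * |f 0|) * (‖a‖ * ‖b‖) := by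
    have : ker E f a b 0 = E / 3 * (2 * f 0) * inner ℝ a b := by simp [ker]; ring
    rw [this, abs_mul, abs_mul, abs_mul, abs_of_pos (by positivity : 0 < E / 3), abs_two]
    gcongr
    exact abs_inner_le a b
  have h4 : |ker E f a b (x - y)| ≤ |ker E f a b (x - y) - ker E f a b 0| + |ker E f a b 0| := by
    simpa using abs_add_le (ker E f a b (x - y) - ker E f a b 0) (ker E f a b 0)
  have hab : 0 ≤ ‖a‖ * ‖b‖ := by positivity
  nlinarith [mul_le_mul_of_nonneg_right h2 hab]

end KernelDomain

/-! ### The Gaussian Hilbert space of the flow -/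

section GaussianSpace
variable {Ω : Type*} [MeasurableSpace Ω] {P : Measure Ω} [IsProbabilityMeasure P]

/-- Mean-square convergence implies almost sure convergence along a subsequence, and the
exponentials are bounded by 1. A subsequence is enough to identify the law of the limit. -/
theorem tendsto_charFun_map_of_tendsto_Lp {ξ : ℕ → Lp ℝ 2 P} {ζ : Lp ℝ 2 P}
    (h : Tendsto ξ atTop (𝓝 ζ)) : ∃ ns : ℕ → ℕ, StrictMono ns ∧ ∀ t : ℝ,
      Tendsto (fun n => charFun (P.map (ξ (ns n))) t) atTop (𝓝 (charFun (P.map ζ) t)) := by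
  have h1 := tendstoInMeasure_of_tendsto_Lp h
  obtain ⟨ns, hns, hae⟩ := h1.exists_seq_tendsto_ae
  refine ⟨ns, hns, fun t => ?_⟩
  have h2 : ∀ η : Lp ℝ 2 P, charFun (P.map η) t
      = ∫ ω, Complex.exp (t * (η ω : ℝ) * Complex.I) ∂P := fun η => by
    rw [charFun_apply_real, integral_map (Lp.aestronglyMeasurable η).aemeasurable (by fun_prop)]
  simp only [h2]
  refine tendsto_integral_of_dominated_convergence (fun _ => 1) (fun n => ?_)
    (integrable_const _) (fun n => ?_) ?_
  · have := (Lp.aestronglyMeasurable (ξ (ns n)))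
    exact (Complex.continuous_exp.comp ((continuous_const.mul Complex.continuous_ofReal).mul
      continuous_const)).comp_aestronglyMeasurable this
  · refine Eventually.of_forall fun ω => ?_
    rw [← Complex.ofReal_mul, Complex.norm_exp_ofReal_mul_I]
  · filter_upwards [hae] with ω hω
    exact ((Complex.continuous_exp.comp ((continuous_const.mul Complex.continuous_ofReal).mul
      continuous_const)).tendsto _).comp hω

omit [IsProbabilityMeasure P] in
theorem variance_Lp_of_integral_eq_zero {ξ : Lp ℝ 2 P} (h0 : ∫ ω, ξ ω ∂P = 0) :
    Var[ξ; P] = ‖ξ‖ ^ 2 := by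
  rw [variance_of_integral_eq_zero (Lp.aestronglyMeasurable ξ).aemeasurable h0,
    ← real_inner_self_eq_norm_sq, L2.inner_def]
  simp [pow_two]

theorem integral_Lp_eq_inner (ξ : Lp ℝ 2 P) :
    ∫ ω, ξ ω ∂P = inner ℝ (Lp.const 2 P (1 : ℝ)) ξ := by
  rw [L2.inner_def]
  refine integral_congr_ae ?_
  filter_upwards [Lp.coeFn_const (p := 2) (μ := P) (1 : ℝ)] with ω hω
  rw [hω]; simp

/-- Centred Gaussian variables form a closed subset of `L²`. -/
theorem centredGaussian_of_tendsto {ξ : ℕ → Lp ℝ 2 P} {ζ : Lp ℝ 2 P}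
    (h : Tendsto ξ atTop (𝓝 ζ)) (hG : ∀ n, HasGaussianLaw (ξ n) P) (h0 : ∀ n, ∫ ω, ξ n ω ∂P = 0) :
    HasGaussianLaw ζ P ∧ ∫ ω, ζ ω ∂P = 0 := by
  have hmean : ∫ ω, ζ ω ∂P = 0 := by
    have h1 : Tendsto (fun n => ∫ ω, ξ n ω ∂P) atTop (𝓝 (∫ ω, ζ ω ∂P)) := by
      simp only [integral_Lp_eq_inner]
      exact tendsto_const_nhds.inner h
    simp only [h0] at h1
    exact tendsto_nhds_unique h1 tendsto_const_nhds
  refine ⟨?_, hmean⟩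
  obtain ⟨ns, hns, hchar⟩ := tendsto_charFun_map_of_tendsto_Lp h
  -- For a centred Gaussian variable the characteristic function is a continuous function of the
  -- `L²` norm alone, so it passes to the limit.
  have hcf : ∀ η : Lp ℝ 2 P, HasGaussianLaw η P → ∫ ω, η ω ∂P = 0 → ∀ t : ℝ,
      charFun (P.map η) t = Complex.exp (-((t ^ 2 * ‖η‖ ^ 2 : ℝ) : ℂ) / 2) := by
    intro η hη h0 t
    rw [hη.map_eq_gaussianReal, h0, variance_Lp_of_integral_eq_zero h0, charFun_gaussianReal]
    congr 1
    simp
    ring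
  have hmap : P.map ζ = gaussianReal 0 (‖ζ‖ ^ 2).toNNReal := by
    have : IsProbabilityMeasure (P.map ζ) :=
      Measure.isProbabilityMeasure_map (Lp.aestronglyMeasurable ζ).aemeasurable
    refine Measure.ext_of_charFun (funext fun t => ?_)
    have h1 : Tendsto (fun n => charFun (P.map (ξ (ns n))) t) atTop
        (𝓝 (Complex.exp (-((t ^ 2 * ‖ζ‖ ^ 2 : ℝ) : ℂ) / 2))) := by
      simp only [hcf _ (hG _) (h0 _)]
      have h2 : Tendsto (fun n => ‖ξ (ns n)‖) atTop (𝓝 ‖ζ‖) := (h.comp hns.tendsto_atTop).norm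
      have hc : Continuous fun x : ℝ => Complex.exp (-((t ^ 2 * x ^ 2 : ℝ) : ℂ) / 2) := by
        fun_prop
      exact (hc.tendsto _).comp h2
    rw [tendsto_nhds_unique (hchar t) h1, charFun_gaussianReal]
    congr 1
    simp
    ring
  exact ⟨by rw [hmap]; infer_instance⟩

/-- A constant which bounds the fourth moment of a centred Gaussian variable by the square of
its second moment. -/
noncomputable def fourthMoment : ℝ≥0∞ := ∫⁻ x, ‖x‖ₑ ^ 4 ∂(gaussianReal 0 1)

theorem fourthMoment_lt_top : fourthMoment < ∞ := by
  have h := (memLp_id_gaussianReal (μ := 0) (v := 1) 4).eLpNorm_lt_top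
  have := (eLpNorm_lt_top_iff_lintegral_rpow_enorm_lt_top (p := 4) (by norm_num)
    (by norm_num)).1 (by simpa using h)
  simpa only [fourthMoment, ENNReal.toReal_ofNat, ENNReal.rpow_ofNat, id] using this

omit [IsProbabilityMeasure P] in
-- A centred Gaussian variable has the law of its standard deviation times a standard one, also when
-- it is degenerate. This upgrades covariance estimates to the fourth moments that Morrey's
-- inequality requires.
theorem lintegral_enorm_pow_four {ξ : Ω → ℝ} (hG : HasGaussianLaw ξ P) (h0 : ∫ ω, ξ ω ∂P = 0) :
    ∫⁻ ω, ‖ξ ω‖ₑ ^ 4 ∂P = fourthMoment * ENNReal.ofReal (∫ ω, ξ ω ^ 2 ∂P) ^ 2 := by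
  have hv : Var[ξ; P] = ∫ ω, ξ ω ^ 2 ∂P := variance_of_integral_eq_zero hG.aemeasurable h0
  have h1 : P.map ξ = (gaussianReal 0 1).map (√(∫ ω, ξ ω ^ 2 ∂P) * ·) := by
    rw [hG.map_eq_gaussianReal, h0, hv, gaussianReal_map_const_mul]
    congr 1
    · simp
    · ext
      have : 0 ≤ ∫ ω, ξ ω ^ 2 ∂P := integral_nonneg fun ω => sq_nonneg _
      simp [Real.sq_sqrt this, this]
  have h2 : ∫⁻ ω, ‖ξ ω‖ₑ ^ 4 ∂P = ∫⁻ x, ‖x‖ₑ ^ 4 ∂(P.map ξ) := by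
    rw [lintegral_map' (by fun_prop) hG.aemeasurable]
  rw [h2, h1, lintegral_map (by fun_prop) (by fun_prop)]
  simp only [enorm_mul, mul_pow]
  rw [lintegral_const_mul _ (by fun_prop), fourthMoment, mul_comm]
  congr 1
  have : 0 ≤ ∫ ω, ξ ω ^ 2 ∂P := integral_nonneg fun ω => sq_nonneg _
  rw [Real.enorm_eq_ofReal (Real.sqrt_nonneg _), ← ENNReal.ofReal_pow (Real.sqrt_nonneg _),
    ← ENNReal.ofReal_pow this]
  congr 1
  nlinarith [Real.sq_sqrt this]

variable {Λ : Set R3} {E : ℝ} {f : ℝ → ℝ} {v : Ω → L2Field Λ} (hv : IsGaussianFlow P Λ E f v)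

omit [IsProbabilityMeasure P] in
theorem IsGaussianFlow.memLp (hv : IsGaussianFlow P Λ E f v) (φ : L2Field Λ) :
    MemLp (fun ω => inner ℝ φ (v ω)) 2 P := (hv.gaussian φ).memLp_two

/-- The random variable `⟨φ, v⟩` as an element of `L²(P)`. -/
noncomputable def pairing (hv : IsGaussianFlow P Λ E f v) : L2Field Λ →ₗ[ℝ] Lp ℝ 2 P where
  toFun φ := (hv.memLp φ).toLp
  map_add' φ ψ := by
    rw [← MemLp.toLp_add]
    exact MemLp.toLp_congr _ _ (Eventually.of_forall fun ω => by simp [inner_add_left])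
  map_smul' t φ := by
    rw [RingHom.id_apply, ← MemLp.toLp_const_smul]
    exact MemLp.toLp_congr _ _ (Eventually.of_forall fun ω => by simp [inner_smul_left])

omit [IsProbabilityMeasure P] in
theorem coeFn_pairing (φ : L2Field Λ) : pairing hv φ =ᵐ[P] fun ω => inner ℝ φ (v ω) :=
  (hv.memLp φ).coeFn_toLp

omit [IsProbabilityMeasure P] in
theorem inner_pairing (φ ψ : L2Field Λ) : inner ℝ (pairing hv φ) (pairing hv ψ)
    = ∫ x in Λ, ∫ y in Λ, ker E f (φ x) (ψ y) (x - y) := by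
  have h := hv.covariance φ ψ
  simp only [sum_mul_covTensor] at h
  rw [← h, L2.inner_def]
  refine integral_congr_ae ?_
  filter_upwards [coeFn_pairing hv φ, coeFn_pairing hv ψ] with ω h1 h2
  rw [h1, h2, real_inner_eq_re_inner, RCLike.inner_apply]
  simp [mul_comm]

/-- The closed linear span of the variables `⟨φ, v⟩` in `L²(P)`. -/
noncomputable def gaussianSpace (hv : IsGaussianFlow P Λ E f v) : Submodule ℝ (Lp ℝ 2 P) :=
  (LinearMap.range (pairing hv)).topologicalClosure

omit [IsProbabilityMeasure P] in
theorem pairing_mem (φ : L2Field Λ) : pairing hv φ ∈ gaussianSpace hv :=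
  Submodule.le_topologicalClosure _ ⟨φ, rfl⟩

omit [IsProbabilityMeasure P] in
theorem isClosed_gaussianSpace : IsClosed (gaussianSpace hv : Set (Lp ℝ 2 P)) :=
  Submodule.isClosed_topologicalClosure _

/-- Values and derivatives of the flow arise as `L²` limits inside this closed subspace. Since
linear combinations stay in it, membership also yields joint Gaussianity. -/
theorem centredGaussian_of_mem {ξ : Lp ℝ 2 P} (hξ : ξ ∈ gaussianSpace hv) :
    HasGaussianLaw ξ P ∧ ∫ ω, ξ ω ∂P = 0 := by
  obtain ⟨u, hu, hlim⟩ := mem_closure_iff_seq_limit.1 hξ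
  refine centredGaussian_of_tendsto hlim (fun n => ?_) (fun n => ?_)
  · obtain ⟨φ, hφ⟩ := hu n
    rw [← hφ]
    exact (hv.gaussian φ).congr (coeFn_pairing hv φ).symm
  · obtain ⟨φ, hφ⟩ := hu n
    rw [← hφ, integral_congr_ae (coeFn_pairing hv φ)]
    exact hv.mean_zero φ

end GaussianSpace

/-! ### Morrey's inequality on convex sets of `ℝ³`, exponent `4` -/

theorem enorm_sub_le_lintegral_fderiv {u : R3 → R3} (hu : ContDiff ℝ 1 u) (x y : R3) :
    ‖u x - u y‖ₑ ≤ ‖x - y‖ₑ * ∫⁻ s in Set.Ioc (0 : ℝ) 1, ‖fderiv ℝ u (y + s • (x - y))‖ₑ := by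
  have hc : Continuous fun s : ℝ => fderiv ℝ u (y + s • (x - y)) :=
    (hu.continuous_fderiv one_ne_zero).comp (by fun_prop)
  have hd : ∀ s ∈ Set.uIcc (0 : ℝ) 1, HasDerivAt (fun s : ℝ => u (y + s • (x - y)))
      (fderiv ℝ u (y + s • (x - y)) (x - y)) s := by
    intro s _
    have h1 : HasDerivAt (fun t : ℝ => y + t • (x - y)) (x - y) s := by
      simpa using ((hasDerivAt_id s).smul_const (x - y)).const_add y
    exact ((hu.differentiable one_ne_zero _).hasFDerivAt).comp_hasDerivAt s h1
  have h2 := intervalIntegral.integral_eq_sub_of_hasDerivAt hd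
    ((hc.clm_apply continuous_const).intervalIntegrable 0 1)
  simp only [one_smul, add_sub_cancel, zero_smul, add_zero] at h2
  rw [← h2, intervalIntegral.integral_of_le zero_le_one]
  refine (enorm_integral_le_lintegral_enorm _).trans ?_
  rw [← lintegral_const_mul' _ _ enorm_ne_top]
  refine lintegral_mono fun s => ?_
  rw [mul_comm]
  exact ContinuousLinearMap.le_opENorm _ _

/-- Contraction towards a point of a convex set: change of variables. -/
theorem setLIntegral_comp_contraction_le {K : Set R3} (hK : Convex ℝ K) (hm : MeasurableSet K)
    {g : R3 → ℝ≥0∞} (hg : Measurable g) {y : R3} (hy : y ∈ K) {s : ℝ} (hs : s ∈ Set.Ioc (0 : ℝ) 1) :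
    ∫⁻ x in K, g (y + s • (x - y)) ≤ ENNReal.ofReal (s ^ (-3 : ℝ)) * ∫⁻ x in K, g x := by
  have h1 : ∫⁻ x in K, g (y + s • (x - y)) ≤ ∫⁻ x, K.indicator g (y + s • (x - y)) := by
    rw [← lintegral_indicator hm]
    refine lintegral_mono fun x => ?_
    by_cases hx : x ∈ K
    · have : y + s • (x - y) ∈ K := hK.add_smul_sub_mem hy hx ⟨hs.1.le, hs.2⟩
      simp [hx, this]
    · simp [hx]
  refine h1.trans (le_of_eq ?_)
  have hgi : Measurable (K.indicator g) := hg.indicator hm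
  rw [lintegral_sub_right_eq_self (fun x => K.indicator g (y + s • x)) y]
  have h2 : ∫⁻ x, K.indicator g (y + s • x) = ∫⁻ x, K.indicator g (y + x)
      ∂(Measure.map (s • ·) (volume : Measure R3)) := by
    rw [lintegral_map (by fun_prop) (by fun_prop)]
  rw [h2, Measure.map_addHaar_smul _ hs.1.ne', lintegral_smul_measure,
    lintegral_add_left_eq_self, lintegral_indicator hm, smul_eq_mul]
  congr 2
  have : (0 : ℝ) < s := hs.1
  rw [abs_of_pos (by positivity), Real.rpow_neg this.le]
  congr 1
  simp

/-- The exponent is the dimension 3 divided by the integrability exponent 4; the integral converges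
because 4 > 3. -/
theorem lintegral_rpow_neg_three_quarters :
    ∫⁻ s in Set.Ioc (0 : ℝ) 1, ENNReal.ofReal (s ^ (-3 / 4 : ℝ)) = 4 := by
  rw [← ofReal_integral_eq_lintegral_ofReal, ← intervalIntegral.integral_of_le zero_le_one,
    integral_rpow (by norm_num)]
  · norm_num
  · exact (intervalIntegrable_iff_integrableOn_Ioc_of_le zero_le_one).1
      (intervalIntegral.intervalIntegrable_rpow' (by norm_num))
  · filter_upwards [ae_restrict_mem measurableSet_Ioc] with s hs using Real.rpow_nonneg hs.1.le _

theorem setLIntegral_le_rpow {K : Set R3} {g : R3 → ℝ≥0∞} (hg : Measurable g) :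
    ∫⁻ x in K, g x ≤ volume K ^ (3 / 4 : ℝ) * (∫⁻ x in K, g x ^ 4) ^ (1 / 4 : ℝ) := by
  have h := ENNReal.lintegral_mul_le_Lp_mul_Lq (volume.restrict K)
    (p := 4 / 3) (q := 4) (Real.holderConjugate_iff.2 ⟨by norm_num, by norm_num⟩)
    (f := fun _ => 1) (g := g) aemeasurable_const hg.aemeasurable
  simp only [Pi.mul_apply, one_mul, ENNReal.one_rpow, lintegral_const, Measure.restrict_apply_univ]
    at h
  refine h.trans (le_of_eq ?_)
  norm_num

/-- Integrating the gradient along segments ending at `y` and exchanging the integrals leaves, for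
each `s`, the gradient on a copy of `K` contracted by `s` towards `y`. The Jacobian `s ^ (-3)`
becomes `s ^ (-3/4)` under the fourth root from Hölder's inequality. -/
theorem setLIntegral_enorm_sub_le {K : Set R3} (hK : Convex ℝ K) (hm : MeasurableSet K) {d : ℝ}
    (hd : ∀ x ∈ K, ∀ y ∈ K, ‖x - y‖ ≤ d) {u : R3 → R3} (hu : ContDiff ℝ 1 u) {y : R3}
    (hy : y ∈ K) :
    ∫⁻ x in K, ‖u x - u y‖ₑ ≤ ENNReal.ofReal (4 * d) *
      (volume K ^ (3 / 4 : ℝ) * (∫⁻ x in K, ‖fderiv ℝ u x‖ₑ ^ 4) ^ (1 / 4 : ℝ)) := by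
  set g : R3 → ℝ≥0∞ := fun x => ‖fderiv ℝ u x‖ₑ with hg
  have hgc : Continuous g := (hu.continuous_fderiv one_ne_zero).enorm
  set M := volume K ^ (3 / 4 : ℝ) * (∫⁻ x in K, g x ^ 4) ^ (1 / 4 : ℝ) with hM
  have hd0 : 0 ≤ d := (norm_nonneg _).trans (hd y hy y hy)
  calc ∫⁻ x in K, ‖u x - u y‖ₑ
      ≤ ∫⁻ x in K, ENNReal.ofReal d * ∫⁻ s in Set.Ioc (0 : ℝ) 1, g (y + s • (x - y)) := by
        refine setLIntegral_mono' hm fun x hx => ?_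
        refine (enorm_sub_le_lintegral_fderiv hu x y).trans ?_
        gcongr
        rw [← ofReal_norm]
        exact ENNReal.ofReal_le_ofReal (hd x hx y hy)
    _ = ENNReal.ofReal d * ∫⁻ s in Set.Ioc (0 : ℝ) 1, ∫⁻ x in K, g (y + s • (x - y)) := by
        rw [lintegral_const_mul' _ _ ENNReal.ofReal_ne_top, lintegral_lintegral_swap]
        exact (hgc.comp (by fun_prop : Continuous fun p : R3 × ℝ =>
          y + p.2 • (p.1 - y))).aemeasurable
    _ ≤ ENNReal.ofReal d * ∫⁻ s in Set.Ioc (0 : ℝ) 1, ENNReal.ofReal (s ^ (-3 / 4 : ℝ)) * M := by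
        gcongr ENNReal.ofReal d * ?_
        refine setLIntegral_mono' measurableSet_Ioc fun s hs => ?_
        refine (setLIntegral_le_rpow (g := fun x => g (y + s • (x - y)))
          (by have := hgc.measurable; fun_prop)).trans ?_
        rw [hM, mul_left_comm]
        gcongr
        refine (ENNReal.rpow_le_rpow (setLIntegral_comp_contraction_le hK hm
          (hgc.measurable.pow_const 4) hy hs) (by norm_num : (0 : ℝ) ≤ 1 / 4)).trans (le_of_eq ?_)
        rw [ENNReal.mul_rpow_of_nonneg _ _ (by norm_num),
          ENNReal.ofReal_rpow_of_nonneg (Real.rpow_nonneg hs.1.le _) (by norm_num),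
          ← Real.rpow_mul hs.1.le]
        norm_num
    _ = ENNReal.ofReal (4 * d) * M := by
        rw [lintegral_mul_const _ (by fun_prop), lintegral_rpow_neg_three_quarters, ← mul_assoc,
          ENNReal.ofReal_mul (by norm_num)]
        congr 1
        rw [mul_comm]
        norm_num

/-- Morrey's inequality. -/
theorem enorm_sub_le_morrey {K : Set R3} (hK : Convex ℝ K) (hm : MeasurableSet K) {d : ℝ}
    (hd : ∀ x ∈ K, ∀ y ∈ K, ‖x - y‖ ≤ d) (h0 : volume K ≠ 0) (hfin : volume K ≠ ∞)
    {u : R3 → R3} (hu : ContDiff ℝ 1 u) {y y' : R3} (hy : y ∈ K) (hy' : y' ∈ K) :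
    ‖u y - u y'‖ₑ ≤ ENNReal.ofReal (8 * d) *
      ((volume K)⁻¹ * ∫⁻ x in K, ‖fderiv ℝ u x‖ₑ ^ 4) ^ (1 / 4 : ℝ) := by
  set I := ∫⁻ x in K, ‖fderiv ℝ u x‖ₑ ^ 4
  set V := volume K
  have hd0 : 0 ≤ d := (norm_nonneg _).trans (hd y hy y hy)
  -- The triangle inequality through a third point `x` is averaged over `x ∈ K`; each half
  -- contributes `4 d`.
  have h1 : V * ‖u y - u y'‖ₑ ≤ ENNReal.ofReal (8 * d) *
      (V ^ (3 / 4 : ℝ) * I ^ (1 / 4 : ℝ)) := by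
    calc V * ‖u y - u y'‖ₑ = ∫⁻ x in K, ‖u y - u y'‖ₑ := by simp [V, mul_comm]
      _ ≤ ∫⁻ x in K, (‖u x - u y‖ₑ + ‖u x - u y'‖ₑ) := by
        refine lintegral_mono fun x => ?_
        have : u y - u y' = (u x - u y') - (u x - u y) := by abel
        rw [this, add_comm]
        exact enorm_sub_le
      _ ≤ ENNReal.ofReal (4 * d) * (V ^ (3 / 4 : ℝ) * I ^ (1 / 4 : ℝ)) +
          ENNReal.ofReal (4 * d) * (V ^ (3 / 4 : ℝ) * I ^ (1 / 4 : ℝ)) := by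
        rw [lintegral_add_left (by have := hu.continuous; fun_prop)]
        exact add_le_add (setLIntegral_enorm_sub_le hK hm hd hu hy)
          (setLIntegral_enorm_sub_le hK hm hd hu hy')
      _ = _ := by
        rw [← add_mul, ← ENNReal.ofReal_add (by positivity) (by positivity)]
        congr 2; ring
  calc ‖u y - u y'‖ₑ = V⁻¹ * (V * ‖u y - u y'‖ₑ) := by
        rw [← mul_assoc, ENNReal.inv_mul_cancel h0 hfin, one_mul]
    _ ≤ V⁻¹ * (ENNReal.ofReal (8 * d) * (V ^ (3 / 4 : ℝ) * I ^ (1 / 4 : ℝ))) := by gcongr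
    _ = _ := by
        rw [ENNReal.mul_rpow_of_nonneg _ _ (by norm_num), ENNReal.inv_rpow,
          ← ENNReal.rpow_neg, ← ENNReal.rpow_neg_one V]
        have : V ^ (-(1 / 4) : ℝ) = V ^ (-1 : ℝ) * V ^ (3 / 4 : ℝ) := by
          rw [← ENNReal.rpow_add _ _ h0 hfin]; norm_num
        rw [this]; ring

/-! ### Lebesgue points and limits of smooth fields -/

theorem enorm_sub_pow_four_le {F : Type*} [NormedAddCommGroup F] (a b c : F) :
    ‖a - c‖ₑ ^ 4 ≤ 8 * (‖a - b‖ₑ ^ 4 + ‖b - c‖ₑ ^ 4) := by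
  have h1 : ‖a - c‖ₑ ≤ ‖a - b‖ₑ + ‖b - c‖ₑ := by
    rw [← sub_add_sub_cancel a b c]; exact enorm_add_le _ _
  refine (pow_le_pow_left' h1 4).trans ?_
  have := ENNReal.rpow_add_le_mul_rpow_add_rpow ‖a - b‖ₑ ‖b - c‖ₑ (p := 4) (by norm_num)
  norm_num at this ⊢
  exact_mod_cast this

/-- Lebesgue differentiation applies to `‖G - c‖⁴` for a fixed constant `c`. Running it over a
countable dense set of `c` and choosing `c` close to `G z` gives one null set that works for the
constant `G z`. -/
theorem ae_lebesguePoint_pow_four {F : Type*} [NormedAddCommGroup F] [MeasurableSpace F]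
    [BorelSpace F] [SecondCountableTopology F] {Λ : Set R3} (hm : MeasurableSet Λ)
    (hfin : volume Λ < ∞) {G : R3 → F} (hG : Measurable G)
    (hint : ∫⁻ x in Λ, ‖G x‖ₑ ^ 4 < ∞) :
    ∀ᵐ z, z ∈ interior Λ → ∀ ε : ℝ≥0∞, 0 < ε → ∀ᶠ r in 𝓝[>] (0 : ℝ),
      Metric.closedBall z r ⊆ Λ ∧
      ∫⁻ x in Metric.closedBall z r, ‖G x - G z‖ₑ ^ 4 ≤ ε * volume (Metric.closedBall z r) := by
  obtain ⟨D, hDc, hDd⟩ := TopologicalSpace.exists_countable_dense F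
  have h1 : ∀ᵐ z : R3, ∀ c ∈ D, Tendsto (fun r => (∫⁻ x in Metric.closedBall z r,
      Λ.indicator (fun x => ‖G x - c‖ₑ ^ 4) x) / volume (Metric.closedBall z r)) (𝓝[>] 0)
      (𝓝 (Λ.indicator (fun x => ‖G x - c‖ₑ ^ 4) z)) := by
    rw [ae_ball_iff hDc]
    intro c _
    have := (Besicovitch.vitaliFamily (volume : Measure R3)).ae_tendsto_lintegral_div
      (f := Λ.indicator (fun x => ‖G x - c‖ₑ ^ 4))
      ((((hG.sub_const c).enorm).pow_const 4).indicator hm).aemeasurable ?_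
    · filter_upwards [this] with z hz
      exact hz.comp (Besicovitch.tendsto_filterAt volume z)
    · rw [lintegral_indicator hm]
      refine ne_of_lt (lt_of_le_of_lt (lintegral_mono fun x =>
        enorm_sub_pow_four_le (G x) 0 c) ?_)
      simp only [sub_zero, zero_sub, enorm_neg]
      rw [lintegral_const_mul _ (by fun_prop), lintegral_add_left (by fun_prop)]
      refine ENNReal.mul_lt_top (by norm_num) (ENNReal.add_lt_top.2 ⟨hint, ?_⟩)
      simp only [lintegral_const, Measure.restrict_apply_univ]
      exact ENNReal.mul_lt_top (by simp) hfin
  filter_upwards [h1] with z hz hzΛ ε hε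
  have hball : ∀ᶠ r in 𝓝[>] (0 : ℝ), Metric.closedBall z r ⊆ Λ := by
    obtain ⟨r₀, hr₀, hsub⟩ := Metric.isOpen_iff.1 isOpen_interior z hzΛ
    filter_upwards [Ioo_mem_nhdsGT hr₀] with r hr
    exact (Metric.closedBall_subset_ball hr.2).trans (hsub.trans interior_subset)
  -- The estimate at the end uses only `16 η ≤ ε`, with `16 = 8 · 2` from `enorm_sub_pow_four_le`.
  obtain ⟨η, hη0, hη⟩ : ∃ η : ℝ≥0∞, 0 < η ∧ 24 * η ≤ ε := by
    refine ⟨ε / 24, ENNReal.div_pos hε.ne' (by norm_num), ?_⟩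
    rw [ENNReal.mul_div_cancel (by norm_num) (by norm_num)]
  obtain ⟨c, hcD, hc⟩ : ∃ c ∈ D, ‖G z - c‖ₑ ^ 4 < η := by
    have hopen : IsOpen {c : F | ‖G z - c‖ₑ ^ 4 < η} :=
      isOpen_lt (by fun_prop) continuous_const
    obtain ⟨c, h, hcD⟩ := hDd.inter_open_nonempty _ hopen ⟨G z, by simpa using hη0⟩
    exact ⟨c, hcD, h⟩
  have h2 := hz c hcD
  rw [Set.indicator_of_mem (interior_subset hzΛ)] at h2
  have h3 := h2.eventually (Iio_mem_nhds hc)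
  filter_upwards [hball, h3, self_mem_nhdsWithin] with r hr1 hr2 (hr3 : 0 < r)
  refine ⟨hr1, ?_⟩
  have hV0 : volume (Metric.closedBall z r) ≠ 0 := (Metric.measure_closedBall_pos _ _ hr3).ne'
  have hVt : volume (Metric.closedBall z r) ≠ ∞ := measure_closedBall_lt_top.ne
  have h4 : ∫⁻ x in Metric.closedBall z r, ‖G x - c‖ₑ ^ 4 ≤
      η * volume (Metric.closedBall z r) := by
    have h5 : ∫⁻ x in Metric.closedBall z r, Λ.indicator (fun x => ‖G x - c‖ₑ ^ 4) x
        = ∫⁻ x in Metric.closedBall z r, ‖G x - c‖ₑ ^ 4 :=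
      setLIntegral_congr_fun Metric.isClosed_closedBall.measurableSet fun x hx => by
        simp [hr1 hx]
    rw [h5] at hr2
    exact ((ENNReal.div_le_iff hV0 hVt).1 hr2.le)
  calc ∫⁻ x in Metric.closedBall z r, ‖G x - G z‖ₑ ^ 4
      ≤ ∫⁻ x in Metric.closedBall z r, 8 * (‖G x - c‖ₑ ^ 4 + η) := by
        refine lintegral_mono fun x => (enorm_sub_pow_four_le (G x) c (G z)).trans ?_
        gcongr
        rw [enorm_sub_rev]
        exact hc.le
    _ = 8 * ((∫⁻ x in Metric.closedBall z r, ‖G x - c‖ₑ ^ 4)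
        + η * volume (Metric.closedBall z r)) := by
        rw [lintegral_const_mul _ (by fun_prop), lintegral_add_left (by fun_prop)]
        simp
    _ ≤ 8 * (η * volume (Metric.closedBall z r) + η * volume (Metric.closedBall z r)) := by gcongr
    _ = 16 * η * volume (Metric.closedBall z r) := by ring
    _ ≤ 24 * η * volume (Metric.closedBall z r) := by gcongr; norm_num
    _ ≤ ε * volume (Metric.closedBall z r) := by gcongr

/-- A sequence of smooth fields whose derivatives converge in `L⁴` and which converges at `0` has
a limit which is continuous and almost everywhere differentiable. -/
theorem exists_regular_limit {Λ : Set R3} (hcomp : IsCompact Λ) (hconv : Convex ℝ Λ)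
    (h0 : (0 : R3) ∈ Λ) (hpos : volume Λ ≠ 0) {u : ℕ → R3 → R3} (hu : ∀ n, ContDiff ℝ 1 (u n))
    (hsum : ∑' n, 16 ^ n * ((∫⁻ x in Λ, ‖fderiv ℝ (u (n + 1)) x - fderiv ℝ (u n) x‖ₑ ^ 4)
      + ‖u (n + 1) 0 - u n 0‖ₑ ^ 4) ≠ ∞) :
    ∃ w : R3 → R3, ContinuousOn w Λ ∧ (∀ x ∈ Λ, Tendsto (fun n => u n x) atTop (𝓝 (w x))) ∧
      ∀ᵐ z, z ∈ interior Λ → DifferentiableAt ℝ w z := by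
  have hm : MeasurableSet Λ := hcomp.isClosed.measurableSet
  have hfin : volume Λ ≠ ∞ := hcomp.measure_lt_top.ne
  set S := ∑' n, 16 ^ n * ((∫⁻ x in Λ, ‖fderiv ℝ (u (n + 1)) x - fderiv ℝ (u n) x‖ₑ ^ 4)
      + ‖u (n + 1) 0 - u n 0‖ₑ ^ 4) with hS
  set C := S ^ (1 / 4 : ℝ) with hC
  have hCt : C ≠ ∞ := ENNReal.rpow_ne_top_of_nonneg (by norm_num) hsum
  -- The weights are `16 ^ n = (2 ^ n) ^ 4`, so fourth roots decay geometrically with ratio 1/2.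
  have hroot : ∀ (n : ℕ) (a : ℝ≥0∞), 16 ^ n * a ≤ S → a ^ (1 / 4 : ℝ) ≤ C / 2 ^ n := by
    intro n a ha
    rw [ENNReal.le_div_iff_mul_le (by simp) (by simp), hC]
    calc a ^ (1 / 4 : ℝ) * 2 ^ n = (16 ^ n * a) ^ (1 / 4 : ℝ) := by
          rw [ENNReal.mul_rpow_of_nonneg _ _ (by norm_num), mul_comm]
          congr 1
          have : (16 : ℝ≥0∞) ^ n = (2 ^ n) ^ (4 : ℝ) := by
            rw [ENNReal.rpow_ofNat, ← pow_mul, mul_comm, pow_mul]; norm_num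
          rw [this, ← ENNReal.rpow_mul]; norm_num
      _ ≤ _ := ENNReal.rpow_le_rpow ha (by norm_num)
  have hterm : ∀ n, 16 ^ n * ((∫⁻ x in Λ, ‖fderiv ℝ (u (n + 1)) x - fderiv ℝ (u n) x‖ₑ ^ 4)
      + ‖u (n + 1) 0 - u n 0‖ₑ ^ 4) ≤ S := fun n => ENNReal.le_tsum n
  have hder : ∀ n, (∫⁻ x in Λ, ‖fderiv ℝ (u (n + 1)) x - fderiv ℝ (u n) x‖ₑ ^ 4) ^ (1 / 4 : ℝ)
      ≤ C / 2 ^ n := fun n => hroot n _ (le_trans (by gcongr; exact le_self_add) (hterm n))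
  have hval : ∀ n, ‖u (n + 1) 0 - u n 0‖ₑ ≤ C / 2 ^ n := fun n => by
    have := hroot n (‖u (n + 1) 0 - u n 0‖ₑ ^ 4)
      (le_trans (by gcongr; exact le_add_self) (hterm n))
    rwa [← ENNReal.rpow_natCast, ← ENNReal.rpow_mul, show ((4 : ℕ) : ℝ) * (1 / 4) = 1 by norm_num,
      ENNReal.rpow_one] at this
  -- the limit of the derivatives in `L⁴`
  have : Fact ((1 : ℝ≥0∞) ≤ 4) := ⟨by norm_num⟩
  have hL : ∀ n, MemLp (fderiv ℝ (u n)) 4 (volume.restrict Λ) := fun n => by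
    have : IsFiniteMeasure (volume.restrict Λ) := ⟨by simpa using hfin.lt_top⟩
    have hc := (hu n).continuous_fderiv one_ne_zero
    obtain ⟨M, hM⟩ := hcomp.exists_bound_of_continuousOn hc.continuousOn
    refine MemLp.of_bound hc.aestronglyMeasurable M ?_
    filter_upwards [ae_restrict_mem hm] with x hx using hM x hx
  have heLp : ∀ g : R3 → R3 →L[ℝ] R3, eLpNorm g 4 (volume.restrict Λ)
      = (∫⁻ x in Λ, ‖g x‖ₑ ^ 4) ^ (1 / 4 : ℝ) := fun g => by
    rw [eLpNorm_eq_lintegral_rpow_enorm_toReal (by norm_num) (by norm_num)]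
    simp
  have hcau : CauchySeq fun n => (hL n).toLp := by
    refine cauchySeq_of_edist_le_geometric_two C hCt fun n => ?_
    rw [Lp.edist_toLp_toLp, eLpNorm_sub_comm, heLp]
    exact hder n
  obtain ⟨G₀, hG₀⟩ := cauchySeq_tendsto_of_complete hcau
  set G : R3 → R3 →L[ℝ] R3 := (Lp.aestronglyMeasurable G₀).mk with hGdef
  have hGm : Measurable G := (Lp.aestronglyMeasurable G₀).stronglyMeasurable_mk.measurable
  have hGae : G₀ =ᵐ[volume.restrict Λ] G := (Lp.aestronglyMeasurable G₀).ae_eq_mk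
  have hGlim : Tendsto (fun n => ∫⁻ x in Λ, ‖fderiv ℝ (u n) x - G x‖ₑ ^ 4) atTop (𝓝 0) := by
    rw [tendsto_iff_edist_tendsto_0] at hG₀
    have h1 : ∀ n, edist (hL n).toLp G₀ ^ 4 = ∫⁻ x in Λ, ‖fderiv ℝ (u n) x - G x‖ₑ ^ 4 := by
      intro n
      rw [Lp.edist_def, heLp, ← ENNReal.rpow_natCast, ← ENNReal.rpow_mul]
      norm_num
      refine lintegral_congr_ae ?_
      filter_upwards [hGae, (hL n).coeFn_toLp] with x hx hx'
      rw [hx, hx']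
    have h2 := ((ENNReal.continuous_pow 4).tendsto 0).comp hG₀
    simpa [Function.comp_def, h1] using h2
  have hGint : ∫⁻ x in Λ, ‖G x‖ₑ ^ 4 < ∞ := by
    have h1 : MemLp G 4 (volume.restrict Λ) := (Lp.memLp G₀).ae_eq hGae
    have h2 := h1.eLpNorm_lt_top
    rw [heLp] at h2
    exact (ENNReal.rpow_lt_top_iff_of_pos (by norm_num)).1 h2
  -- the uniform limit
  obtain ⟨d, hd⟩ := Metric.isBounded_iff.1 hcomp.isBounded
  have hd' : ∀ x ∈ Λ, ∀ y ∈ Λ, ‖x - y‖ ≤ d := fun x hx y hy => by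
    rw [← dist_eq_norm]; exact hd hx hy
  -- The first term is the increment at 0, the second the oscillation over `Λ` given by Morrey's
  -- inequality.
  set C' := C + ENNReal.ofReal (8 * d) * ((volume Λ)⁻¹ ^ (1 / 4 : ℝ) * C) with hC'
  have hC't : C' ≠ ∞ := by
    have : (volume Λ)⁻¹ ^ (1 / 4 : ℝ) ≠ ∞ :=
      ENNReal.rpow_ne_top_of_nonneg (by norm_num) (ENNReal.inv_ne_top.2 hpos)
    finiteness
  have hstep : ∀ x ∈ Λ, ∀ n, edist (u n x) (u (n + 1) x) ≤ C' / 2 ^ n := by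
    intro x hx n
    have h1 := enorm_sub_le_morrey hconv hm hd' hpos hfin ((hu (n + 1)).sub (hu n)) hx h0
    have h2 : ∀ x, fderiv ℝ (u (n + 1) - u n) x = fderiv ℝ (u (n + 1)) x - fderiv ℝ (u n) x :=
      fun x => fderiv_sub ((hu (n + 1)).differentiable one_ne_zero x)
        ((hu n).differentiable one_ne_zero x)
    change ‖(u (n + 1) - u n) x - (u (n + 1) - u n) 0‖ₑ ≤ _ * (_ * ∫⁻ x in Λ,
      ‖fderiv ℝ (u (n + 1) - u n) x‖ₑ ^ 4) ^ (1 / 4 : ℝ) at h1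
    simp only [h2, Pi.sub_apply] at h1
    rw [edist_comm, edist_eq_enorm_sub]
    calc ‖u (n + 1) x - u n x‖ₑ
        = ‖(u (n + 1) 0 - u n 0) + (u (n + 1) x - u n x - (u (n + 1) 0 - u n 0))‖ₑ := by
          congr 1; abel
      _ ≤ C / 2 ^ n + ENNReal.ofReal (8 * d) * ((volume Λ)⁻¹ ^ (1 / 4 : ℝ) * (C / 2 ^ n)) := by
          refine (enorm_add_le _ _).trans (add_le_add (hval n) (h1.trans ?_))
          rw [ENNReal.mul_rpow_of_nonneg _ _ (by norm_num)]
          gcongr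
          exact hder n
      _ = C' / 2 ^ n := by rw [hC']; simp only [div_eq_mul_inv]; ring
  have hlim : ∀ x, ∃ y, x ∈ Λ → Tendsto (fun n => u n x) atTop (𝓝 y) := fun x => by
    by_cases hx : x ∈ Λ
    · obtain ⟨y, hy⟩ := cauchySeq_tendsto_of_complete
        (cauchySeq_of_edist_le_geometric_two C' hC't (hstep x hx))
      exact ⟨y, fun _ => hy⟩
    · exact ⟨0, fun h => absurd h hx⟩
  choose w hw using hlim
  refine ⟨w, ?_, hw, ?_⟩
  · refine TendstoUniformlyOn.continuousOn (F := u) (p := atTop) ?_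
      (Eventually.of_forall fun n => (hu n).continuous.continuousOn).frequently
    rw [EMetric.tendstoUniformlyOn_iff]
    intro ε hε
    have h1 : Tendsto (fun n : ℕ => 2 * C' / 2 ^ n) atTop (𝓝 0) := by
      have h2 : Tendsto (fun n : ℕ => (2 * C') * (2⁻¹ : ℝ≥0∞) ^ n) atTop (𝓝 ((2 * C') * 0)) :=
        ENNReal.Tendsto.const_mul
          (ENNReal.tendsto_pow_atTop_nhds_zero_of_lt_one (by simp)) (Or.inr (by finiteness))
      rw [mul_zero] at h2
      refine h2.congr fun n => ?_
      rw [div_eq_mul_inv, ENNReal.inv_pow]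
    filter_upwards [h1.eventually (Iio_mem_nhds hε)] with n hn x hx
    rw [edist_comm]
    exact (edist_le_of_edist_le_geometric_two_of_tendsto C' (hstep x hx) (hw x hx) n).trans_lt hn
  · filter_upwards [ae_lebesguePoint_pow_four hm hfin.lt_top hGm hGint] with z hz hzΛ
    refine HasFDerivAt.differentiableAt (f' := G z) ?_
    rw [hasFDerivAt_iff_isLittleO, isLittleO_iff]
    intro ε hε
    -- Morrey's inequality on a ball of diameter `2 r` has the factor `16 r`, and the splitting of
    -- the fourth power costs 8; this tolerance makes the final bound exactly `ε r`.
    have hr := hz hzΛ (ENNReal.ofReal ((ε / 16) ^ 4 / 8)) (by simp; positivity)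
    rw [eventually_nhdsWithin_iff, Metric.eventually_nhds_iff] at hr
    obtain ⟨δ, hδ, hr⟩ := hr
    rw [Metric.eventually_nhds_iff]
    refine ⟨δ, hδ, fun y hy => ?_⟩
    rcases eq_or_ne y z with rfl | hyz
    · simp
    set r := ‖y - z‖ with hrdef
    have hr0 : 0 < r := norm_pos_iff.2 (sub_ne_zero.2 hyz)
    obtain ⟨hsub, hle⟩ := hr (y := r) (by
      rw [Real.dist_eq, sub_zero, abs_of_pos hr0, hrdef, ← dist_eq_norm]; exact hy) hr0
    set V := volume (Metric.closedBall z r) with hV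
    have hV0 : V ≠ 0 := (Metric.measure_closedBall_pos _ _ hr0).ne'
    have hVt : V ≠ ∞ := measure_closedBall_lt_top.ne
    have hyB : y ∈ Metric.closedBall z r := by simp [hrdef, dist_eq_norm]
    have hzB : z ∈ Metric.closedBall z r := Metric.mem_closedBall_self hr0.le
    have hdiam : ∀ x ∈ Metric.closedBall z r, ∀ y ∈ Metric.closedBall z r, ‖x - y‖ ≤ 2 * r := by
      intro x hx y hy
      rw [← dist_eq_norm]
      have h1 := dist_triangle_right x y z
      have h2 := Metric.mem_closedBall.1 hx
      have h3 := Metric.mem_closedBall.1 hy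
      linarith
    set A := ∫⁻ x in Metric.closedBall z r, ‖G x - G z‖ₑ ^ 4 with hA
    -- Morrey's inequality is applied to `u n` minus the linear map `G z`, on the ball around `z`
    -- with `y` on its boundary. As `n → ∞` only the oscillation of `G` at the Lebesgue point `z`
    -- remains.
    have hn : ∀ n, ‖u n y - u n z - G z (y - z)‖ₑ ≤ ENNReal.ofReal (8 * (2 * r)) *
        (V⁻¹ * (8 * ((∫⁻ x in Λ, ‖fderiv ℝ (u n) x - G x‖ₑ ^ 4) + A))) ^ (1 / 4 : ℝ) := by
      intro n
      have h1 := enorm_sub_le_morrey (convex_closedBall z r)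
        Metric.isClosed_closedBall.measurableSet hdiam hV0 hVt
        ((hu n).sub (G z).contDiff) hyB hzB
      have h2 : ∀ x, fderiv ℝ (fun x => u n x - G z x) x = fderiv ℝ (u n) x - G z := fun x => by
        rw [fderiv_fun_sub ((hu n).differentiable one_ne_zero x) (G z).differentiableAt,
          ContinuousLinearMap.fderiv]
      simp only [h2] at h1
      have h3 : u n y - u n z - G z (y - z) = u n y - G z y - (u n z - G z z) := by
        rw [map_sub]; abel
      rw [h3]
      refine h1.trans ?_
      gcongr
      calc ∫⁻ x in Metric.closedBall z r, ‖fderiv ℝ (u n) x - G z‖ₑ ^ 4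
          ≤ ∫⁻ x in Metric.closedBall z r, 8 * (‖fderiv ℝ (u n) x - G x‖ₑ ^ 4
            + ‖G x - G z‖ₑ ^ 4) := lintegral_mono fun x => enorm_sub_pow_four_le _ _ _
        _ = 8 * ((∫⁻ x in Metric.closedBall z r, ‖fderiv ℝ (u n) x - G x‖ₑ ^ 4) + A) := by
          have hc := ((hu n).continuous_fderiv one_ne_zero).measurable
          rw [lintegral_const_mul _ (by fun_prop), lintegral_add_left (by fun_prop)]
        _ ≤ _ := by gcongr
    have hlimL : Tendsto (fun n => ‖u n y - u n z - G z (y - z)‖ₑ) atTop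
        (𝓝 ‖w y - w z - G z (y - z)‖ₑ) :=
      (((hw y (hsub hyB)).sub (hw z (hsub hzB))).sub_const _).enorm
    have hlimR : Tendsto (fun n => ENNReal.ofReal (8 * (2 * r)) *
        (V⁻¹ * (8 * ((∫⁻ x in Λ, ‖fderiv ℝ (u n) x - G x‖ₑ ^ 4) + A))) ^ (1 / 4 : ℝ)) atTop
        (𝓝 (ENNReal.ofReal (8 * (2 * r)) * (V⁻¹ * (8 * (0 + A))) ^ (1 / 4 : ℝ))) := by
      refine ENNReal.Tendsto.const_mul ?_ (Or.inr ENNReal.ofReal_ne_top)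
      refine ((ENNReal.continuous_rpow_const (y := 1 / 4)).tendsto _).comp ?_
      refine ENNReal.Tendsto.const_mul ?_ (Or.inr (ENNReal.inv_ne_top.2 hV0))
      exact ENNReal.Tendsto.const_mul (hGlim.add_const A) (Or.inr (by norm_num))
    have hfinal := le_of_tendsto_of_tendsto' hlimL hlimR hn
    have hbound : ENNReal.ofReal (8 * (2 * r)) * (V⁻¹ * (8 * (0 + A))) ^ (1 / 4 : ℝ)
        ≤ ENNReal.ofReal (ε * r) := by
      have h1 : V⁻¹ * (8 * (0 + A)) ≤ ENNReal.ofReal ((ε / 16) ^ 4) := by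
        rw [zero_add]
        calc V⁻¹ * (8 * A) ≤ V⁻¹ * (8 * (ENNReal.ofReal ((ε / 16) ^ 4 / 8) * V)) := by gcongr
          _ = (8 * ENNReal.ofReal ((ε / 16) ^ 4 / 8)) * (V⁻¹ * V) := by ring
          _ = ENNReal.ofReal ((ε / 16) ^ 4) := by
            rw [ENNReal.inv_mul_cancel hV0 hVt, mul_one,
              show (8 : ℝ≥0∞) = ENNReal.ofReal 8 by norm_num, ← ENNReal.ofReal_mul (by norm_num)]
            congr 1; ring
      have h2 : (V⁻¹ * (8 * (0 + A))) ^ (1 / 4 : ℝ) ≤ ENNReal.ofReal (ε / 16) := by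
        refine (ENNReal.rpow_le_rpow h1 (by norm_num)).trans (le_of_eq ?_)
        rw [ENNReal.ofReal_rpow_of_nonneg (by positivity) (by norm_num), ← Real.rpow_natCast,
          ← Real.rpow_mul (by positivity)]
        norm_num
      calc _ ≤ ENNReal.ofReal (8 * (2 * r)) * ENNReal.ofReal (ε / 16) := by gcongr
        _ = _ := by rw [← ENNReal.ofReal_mul (by positivity)]; congr 1; ring
    have := hfinal.trans hbound
    rw [← ofReal_norm, ENNReal.ofReal_le_ofReal_iff (by positivity)] at this
    exact this


/-! ### Mollification inside a convex set -/

/-- A `C¹` probability density supported in `Λ`. -/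
structure IsMollifier (Λ : Set R3) (ρ : R3 → ℝ) : Prop where
  contDiff : ContDiff ℝ 1 ρ
  nonneg : ∀ x, 0 ≤ ρ x
  integral_eq_one : ∫ x, ρ x = 1
  eq_zero : ∀ x ∉ Λ, ρ x = 0
  hasCompactSupport : HasCompactSupport ρ

theorem exists_isMollifier {Λ : Set R3} (hint : (interior Λ).Nonempty) :
    ∃ ρ, IsMollifier Λ ρ := by
  obtain ⟨p, hp⟩ := hint
  obtain ⟨r, hr, hsub⟩ := Metric.isOpen_iff.1 isOpen_interior p hp
  let b : ContDiffBump p := ⟨r / 2, r, by positivity, by linarith⟩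
  refine ⟨b.normed volume, b.contDiff_normed, b.nonneg_normed, b.integral_normed, fun x hx => ?_,
    b.hasCompactSupport_normed⟩
  by_contra h
  have h1 : x ∈ Function.support (b.normed volume) := h
  rw [b.support_normed_eq] at h1
  exact hx (interior_subset (hsub h1))

/-- The probability measure with density `ρ`. -/
noncomputable def mollMeasure (ρ : R3 → ℝ) : Measure R3 :=
  volume.withDensity fun x => ENNReal.ofReal (ρ x)

/-- The density of `(1 - s) x + s Y` where `Y` has density `ρ`. -/
noncomputable def mollKernel (ρ : R3 → ℝ) (s : ℝ) (x z : R3) : ℝ :=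
  s⁻¹ ^ 3 * ρ (s⁻¹ • (z - (1 - s) • x))

/-- The mollification `x ↦ 𝔼 g((1 - s) x + s Y)` of `g`, where `Y` has density `ρ`. -/
noncomputable def moll (Λ : Set R3) (ρ : R3 → ℝ) (s : ℝ) (g : R3 → R3) (x : R3) : R3 :=
  ∫ z in Λ, mollKernel ρ s x z • g z

namespace IsMollifier
variable {Λ : Set R3} {ρ : R3 → ℝ} (hρ : IsMollifier Λ ρ)
include hρ

theorem integral_mollMeasure {G : Type*} [NormedAddCommGroup G] [NormedSpace ℝ G] (F : R3 → G) :
    ∫ y, F y ∂(mollMeasure ρ) = ∫ y, ρ y • F y := by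
  rw [mollMeasure, integral_withDensity_eq_integral_toReal_smul]
  · exact integral_congr_ae (Eventually.of_forall fun y => by
      simp [ENNReal.toReal_ofReal (hρ.nonneg y)])
  · exact hρ.contDiff.continuous.measurable.ennreal_ofReal
  · exact Eventually.of_forall fun y => ENNReal.ofReal_lt_top

theorem isProbabilityMeasure : IsProbabilityMeasure (mollMeasure ρ) := by
  constructor
  rw [mollMeasure, withDensity_apply _ MeasurableSet.univ, Measure.restrict_univ,
    ← ofReal_integral_eq_lintegral_ofReal
      (hρ.contDiff.continuous.integrable_of_hasCompactSupport hρ.hasCompactSupport)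
      (Eventually.of_forall hρ.nonneg), hρ.integral_eq_one, ENNReal.ofReal_one]

theorem ae_mem : ∀ᵐ y ∂(mollMeasure ρ), y ∈ Λ := by
  rw [mollMeasure, ae_withDensity_iff (hρ.contDiff.continuous.measurable.ennreal_ofReal)]
  refine Eventually.of_forall fun y hy => ?_
  by_contra h
  simp [hρ.eq_zero y h] at hy

/-- By convexity `(1 - s) x + s Y` stays in `Λ`. Mollification thus needs no extension of the field
beyond `Λ` and works up to the boundary. -/
theorem mollKernel_eq_zero (hconv : Convex ℝ Λ) {s : ℝ} (hs : s ∈ Set.Ioc (0 : ℝ) 1) {x z : R3}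
    (hx : x ∈ Λ) (hz : z ∉ Λ) : mollKernel ρ s x z = 0 := by
  rw [mollKernel, hρ.eq_zero, mul_zero]
  intro h
  refine hz ?_
  have h1 := hconv hx h (sub_nonneg.2 hs.2) hs.1.le (by ring)
  rwa [smul_inv_smul₀ hs.1.ne', add_sub_cancel] at h1

theorem setIntegral_mollKernel_smul (hconv : Convex ℝ Λ) {s : ℝ} (hs : s ∈ Set.Ioc (0 : ℝ) 1)
    {x : R3} (hx : x ∈ Λ) {G : Type*} [NormedAddCommGroup G] [NormedSpace ℝ G] (F : R3 → G) :
    ∫ z in Λ, mollKernel ρ s x z • F z = ∫ y, F ((1 - s) • x + s • y) ∂(mollMeasure ρ) := by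
  rw [setIntegral_eq_integral_of_forall_compl_eq_zero fun z hz => by
    rw [hρ.mollKernel_eq_zero hconv hs hx hz, zero_smul], hρ.integral_mollMeasure]
  have hs0 : s ≠ 0 := hs.1.ne'
  set H : R3 → G := fun z => ρ (s⁻¹ • (z - (1 - s) • x)) • F z with hH
  have h1 : ∀ y, ρ y • F ((1 - s) • x + s • y) = H ((1 - s) • x + s • y) := fun y => by
    simp [hH, inv_smul_smul₀ hs0]
  simp only [h1]
  rw [Measure.integral_comp_smul volume (fun y => H ((1 - s) • x + y)) s,
    integral_add_left_eq_self]
  simp only [mollKernel, mul_smul, hH]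
  rw [integral_smul]
  congr 1
  have : (0 : ℝ) < s := hs.1
  rw [abs_of_pos (by positivity)]
  simp

theorem continuous_mollKernel {s : ℝ} (x : R3) : Continuous (mollKernel ρ s x) := by
  unfold mollKernel
  have := hρ.contDiff.continuous
  fun_prop

theorem exists_bound : ∃ M > 0, ∀ x, ρ x ≤ M := by
  obtain ⟨M, hM⟩ := hρ.contDiff.continuous.bounded_above_of_compact_support hρ.hasCompactSupport
  exact ⟨max M 1, by positivity, fun x => (le_abs_self _).trans ((hM x).trans (le_max_left _ _))⟩

/-- The mollification is a convolution with a compactly supported `C¹` function, evaluated at the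
dilated point `(1 - s) x`. -/
theorem contDiff_moll {s : ℝ} (hs : 0 < s) (hm : MeasurableSet Λ) {g : R3 → R3}
    (hg : IntegrableOn g Λ) : ContDiff ℝ 1 (moll Λ ρ s g) := by
  set κ : R3 → ℝ := fun t => s⁻¹ ^ 3 * ρ (-(s⁻¹ • t)) with hκ
  have hκc : ContDiff ℝ 1 κ := contDiff_const.mul (hρ.contDiff.comp (by fun_prop))
  have hκs : HasCompactSupport κ := by
    have h1 : HasCompactSupport fun t : R3 => ρ ((-s⁻¹) • t) :=
      hρ.hasCompactSupport.comp_smul (neg_ne_zero.2 (inv_ne_zero hs.ne'))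
    have h2 : κ = fun t => s⁻¹ ^ 3 * ρ ((-s⁻¹) • t) := by
      funext t; simp [hκ]
    rw [h2]
    exact h1.mul_left
  have hloc : LocallyIntegrable (Λ.indicator g) volume :=
    ((integrable_indicator_iff hm).2 hg).locallyIntegrable
  have h1 := hκs.contDiff_convolution_right (n := 1)
    (ContinuousLinearMap.lsmul ℝ ℝ : ℝ →L[ℝ] R3 →L[ℝ] R3).flip hloc hκc
  have h2 : moll Λ ρ s g = (convolution (Λ.indicator g) κ
      (ContinuousLinearMap.lsmul ℝ ℝ : ℝ →L[ℝ] R3 →L[ℝ] R3).flip volume) ∘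
      fun x => (1 - s) • x := by
    funext x
    simp only [moll, Function.comp, convolution, ContinuousLinearMap.flip_apply,
      ContinuousLinearMap.lsmul_apply]
    rw [← integral_indicator hm]
    refine integral_congr_ae (Eventually.of_forall fun z => ?_)
    by_cases hz : z ∈ Λ
    · simp only [Set.indicator_of_mem hz, mollKernel, hκ]
      rw [← smul_neg, neg_sub]
    · simp [hz]
  rw [h2]
  exact h1.comp (by fun_prop)

/-- The mollifications converge almost everywhere. -/
theorem ae_tendsto_moll (hcomp : IsCompact Λ) (hconv : Convex ℝ Λ) {g : R3 → R3}
    (hg : IntegrableOn g Λ) {s : ℕ → ℝ} (hs : ∀ n, s n ∈ Set.Ioc (0 : ℝ) 1)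
    (hlim : Tendsto s atTop (𝓝 0)) :
    ∀ᵐ x, x ∈ Λ → Tendsto (fun n => moll Λ ρ (s n) g x) atTop (𝓝 (g x)) := by
  have hm : MeasurableSet Λ := hcomp.isClosed.measurableSet
  set H := Λ.indicator g with hH
  have hHi : Integrable H volume := (integrable_indicator_iff hm).2 hg
  obtain ⟨d₀, hd₀⟩ := Metric.isBounded_iff.1 hcomp.isBounded
  set d := max d₀ 1
  have hd : 0 < d := by positivity
  obtain ⟨M, hM0, hM⟩ := hρ.exists_bound
  filter_upwards [(Besicovitch.vitaliFamily (volume : Measure R3)).ae_tendsto_average_norm_sub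
    hHi.locallyIntegrable] with x hx hxΛ
  have h1 : Tendsto (fun r => ⨍ y in Metric.closedBall x r, ‖H y - H x‖) (𝓝[>] 0) (𝓝 0) :=
    hx.comp (Besicovitch.tendsto_filterAt volume x)
  have h2 : Tendsto (fun n => s n * d) atTop (𝓝[>] 0) := by
    refine tendsto_nhdsWithin_iff.2 ⟨by simpa using hlim.mul_const d, ?_⟩
    exact Eventually.of_forall fun n => mul_pos (hs n).1 hd
  -- The mollifying kernel is at most `M / s³` and, restricted to the field, lives in the ball of
  -- radius `s d` around `x`. The constant is this bound times the volume of that ball, with `s`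
  -- cancelled.
  have h3 := (h1.comp h2).const_mul (M * d ^ 3 * volume.real (Metric.ball (0 : R3) 1))
  rw [mul_zero] at h3
  rw [tendsto_iff_norm_sub_tendsto_zero]
  refine squeeze_zero (fun _ => norm_nonneg _) (fun n => ?_) h3
  have hsn := hs n
  have hs0 : 0 < s n := hsn.1
  have := hρ.isProbabilityMeasure
  set B := Metric.closedBall x (s n * d) with hB
  have e1 : moll Λ ρ (s n) g x = ∫ z in Λ, mollKernel ρ (s n) x z • H z :=
    setIntegral_congr_fun hm fun z hz => by simp [hH, hz]
  have hone : ∫ z in Λ, mollKernel ρ (s n) x z • H x = H x := by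
    rw [hρ.setIntegral_mollKernel_smul hconv hsn hxΛ (fun _ => H x)]
    simp
  have hbd : ∀ z, |mollKernel ρ (s n) x z| ≤ (s n)⁻¹ ^ 3 * M := fun z => by
    rw [mollKernel, abs_mul, abs_of_pos (by positivity : 0 < (s n)⁻¹ ^ 3),
      abs_of_nonneg (hρ.nonneg _)]
    gcongr
    exact hM _
  have hkc := (hρ.continuous_mollKernel (s := s n) x)
  have i1 : IntegrableOn (fun z => mollKernel ρ (s n) x z • H z) Λ :=
    hHi.integrableOn.bdd_smul _ hkc.aestronglyMeasurable (Eventually.of_forall hbd)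
  have hfm : IsFiniteMeasure (volume.restrict Λ) := ⟨by simpa using hcomp.measure_lt_top⟩
  have i2 : IntegrableOn (fun z => mollKernel ρ (s n) x z • H x) Λ :=
    (integrable_const (H x)).bdd_smul _ hkc.aestronglyMeasurable (Eventually.of_forall hbd)
  have e2 : moll Λ ρ (s n) g x - g x = ∫ z in Λ, mollKernel ρ (s n) x z • (H z - H x) := by
    have : g x = H x := by simp [hH, hxΛ]
    rw [this, e1]
    calc _ = ∫ z in Λ, (mollKernel ρ (s n) x z • H z - mollKernel ρ (s n) x z • H x) := by
          rw [integral_sub i1 i2, hone]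
      _ = _ := by simp only [smul_sub]
  have e3 : ∫ z in Λ, mollKernel ρ (s n) x z • (H z - H x)
      = ∫ z, B.indicator (fun z => mollKernel ρ (s n) x z • (H z - H x)) z := by
    rw [← integral_indicator hm]
    refine integral_congr_ae (Eventually.of_forall fun z => ?_)
    by_cases hk : mollKernel ρ (s n) x z = 0
    · classical
      simp only [Set.indicator_apply, hk, zero_smul, ite_self]
    · have hz : z ∈ Λ := by
        by_contra h; exact hk (hρ.mollKernel_eq_zero hconv hsn hxΛ h)
      have hzB : z ∈ B := by
        have hy : (s n)⁻¹ • (z - (1 - s n) • x) ∈ Λ := by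
          by_contra h
          exact hk (by rw [mollKernel, hρ.eq_zero _ h, mul_zero])
        have h4 := hd₀ hy hxΛ
        have h5 : z - x = s n • ((s n)⁻¹ • (z - (1 - s n) • x) - x) := by
          rw [smul_sub, smul_inv_smul₀ hs0.ne', sub_smul, one_smul]; abel
        rw [hB, Metric.mem_closedBall, dist_eq_norm, h5, norm_smul, Real.norm_eq_abs,
          abs_of_pos hs0, ← dist_eq_norm]
        gcongr
        exact h4.trans (le_max_left _ _)
      simp [hz, hzB]
  have i3 : IntegrableOn (fun z => ‖H z - H x‖) B :=
    (hHi.integrableOn.sub (integrableOn_const (by exact measure_closedBall_lt_top.ne))).norm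
  rw [e2, e3, integral_indicator Metric.isClosed_closedBall.measurableSet]
  calc ‖∫ z in B, mollKernel ρ (s n) x z • (H z - H x)‖
      ≤ ∫ z in B, (s n)⁻¹ ^ 3 * M * ‖H z - H x‖ := by
        refine norm_integral_le_of_norm_le (i3.const_mul _) (Eventually.of_forall fun z => ?_)
        rw [norm_smul]
        gcongr
        exact hbd z
    _ = (s n)⁻¹ ^ 3 * M * (volume.real B * ⨍ y in B, ‖H y - H x‖) := by
        rw [integral_const_mul, setAverage_eq, smul_eq_mul, mul_inv_cancel_left₀]
        exact (ENNReal.toReal_pos (Metric.measure_closedBall_pos _ _ (by positivity)).ne'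
          measure_closedBall_lt_top.ne).ne'
    _ = _ := by
        rw [hB, Measure.addHaar_real_closedBall _ _ (by positivity)]
        simp only [Function.comp, finrank_euclideanSpace, Fintype.card_fin]
        field_simp

end IsMollifier

/-! ### Mollified flows -/

section Flow
variable {Ω : Type*} [MeasurableSpace Ω] {P : Measure Ω} [IsProbabilityMeasure P]
  {Λ : Set R3} {E c : ℝ} {f : ℝ → ℝ} {v : Ω → L2Field Λ} {ρ : R3 → ℝ}

theorem memLp_mollKernel_smul (K : KernelDomain Λ E c f) (hρ : IsMollifier Λ ρ) (s : ℝ) (x a : R3) :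
    MemLp (fun z => mollKernel ρ s x z • a) 2 (volume.restrict Λ) := by
  have := K.isFiniteMeasure
  have hc : Continuous fun z => mollKernel ρ s x z • a :=
    (hρ.continuous_mollKernel x).smul continuous_const
  obtain ⟨M, hM⟩ := K.isCompact.exists_bound_of_continuousOn hc.continuousOn
  refine MemLp.of_bound hc.aestronglyMeasurable M ?_
  filter_upwards [ae_restrict_mem K.measurableSet] with z hz using hM z hz

/-- The test field `z ↦ Ψ(s, x, z) a`. -/
noncomputable def testField (K : KernelDomain Λ E c f) (hρ : IsMollifier Λ ρ) (s : ℝ) (x a : R3) :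
    L2Field Λ := (memLp_mollKernel_smul K hρ s x a).toLp

variable (K : KernelDomain Λ E c f) (hρ : IsMollifier Λ ρ) (hv : IsGaussianFlow P Λ E f v)
include K

theorem integrableOn_field (g : L2Field Λ) : IntegrableOn g Λ := by
  have := K.isFiniteMeasure
  exact (Lp.memLp g).integrable (by norm_num)

/-- This exhibits every component of the mollified flow as a pairing `⟨φ, v⟩`, hence as a Gaussian
variable of known covariance. -/
theorem inner_testField (s : ℝ) (x a : R3) (g : L2Field Λ) :
    inner ℝ (testField K hρ s x a) g = inner ℝ a (moll Λ ρ s g x) := by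
  have hkc := hρ.continuous_mollKernel (s := s) x
  obtain ⟨M, hM⟩ := K.isCompact.exists_bound_of_continuousOn hkc.continuousOn
  have i1 : IntegrableOn (fun z => mollKernel ρ s x z • g z) Λ :=
    (integrableOn_field K g).bdd_smul _ hkc.aestronglyMeasurable
      ((ae_restrict_mem K.measurableSet).mono fun z hz => hM z hz)
  rw [moll, ← integral_inner i1, L2.inner_def]
  refine integral_congr_ae ?_
  filter_upwards [(memLp_mollKernel_smul K hρ s x a).coeFn_toLp] with z hz
  rw [testField, hz]
  simp [inner_smul_left, inner_smul_right]

theorem mem_contraction {s : ℝ} (hs : s ∈ Set.Ioc (0 : ℝ) 1) {x y : R3} (hx : x ∈ Λ)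
    (hy : y ∈ Λ) : (1 - s) • x + s • y ∈ Λ :=
  K.convex hx hy (sub_nonneg.2 hs.2) hs.1.le (by ring)

omit [IsProbabilityMeasure P] in
theorem inner_pairing_testField (φ : L2Field Λ) {s : ℝ} (hs : s ∈ Set.Ioc (0 : ℝ) 1) {x : R3}
    (hx : x ∈ Λ) (a : R3) :
    inner ℝ (pairing hv φ) (pairing hv (testField K hρ s x a))
      = ∫ z in Λ, ∫ y, ker E f (φ z) a (z - ((1 - s) • x + s • y)) ∂(mollMeasure ρ) := by
  rw [inner_pairing]
  refine integral_congr_ae (Eventually.of_forall fun z => ?_)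
  dsimp only
  rw [← hρ.setIntegral_mollKernel_smul K.convex hs hx (fun y => ker E f (φ z) a (z - y))]
  refine integral_congr_ae ?_
  filter_upwards [(memLp_mollKernel_smul K hρ s x a).coeFn_toLp] with y hy
  rw [testField, hy, ker_smul_right, smul_eq_mul]

theorem continuousOn_ker_contraction {s s' : ℝ} (hs : s ∈ Set.Ioc (0 : ℝ) 1)
    (hs' : s' ∈ Set.Ioc (0 : ℝ) 1) {x x' : R3} (hx : x ∈ Λ) (hx' : x' ∈ Λ) (a b : R3) :
    ContinuousOn (fun p : R3 × R3 =>
      ker E f a b ((1 - s) • x + s • p.1 - ((1 - s') • x' + s' • p.2))) (Λ ×ˢ Λ) := by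
  refine (K.continuousOn_ker a b).comp (f := fun p : R3 × R3 =>
    ((1 - s) • x + s • p.1, (1 - s') • x' + s' • p.2)) (by fun_prop) ?_
  exact fun p hp => ⟨mem_contraction K hs hx hp.1, mem_contraction K hs' hx' hp.2⟩

theorem integrable_ker_contraction (hρ : IsMollifier Λ ρ) {s s' : ℝ} (hs : s ∈ Set.Ioc (0 : ℝ) 1)
    (hs' : s' ∈ Set.Ioc (0 : ℝ) 1) {x x' : R3} (hx : x ∈ Λ) (hx' : x' ∈ Λ) (a b : R3) :
    Integrable (fun p : R3 × R3 =>
      ker E f a b ((1 - s) • x + s • p.1 - ((1 - s') • x' + s' • p.2)))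
      ((mollMeasure ρ).prod (mollMeasure ρ)) := by
  have := hρ.isProbabilityMeasure
  have hmem : ∀ᵐ p ∂((mollMeasure ρ).prod (mollMeasure ρ)), p ∈ Λ ×ˢ Λ := by
    rw [Measure.ae_prod_iff_ae_ae]
    · filter_upwards [hρ.ae_mem] with y hy
      filter_upwards [hρ.ae_mem] with y' hy' using ⟨hy, hy'⟩
    · exact K.measurableSet.prod K.measurableSet
  have hc := continuousOn_ker_contraction K hs hs' hx hx' a b
  have := hc.integrableOn_compact' (μ := (mollMeasure ρ).prod (mollMeasure ρ))
    (K.isCompact.prod K.isCompact) (K.measurableSet.prod K.measurableSet)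
  rwa [IntegrableOn, Measure.restrict_eq_self_of_ae_mem hmem] at this

omit [IsProbabilityMeasure P] in
theorem inner_testField_testField {s s' : ℝ} (hs : s ∈ Set.Ioc (0 : ℝ) 1)
    (hs' : s' ∈ Set.Ioc (0 : ℝ) 1) {x x' : R3} (hx : x ∈ Λ) (hx' : x' ∈ Λ) (a b : R3) :
    inner ℝ (pairing hv (testField K hρ s x a)) (pairing hv (testField K hρ s' x' b))
      = ∫ p, ker E f a b ((1 - s) • x + s • p.1 - ((1 - s') • x' + s' • p.2))
        ∂((mollMeasure ρ).prod (mollMeasure ρ)) := by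
  have := hρ.isProbabilityMeasure
  rw [inner_pairing_testField K hρ hv _ hs' hx', integral_prod _
    (integrable_ker_contraction K hρ hs hs' hx hx' a b),
    ← hρ.setIntegral_mollKernel_smul K.convex hs hx (fun z => ∫ y, ker E f a b
      (z - ((1 - s') • x' + s' • y)) ∂(mollMeasure ρ))]
  refine integral_congr_ae ?_
  filter_upwards [(memLp_mollKernel_smul K hρ s x a).coeFn_toLp] with z hz
  rw [testField, hz]
  simp only [ker_smul_left]
  rw [integral_const_mul, smul_eq_mul]

end Flow

/-! ### Increments of the mollified flow in `L²(P)` -/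

section Flow
variable {Ω : Type*} [MeasurableSpace Ω] {P : Measure Ω} [IsProbabilityMeasure P]
  {Λ : Set R3} {E c : ℝ} {f : ℝ → ℝ} {v : Ω → L2Field Λ} {ρ : R3 → ℝ}

omit [IsProbabilityMeasure P] in
theorem IsGaussianFlow.congr (hv : IsGaussianFlow P Λ E f v) {v' : Ω → L2Field Λ}
    (h : v =ᵐ[P] v') : IsGaussianFlow P Λ E f v' where
  aestronglyMeasurable := hv.aestronglyMeasurable.congr h
  gaussian φ := (hv.gaussian φ).congr (h.mono fun ω hω => by simp only [hω])
  mean_zero φ := by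
    rw [← hv.mean_zero φ]
    exact integral_congr_ae (h.mono fun ω hω => by simp only [hω])
  covariance φ ψ := by
    rw [← hv.covariance φ ψ]
    exact integral_congr_ae (h.mono fun ω hω => by simp only [hω])

theorem abs_kerQ_le {E c : ℝ} (hE : 0 < E) (a b h k : R3) :
    |kerQ E c a b h k| ≤ 2 * E * |c| * (‖h‖ * ‖k‖ * (‖a‖ * ‖b‖)) := by
  have e1 : |(-4 * c) * inner ℝ h k * inner ℝ a b| ≤ (4 * |c|) * (‖h‖ * ‖k‖) * (‖a‖ * ‖b‖) :=
    abs_mul₃_le (by rw [abs_mul]; norm_num) (abs_inner_le _ _) (abs_inner_le _ _)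
  have e2 : |c * inner ℝ h a * inner ℝ k b| ≤ |c| * (‖h‖ * ‖a‖) * (‖k‖ * ‖b‖) :=
    abs_mul₃_le le_rfl (abs_inner_le _ _) (abs_inner_le _ _)
  have e3 : |c * inner ℝ k a * inner ℝ h b| ≤ |c| * (‖k‖ * ‖a‖) * (‖h‖ * ‖b‖) :=
    abs_mul₃_le le_rfl (abs_inner_le _ _) (abs_inner_le _ _)
  rw [abs_le] at e1 e2 e3
  rw [kerQ, abs_mul, abs_of_pos (by positivity : 0 < E / 3)]
  calc _ ≤ E / 3 * (6 * (|c| * (‖h‖ * ‖k‖ * (‖a‖ * ‖b‖)))) := by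
        refine mul_le_mul_of_nonneg_left ?_ (by positivity)
        rw [abs_le]
        constructor <;> linarith
    _ = _ := by ring

theorem integral_second_difference {X : Type*} [MeasurableSpace X] {μ : Measure X}
    [IsProbabilityMeasure μ] {F₁ F₂ F₃ F₄ : X → ℝ} (i₁ : Integrable F₁ μ) (i₂ : Integrable F₂ μ)
    (i₃ : Integrable F₃ μ) (i₄ : Integrable F₄ μ) (C : ℝ) :
    (∫ p, F₁ p ∂μ) - (∫ p, F₃ p ∂μ) - ((∫ p, F₂ p ∂μ) - ∫ p, F₄ p ∂μ) + C
      = ∫ p, (F₁ p - F₃ p - (F₂ p - F₄ p) + C) ∂μ := by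
  rw [integral_add (f := fun p => F₁ p - F₃ p - (F₂ p - F₄ p)) ((i₁.sub i₃).sub (i₂.sub i₄))
    (integrable_const _), integral_sub (f := fun p => F₁ p - F₃ p) (g := fun p => F₂ p - F₄ p)
    (i₁.sub i₃) (i₂.sub i₄), integral_sub i₁ i₃, integral_sub i₂ i₄]
  simp

variable (K : KernelDomain Λ E c f) (hρ : IsMollifier Λ ρ) (hv : IsGaussianFlow P Λ E f v)
include K

theorem exists_diam : ∃ d > 0, ∀ x ∈ Λ, ∀ y ∈ Λ, ‖x - y‖ ≤ d := by
  obtain ⟨d, hd⟩ := Metric.isBounded_iff.1 K.bounded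
  refine ⟨max d 1, by positivity, fun x hx y hy => ?_⟩
  rw [← dist_eq_norm]
  exact (hd hx hy).trans (le_max_left _ _)

omit K in
theorem norm_contraction_sub_le {d : ℝ} (hd : ∀ x ∈ Λ, ∀ y ∈ Λ, ‖x - y‖ ≤ d) {s s' : ℝ}
    (hs : s ∈ Set.Ioc (0 : ℝ) 1) (hs' : s' ∈ Set.Ioc (0 : ℝ) 1) {x y y' : R3} (hx : x ∈ Λ)
    (hy : y ∈ Λ) (hy' : y' ∈ Λ) :
    ‖(1 - s) • x + s • y - ((1 - s') • x + s' • y')‖ ≤ (s + s') * d := by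
  have : (1 - s) • x + s • y - ((1 - s') • x + s' • y') = s • (y - x) - s' • (y' - x) := by
    module
  rw [this, add_mul]
  refine (norm_sub_le _ _).trans ?_
  rw [norm_smul, norm_smul, Real.norm_eq_abs, Real.norm_eq_abs, abs_of_pos hs.1, abs_of_pos hs'.1]
  have := hs.1.le
  have := hs'.1.le
  gcongr
  · exact hd _ hy _ hx
  · exact hd _ hy' _ hx

omit K in
theorem ae_prod_mem (K : KernelDomain Λ E c f) (hρ : IsMollifier Λ ρ) :
    ∀ᵐ p ∂((mollMeasure ρ).prod (mollMeasure ρ)), p.1 ∈ Λ ∧ p.2 ∈ Λ := by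
  have := hρ.isProbabilityMeasure
  rw [Measure.ae_prod_iff_ae_ae (p := fun p : R3 × R3 => p.1 ∈ Λ ∧ p.2 ∈ Λ)]
  · filter_upwards [hρ.ae_mem] with y hy
    filter_upwards [hρ.ae_mem] with y' hy' using ⟨hy, hy'⟩
  · exact K.measurableSet.prod K.measurableSet

omit [IsProbabilityMeasure P] in
/-- Covariances of increments of the mollified flow. -/
theorem inner_increment_increment {η : ℝ} (hη : 0 < η) : ∃ δ > 0, ∀ s ∈ Set.Ioc (0 : ℝ) 1,
    ∀ s' ∈ Set.Ioc (0 : ℝ) 1, s < δ → s' < δ → ∀ x h k a b : R3, x ∈ Λ → x + h ∈ Λ → x + k ∈ Λ →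
    ‖h‖ < δ → ‖k‖ < δ →
    |inner ℝ (pairing hv (testField K hρ s (x + h) a) - pairing hv (testField K hρ s x a))
      (pairing hv (testField K hρ s' (x + k) b) - pairing hv (testField K hρ s' x b))
      + (1 - s) * (1 - s') * kerQ E c a b h k| ≤ η * (‖h‖ * ‖k‖ * (‖a‖ * ‖b‖)) := by
  obtain ⟨δ, hδ, H⟩ := ker_second_difference K.pos K.regular hη
  obtain ⟨d, hd0, hd⟩ := exists_diam K
  -- The second bound makes the base point, a difference of two contractions towards `x`, shorter
  -- than `(s + s') d < δ`.
  refine ⟨min δ (δ / (2 * d)), by positivity, ?_⟩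
  intro s hs s' hs' hsδ hs'δ x h k a b hx hxh hxk hh hk
  have := hρ.isProbabilityMeasure
  have hs1 : 0 ≤ 1 - s := sub_nonneg.2 hs.2
  have hs1' : 0 ≤ 1 - s' := sub_nonneg.2 hs'.2
  simp only [inner_sub_left, inner_sub_right]
  rw [inner_testField_testField K hρ hv hs hs' hxh hxk, inner_testField_testField K hρ hv hs hs'
    hxh hx, inner_testField_testField K hρ hv hs hs' hx hxk, inner_testField_testField K hρ hv hs
    hs' hx hx]
  have i1 := integrable_ker_contraction K hρ hs hs' hxh hxk a b
  have i2 := integrable_ker_contraction K hρ hs hs' hxh hx a b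
  have i3 := integrable_ker_contraction K hρ hs hs' hx hxk a b
  have i4 := integrable_ker_contraction K hρ hs hs' hx hx a b
  set μ := (mollMeasure ρ).prod (mollMeasure ρ)
  -- The kernel is evaluated at a difference, so the increment of the second point enters with a
  -- minus sign.
  have e : kerQ E c a b ((1 - s) • h) (-((1 - s') • k)) = -((1 - s) * (1 - s') * kerQ E c a b h k)
      := by
    rw [← neg_smul, kerQ_smul_left, kerQ_smul_right]; ring
  have hint : (∫ p, ker E f a b ((1 - s) • (x + h) + s • p.1 - ((1 - s') • (x + k) + s' • p.2)) ∂μ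
      - ∫ p, ker E f a b ((1 - s) • x + s • p.1 - ((1 - s') • (x + k) + s' • p.2)) ∂μ
      - (∫ p, ker E f a b ((1 - s) • (x + h) + s • p.1 - ((1 - s') • x + s' • p.2)) ∂μ
      - ∫ p, ker E f a b ((1 - s) • x + s • p.1 - ((1 - s') • x + s' • p.2)) ∂μ))
      + (1 - s) * (1 - s') * kerQ E c a b h k
      = ∫ p, ((ker E f a b ((1 - s) • (x + h) + s • p.1 - ((1 - s') • (x + k) + s' • p.2))
      - ker E f a b ((1 - s) • x + s • p.1 - ((1 - s') • (x + k) + s' • p.2))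
      - (ker E f a b ((1 - s) • (x + h) + s • p.1 - ((1 - s') • x + s' • p.2))
      - ker E f a b ((1 - s) • x + s • p.1 - ((1 - s') • x + s' • p.2))))
      + (1 - s) * (1 - s') * kerQ E c a b h k) ∂μ := by
    exact integral_second_difference i1 i2 i3 i4 _
  rw [hint]
  have hN : ∀ᵐ p ∂μ, ‖(ker E f a b ((1 - s) • (x + h) + s • p.1 - ((1 - s') • (x + k) + s' • p.2))
      - ker E f a b ((1 - s) • x + s • p.1 - ((1 - s') • (x + k) + s' • p.2))
      - (ker E f a b ((1 - s) • (x + h) + s • p.1 - ((1 - s') • x + s' • p.2))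
      - ker E f a b ((1 - s) • x + s • p.1 - ((1 - s') • x + s' • p.2))))
      + (1 - s) * (1 - s') * kerQ E c a b h k‖ ≤ η * (‖h‖ * ‖k‖ * (‖a‖ * ‖b‖)) := by
    filter_upwards [ae_prod_mem K hρ] with p hp
    set z := (1 - s) • x + s • p.1 - ((1 - s') • x + s' • p.2) with hz
    have hzδ : ‖z‖ < δ := by
      refine (norm_contraction_sub_le hd hs hs' hx hp.1 hp.2).trans_lt ?_
      have h1 := hsδ.trans_le (min_le_right _ _)
      have h2 := hs'δ.trans_le (min_le_right _ _)
      calc (s + s') * d < (δ / (2 * d) + δ / (2 * d)) * d := by gcongr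
        _ = δ := by field_simp; norm_num
    have hle : ∀ {t : ℝ} (y : R3), 0 ≤ t → t ≤ 1 → ‖t • y‖ ≤ ‖y‖ := fun y h0 h1 => by
      rw [norm_smul, Real.norm_eq_abs, abs_of_nonneg h0]
      exact mul_le_of_le_one_left (norm_nonneg _) h1
    have hs2 : 1 - s ≤ 1 := by linarith [hs.1]
    have hs2' : 1 - s' ≤ 1 := by linarith [hs'.1]
    have h1 := H a b z ((1 - s) • h) (-((1 - s') • k)) hzδ
      ((hle h hs1 hs2).trans_lt (hh.trans_le (min_le_left _ _)))
      (by rw [norm_neg]; exact (hle k hs1' hs2').trans_lt (hk.trans_le (min_le_left _ _)))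
    have e1 : (1 - s) • (x + h) + s • p.1 - ((1 - s') • (x + k) + s' • p.2)
        = z + (1 - s) • h + -((1 - s') • k) := by rw [hz]; module
    have e2 : (1 - s) • (x + h) + s • p.1 - ((1 - s') • x + s' • p.2)
        = z + (1 - s) • h := by rw [hz]; module
    have e3 : (1 - s) • x + s • p.1 - ((1 - s') • (x + k) + s' • p.2)
        = z + -((1 - s') • k) := by rw [hz]; module
    rw [e1, e2, e3, Real.norm_eq_abs]
    rw [e] at h1
    refine (le_of_eq ?_).trans (h1.trans ?_)
    · congr 1; ring
    · rw [norm_neg]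
      gcongr
      · exact hle h hs1 hs2
      · exact hle k hs1' hs2'
  simpa using norm_integral_le_of_norm_le_const hN

omit [IsProbabilityMeasure P] in
-- In the expanded square the main terms collapse to `-(s - s')² kerQ`, and the errors amount to
-- four times `η / 8`. The factor `‖h‖²` is essential: it survives division by the squared step when
-- increments become derivatives.
theorem norm_sq_increment_sub_le {η : ℝ} (hη : 0 < η) : ∃ δ > 0, ∀ s ∈ Set.Ioc (0 : ℝ) 1,
    ∀ s' ∈ Set.Ioc (0 : ℝ) 1, s < δ → s' < δ → ∀ x h a : R3, x ∈ Λ → x + h ∈ Λ → ‖h‖ < δ →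
    ‖(pairing hv (testField K hρ s (x + h) a) - pairing hv (testField K hρ s x a))
      - (pairing hv (testField K hρ s' (x + h) a) - pairing hv (testField K hρ s' x a))‖ ^ 2
      ≤ η * (‖h‖ ^ 2 * ‖a‖ ^ 2) := by
  have hE := K.pos
  obtain ⟨δ, hδ, H⟩ := inner_increment_increment K hρ hv (η := η / 8) (by positivity)
  set M := 2 * E * |c| + 1 with hM
  have hM0 : 0 < M := by positivity
  refine ⟨min δ (min 1 (η / (2 * M))), by positivity, ?_⟩
  intro s hs s' hs' hsδ hs'δ x h a hx hxh hh
  have hsδ1 := hsδ.trans_le (min_le_left _ _)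
  have hsδ1' := hs'δ.trans_le (min_le_left _ _)
  have hh1 := hh.trans_le (min_le_left _ _)
  have h11 := H s hs s hs hsδ1 hsδ1 x h h a a hx hxh hxh hh1 hh1
  have h12 := H s hs s' hs' hsδ1 hsδ1' x h h a a hx hxh hxh hh1 hh1
  have h22 := H s' hs' s' hs' hsδ1' hsδ1' x h h a a hx hxh hxh hh1 hh1
  have hQ := abs_kerQ_le (c := c) hE a a h h
  set A := pairing hv (testField K hρ s (x + h) a) - pairing hv (testField K hρ s x a)
  set B := pairing hv (testField K hρ s' (x + h) a) - pairing hv (testField K hρ s' x a)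
  set N := ‖h‖ * ‖h‖ * (‖a‖ * ‖a‖) with hN
  have hN0 : 0 ≤ N := by positivity
  set q := kerQ E c a a h h
  rw [norm_sub_sq_real, ← real_inner_self_eq_norm_sq, ← real_inner_self_eq_norm_sq]
  have hss : (s - s') ^ 2 ≤ η / (2 * M) := by
    have h1 := (hsδ.trans_le (min_le_right _ _))
    have h2 := (hs'δ.trans_le (min_le_right _ _))
    have h3 := h1.trans_le (min_le_right _ _)
    have h4 := h2.trans_le (min_le_right _ _)
    have h5 := h1.trans_le (min_le_left _ _)
    have h6 := h2.trans_le (min_le_left _ _)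
    have := hs.1
    have := hs'.1
    have h7 : |s - s'| ≤ 1 := by rw [abs_le]; constructor <;> linarith
    have h8 : |s - s'| ≤ η / (2 * M) := by rw [abs_le]; constructor <;> linarith
    rw [← sq_abs, pow_two]
    nlinarith [abs_nonneg (s - s')]
  have hqs : |(s - s') ^ 2 * q| ≤ η / 2 * N := by
    rw [abs_mul, abs_of_nonneg (sq_nonneg _)]
    calc (s - s') ^ 2 * |q| ≤ η / (2 * M) * (M * N) := by
          gcongr
          refine hQ.trans ?_
          rw [hM]; nlinarith
      _ = _ := by field_simp
  rw [abs_le] at h11 h12 h22 hqs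
  have : η * (‖h‖ ^ 2 * ‖a‖ ^ 2) = η * N := by rw [hN]; ring
  rw [this]
  nlinarith [h11.1, h11.2, h12.1, h12.2, h22.1, h22.2, hqs.1, hqs.2]

omit [IsProbabilityMeasure P] in
-- All covariances in the expanded square are close to the kernel at the origin, which cancels.
theorem norm_sq_value_sub_le {η : ℝ} (hη : 0 < η) : ∃ δ > 0, ∀ s ∈ Set.Ioc (0 : ℝ) 1,
    ∀ s' ∈ Set.Ioc (0 : ℝ) 1, s < δ → s' < δ → ∀ x a : R3, x ∈ Λ →
    ‖pairing hv (testField K hρ s x a) - pairing hv (testField K hρ s' x a)‖ ^ 2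
      ≤ η * ‖a‖ ^ 2 := by
  have hE := K.pos
  obtain ⟨δ, hδ, H⟩ : ∃ δ > 0, ∀ z : R3, ‖z‖ < δ →
      E / 3 * (2 * |f ‖z‖ - f 0| + 2 * (‖z‖ * |deriv f ‖z‖|)) < η / 4 := by
    have hc0 : ContDiffAt ℝ 2 f 0 := K.regular.contDiffAt
    have hf0 : ContinuousAt f 0 := hc0.continuousAt
    have hf1 : ContinuousAt (deriv f) 0 := hc0.deriv_of_two.continuousAt
    have h1 : ContinuousAt (fun r : ℝ => E / 3 * (2 * |f r - f 0| + 2 * (r * |deriv f r|))) 0 := by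
      fun_prop
    have h2 : ∀ᶠ r in 𝓝 (0 : ℝ), E / 3 * (2 * |f r - f 0| + 2 * (r * |deriv f r|)) < η / 4 := by
      refine h1.eventually (Iio_mem_nhds ?_)
      simp; positivity
    obtain ⟨δ, hδ, H⟩ := Metric.eventually_nhds_iff.1 h2
    exact ⟨δ, hδ, fun z hz => H (by simpa using hz)⟩
  obtain ⟨d, hd0, hd⟩ := exists_diam K
  refine ⟨δ / (2 * d), by positivity, ?_⟩
  intro s hs s' hs' hsδ hs'δ x a hx
  have := hρ.isProbabilityMeasure
  have key : ∀ t ∈ Set.Ioc (0 : ℝ) 1, ∀ t' ∈ Set.Ioc (0 : ℝ) 1, t < δ / (2 * d) →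
      t' < δ / (2 * d) → |inner ℝ (pairing hv (testField K hρ t x a))
      (pairing hv (testField K hρ t' x a)) - ker E f a a 0| ≤ η / 4 * (‖a‖ * ‖a‖) := by
    intro t ht t' ht' h1 h2
    rw [inner_testField_testField K hρ hv ht ht' hx hx]
    have i1 := integrable_ker_contraction K hρ ht ht' hx hx a a
    have e : ker E f a a 0
        = ∫ _, ker E f a a 0 ∂((mollMeasure ρ).prod (mollMeasure ρ)) := by simp
    rw [e, ← integral_sub i1 (integrable_const _)]
    have hN : ∀ᵐ p ∂((mollMeasure ρ).prod (mollMeasure ρ)),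
        ‖ker E f a a ((1 - t) • x + t • p.1 - ((1 - t') • x + t' • p.2)) - ker E f a a 0‖
          ≤ η / 4 * (‖a‖ * ‖a‖) := by
      filter_upwards [ae_prod_mem K hρ] with p hp
      refine (abs_ker_sub_zero_le hE a a _).trans ?_
      gcongr
      refine (H _ ?_).le
      refine (norm_contraction_sub_le hd ht ht' hx hp.1 hp.2).trans_lt ?_
      calc (t + t') * d < (δ / (2 * d) + δ / (2 * d)) * d := by gcongr
        _ = δ := by field_simp; norm_num
    simpa using norm_integral_le_of_norm_le_const hN
  have h11 := key s hs s hs hsδ hsδ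
  have h12 := key s hs s' hs' hsδ hs'δ
  have h22 := key s' hs' s' hs' hs'δ hs'δ
  rw [norm_sub_sq_real, ← real_inner_self_eq_norm_sq, ← real_inner_self_eq_norm_sq]
  rw [abs_le] at h11 h12 h22
  nlinarith [h11.1, h11.2, h12.1, h12.2, h22.1, h22.2]

omit K in
omit [IsProbabilityMeasure P] in
theorem norm_sq_eq_integral (ξ : Lp ℝ 2 P) : ‖ξ‖ ^ 2 = ∫ ω, ξ ω ^ 2 ∂P := by
  rw [← real_inner_self_eq_norm_sq, L2.inner_def]
  simp [pow_two]

omit K in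
theorem lintegral_pow_four_of_mem (hv : IsGaussianFlow P Λ E f v) {ξ : Lp ℝ 2 P}
    (hξ : ξ ∈ gaussianSpace hv) :
    ∫⁻ ω, ‖ξ ω‖ₑ ^ 4 ∂P = fourthMoment * ENNReal.ofReal (‖ξ‖ ^ 2) ^ 2 := by
  obtain ⟨h1, h2⟩ := centredGaussian_of_mem hv hξ
  rw [lintegral_enorm_pow_four h1 h2, norm_sq_eq_integral]

omit [IsProbabilityMeasure P] in
theorem coeFn_pairing_testField (s : ℝ) (x a : R3) :
    pairing hv (testField K hρ s x a) =ᵐ[P] fun ω => inner ℝ a (moll Λ ρ s (v ω) x) := by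
  filter_upwards [coeFn_pairing hv (testField K hρ s x a)] with ω hω
  rw [hω, inner_testField K hρ]

include hρ in
theorem differentiable_moll {s : ℝ} (hs : 0 < s) (g : L2Field Λ) :
    Differentiable ℝ (moll Λ ρ s g) :=
  (hρ.contDiff_moll hs K.measurableSet (integrableOn_field K g)).differentiable one_ne_zero

include hρ hv in
/-- Fourth moments of the differences of the derivatives of the mollified flow. -/
theorem lintegral_fderiv_moll_sub_le {η : ℝ} (hη : 0 < η) : ∃ δ > 0, ∀ s ∈ Set.Ioc (0 : ℝ) 1,
    ∀ s' ∈ Set.Ioc (0 : ℝ) 1, s < δ → s' < δ → ∀ x ∈ interior Λ, ∀ h a : R3, ‖h‖ ≤ 1 → ‖a‖ ≤ 1 →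
    ∫⁻ ω, ‖inner ℝ a (fderiv ℝ (moll Λ ρ s (v ω)) x h - fderiv ℝ (moll Λ ρ s' (v ω)) x h)‖ₑ ^ 4 ∂P
      ≤ fourthMoment * ENNReal.ofReal η ^ 2 := by
  obtain ⟨δ, hδ, H⟩ := norm_sq_increment_sub_le K hρ hv hη
  refine ⟨δ, hδ, ?_⟩
  intro s hs s' hs' hsδ hs'δ x hx h a hh ha
  set t : ℕ → ℝ := fun n => 1 / ((n : ℝ) + 1) with ht
  have ht0 : ∀ n, 0 < t n := fun n => by positivity
  have htlim : Tendsto t atTop (𝓝 0) := tendsto_one_div_add_atTop_nhds_zero_nat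
  set q : ℕ → Ω → ℝ := fun n ω => (t n)⁻¹ * inner ℝ a ((moll Λ ρ s (v ω) (x + t n • h)
    - moll Λ ρ s (v ω) x) - (moll Λ ρ s' (v ω) (x + t n • h) - moll Λ ρ s' (v ω) x)) with hq
  set ξ : ℕ → Lp ℝ 2 P := fun n => (t n)⁻¹ •
    ((pairing hv (testField K hρ s (x + t n • h) a) - pairing hv (testField K hρ s x a))
      - (pairing hv (testField K hρ s' (x + t n • h) a) - pairing hv (testField K hρ s' x a)))
    with hξ
  have hqξ : ∀ n, ξ n =ᵐ[P] q n := fun n => by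
    filter_upwards [Lp.coeFn_smul (t n)⁻¹ ((pairing hv (testField K hρ s (x + t n • h) a)
      - pairing hv (testField K hρ s x a)) - (pairing hv (testField K hρ s' (x + t n • h) a)
      - pairing hv (testField K hρ s' x a))),
      Lp.coeFn_sub (pairing hv (testField K hρ s (x + t n • h) a)
      - pairing hv (testField K hρ s x a)) (pairing hv (testField K hρ s' (x + t n • h) a)
      - pairing hv (testField K hρ s' x a)),
      Lp.coeFn_sub (pairing hv (testField K hρ s (x + t n • h) a))
        (pairing hv (testField K hρ s x a)),
      Lp.coeFn_sub (pairing hv (testField K hρ s' (x + t n • h) a))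
        (pairing hv (testField K hρ s' x a)),
      coeFn_pairing_testField K hρ hv s (x + t n • h) a, coeFn_pairing_testField K hρ hv s x a,
      coeFn_pairing_testField K hρ hv s' (x + t n • h) a,
      coeFn_pairing_testField K hρ hv s' x a] with ω h1 h2 h3 h4 h5 h6 h7 h8
    simp only [hξ, hq]
    rw [h1, Pi.smul_apply, h2, Pi.sub_apply, h3, h4, Pi.sub_apply, Pi.sub_apply, h5, h6, h7, h8]
    simp only [inner_sub_right, smul_eq_mul]
  have hmem : ∀ n, ξ n ∈ gaussianSpace hv := fun n =>
    Submodule.smul_mem _ _ (Submodule.sub_mem _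
      (Submodule.sub_mem _ (pairing_mem hv _) (pairing_mem hv _))
      (Submodule.sub_mem _ (pairing_mem hv _) (pairing_mem hv _)))
  -- The difference quotients are Gaussian with second moment at most `η`, uniformly in the step;
  -- `x` is interior so that the shifted points are eventually in `Λ`. Fatou's lemma then carries
  -- the bound to the derivative.
  have hbound : ∀ᶠ n in atTop, ∫⁻ ω, ‖q n ω‖ₑ ^ 4 ∂P ≤ fourthMoment * ENNReal.ofReal η ^ 2 := by
    have h1 : Tendsto (fun n => x + t n • h) atTop (𝓝 x) := by
      simpa using (htlim.smul_const h).const_add x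
    have h2 := h1.eventually (isOpen_interior.mem_nhds hx)
    have h3 := htlim.eventually (Iio_mem_nhds hδ)
    filter_upwards [h2, h3] with n hn1 hn2
    have e : ∫⁻ ω, ‖q n ω‖ₑ ^ 4 ∂P = ∫⁻ ω, ‖ξ n ω‖ₑ ^ 4 ∂P :=
      lintegral_congr_ae ((hqξ n).mono fun ω hω => by simp only [hω])
    rw [e, lintegral_pow_four_of_mem hv (hmem n)]
    gcongr
    have hth : ‖t n • h‖ ≤ t n := by
      rw [norm_smul, Real.norm_eq_abs, abs_of_pos (ht0 n)]
      exact mul_le_of_le_one_right (ht0 n).le hh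
    have h4 := H s hs s' hs' hsδ hs'δ x (t n • h) a (interior_subset hx) (interior_subset hn1)
      (hth.trans_lt hn2)
    simp only [hξ]
    rw [norm_smul, mul_pow, Real.norm_eq_abs, abs_of_pos (inv_pos.2 (ht0 n))]
    calc _ ≤ (t n)⁻¹ ^ 2 * (η * (‖t n • h‖ ^ 2 * ‖a‖ ^ 2)) := by gcongr
      _ ≤ (t n)⁻¹ ^ 2 * (η * (t n ^ 2 * 1 ^ 2)) := by gcongr
      _ = η := by have := (ht0 n).ne'; field_simp
  have hlim : ∀ ω, Tendsto (fun n => ‖q n ω‖ₑ ^ 4) atTop (𝓝 (‖inner ℝ a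
      (fderiv ℝ (moll Λ ρ s (v ω)) x h - fderiv ℝ (moll Λ ρ s' (v ω)) x h)‖ₑ ^ 4)) := by
    intro ω
    refine ((ENNReal.continuous_pow 4).tendsto _).comp (Tendsto.enorm ?_)
    have hd := fun {σ : ℝ} (hσ : 0 < σ) =>
      ((differentiable_moll K hρ hσ (v ω) x).hasFDerivAt.hasLineDerivAt h).tendsto_slope_zero
    have htn : Tendsto t atTop (𝓝[≠] 0) :=
      tendsto_nhdsWithin_iff.2 ⟨htlim, Eventually.of_forall fun n => (ht0 n).ne'⟩
    have h1 := ((hd hs.1).comp htn).sub ((hd hs'.1).comp htn)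
    have h2 := (tendsto_const_nhds (x := a)).inner (𝕜 := ℝ) h1
    refine h2.congr fun n => ?_
    simp only [hq, Function.comp]
    rw [← smul_sub, inner_smul_right]
  calc ∫⁻ ω, ‖inner ℝ a (fderiv ℝ (moll Λ ρ s (v ω)) x h
        - fderiv ℝ (moll Λ ρ s' (v ω)) x h)‖ₑ ^ 4 ∂P
      = ∫⁻ ω, liminf (fun n => ‖q n ω‖ₑ ^ 4) atTop ∂P :=
        lintegral_congr fun ω => ((hlim ω).liminf_eq).symm
    _ ≤ liminf (fun n => ∫⁻ ω, ‖q n ω‖ₑ ^ 4 ∂P) atTop :=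
        lintegral_liminf_le' fun n => (((Lp.aestronglyMeasurable (ξ n)).congr (hqξ n)).aemeasurable
          |>.enorm.pow_const 4)
    _ ≤ _ := liminf_le_of_frequently_le' hbound.frequently

include hρ hv in
theorem lintegral_moll_sub_le {η : ℝ} (hη : 0 < η) : ∃ δ > 0, ∀ s ∈ Set.Ioc (0 : ℝ) 1,
    ∀ s' ∈ Set.Ioc (0 : ℝ) 1, s < δ → s' < δ → ∀ x ∈ Λ, ∀ a : R3, ‖a‖ ≤ 1 →
    ∫⁻ ω, ‖inner ℝ a (moll Λ ρ s (v ω) x - moll Λ ρ s' (v ω) x)‖ₑ ^ 4 ∂P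
      ≤ fourthMoment * ENNReal.ofReal η ^ 2 := by
  obtain ⟨δ, hδ, H⟩ := norm_sq_value_sub_le K hρ hv hη
  refine ⟨δ, hδ, ?_⟩
  intro s hs s' hs' hsδ hs'δ x hx a ha
  set ξ : Lp ℝ 2 P := pairing hv (testField K hρ s x a) - pairing hv (testField K hρ s' x a) with hξ
  have h1 : ∫⁻ ω, ‖inner ℝ a (moll Λ ρ s (v ω) x - moll Λ ρ s' (v ω) x)‖ₑ ^ 4 ∂P
      = ∫⁻ ω, ‖ξ ω‖ₑ ^ 4 ∂P := by
    refine lintegral_congr_ae ?_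
    filter_upwards [Lp.coeFn_sub (pairing hv (testField K hρ s x a))
      (pairing hv (testField K hρ s' x a)), coeFn_pairing_testField K hρ hv s x a,
      coeFn_pairing_testField K hρ hv s' x a] with ω h1 h2 h3
    rw [hξ, h1, Pi.sub_apply, h2, h3, inner_sub_right]
  rw [h1, lintegral_pow_four_of_mem hv (Submodule.sub_mem _ (pairing_mem hv _) (pairing_mem hv _))]
  gcongr
  refine (H s hs s' hs' hsδ hs'δ x a hx).trans ?_
  have : ‖a‖ ^ 2 ≤ 1 := pow_le_one₀ (norm_nonneg _) ha
  nlinarith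

end Flow

/-! ### A continuous, almost everywhere differentiable version -/

/-- The standard basis of `ℝ³`. -/
noncomputable abbrev basisVec (i : Fin 3) : R3 := EuclideanSpace.single i 1

theorem norm_basisVec (i : Fin 3) : ‖basisVec i‖ = 1 := by simp

theorem inner_basisVec (i : Fin 3) (y : R3) : inner ℝ (basisVec i) y = y i := by
  simp [basisVec, EuclideanSpace.inner_single_left]

theorem sum_smul_basisVec (y : R3) : ∑ i, y i • basisVec i = y := by
  ext j
  simp [basisVec, Pi.single_apply]

theorem enorm_sum_pow_four_le (x : Fin 3 → ℝ≥0∞) : (∑ i, x i) ^ 4 ≤ 27 * ∑ i, x i ^ 4 := by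
  have h := ENNReal.rpow_sum_le_const_mul_sum_rpow Finset.univ x (p := 4) (by norm_num)
  have e : ((4 : ℝ) - 1) = ((3 : ℕ) : ℝ) := by norm_num
  rw [e] at h
  have e4 : ∀ y : ℝ≥0∞, y ^ (4 : ℝ) = y ^ 4 := fun y => by
    rw [← ENNReal.rpow_natCast]; norm_num
  simp only [e4, ENNReal.rpow_natCast] at h
  refine h.trans_eq ?_
  norm_num

theorem enorm_pow_four_le (y : R3) : ‖y‖ₑ ^ 4 ≤ 27 * ∑ i, ‖y i‖ₑ ^ 4 := by
  refine le_trans ?_ (enorm_sum_pow_four_le _)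
  gcongr
  conv_lhs => rw [← sum_smul_basisVec y]
  refine (enorm_sum_le _ _).trans (Finset.sum_le_sum fun i _ => ?_)
  rw [enorm_smul]
  simp [enorm_eq_nnnorm]

theorem enorm_clm_pow_four_le (L : R3 →L[ℝ] R3) :
    ‖L‖ₑ ^ 4 ≤ 27 * ∑ j, (27 * ∑ i, ‖L (basisVec j) i‖ₑ ^ 4) := by
  have h1 : ‖L‖ₑ ≤ ∑ j, ‖L (basisVec j)‖ₑ := by
    have h2 : ‖L‖ ≤ ∑ j, ‖L (basisVec j)‖ := by
      refine L.opNorm_le_bound (by positivity) fun y => ?_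
      conv_lhs => rw [← sum_smul_basisVec y, map_sum]
      rw [Finset.sum_mul]
      refine (norm_sum_le _ _).trans (Finset.sum_le_sum fun i _ => ?_)
      rw [map_smul, norm_smul, mul_comm]
      gcongr
      exact PiLp.norm_apply_le y i
    simp only [← ofReal_norm]
    rw [← ENNReal.ofReal_sum_of_nonneg fun _ _ => norm_nonneg _]
    exact ENNReal.ofReal_le_ofReal h2
  calc ‖L‖ₑ ^ 4 ≤ (∑ j, ‖L (basisVec j)‖ₑ) ^ 4 := by gcongr
    _ ≤ 27 * ∑ j, ‖L (basisVec j)‖ₑ ^ 4 := enorm_sum_pow_four_le _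
    _ ≤ _ := by gcongr with j; exact enorm_pow_four_le _

section Version
variable {Ω : Type*} [MeasurableSpace Ω] {P : Measure Ω} [IsProbabilityMeasure P]

/-- Directional derivatives are limits of difference quotients, which are jointly measurable because
paths are continuous. -/
theorem measurable_fderiv_apply {u : Ω → R3 → R3} (hu : ∀ ω, ContDiff ℝ 1 (u ω))
    (hm : ∀ x, Measurable fun ω => u ω x) (h : R3) :
    Measurable fun p : R3 × Ω => fderiv ℝ (u p.2) p.1 h := by
  have hjm : Measurable fun p : R3 × Ω => u p.2 p.1 :=
    measurable_uncurry_of_continuous_of_measurable (u := fun x ω => u ω x)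
      (fun ω => (hu ω).continuous) hm
  set t : ℕ → ℝ := fun n => 1 / ((n : ℝ) + 1) with ht
  have ht0 : ∀ n, 0 < t n := fun n => by positivity
  have htlim : Tendsto t atTop (𝓝[≠] 0) := tendsto_nhdsWithin_iff.2
    ⟨tendsto_one_div_add_atTop_nhds_zero_nat, Eventually.of_forall fun n => (ht0 n).ne'⟩
  refine measurable_of_tendsto_metrizable
    (f := fun n (p : R3 × Ω) => (t n)⁻¹ • (u p.2 (p.1 + t n • h) - u p.2 p.1)) (fun n => ?_) ?_
  · have h1 : Measurable fun p : R3 × Ω => u p.2 (p.1 + t n • h) := hjm.comp ((measurable_fst.add_const (t n • h)).prodMk measurable_snd)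
    exact (h1.sub hjm).const_smul (t n)⁻¹
  · refine tendsto_pi_nhds.2 fun p => ?_
    exact (((((hu p.2).differentiable one_ne_zero) p.1).hasFDerivAt.hasLineDerivAt
      h).tendsto_slope_zero.comp htlim).congr fun n => by simp

/-- Kolmogorov-type criterion: a sequence of smooth random fields whose values at `0` and
derivatives converge fast enough in `L⁴` has a continuous limit that is almost everywhere
differentiable. -/
theorem exists_regular_version {Λ : Set R3} (hcomp : IsCompact Λ) (hconv : Convex ℝ Λ)
    (h0 : (0 : R3) ∈ Λ) (hpos : volume Λ ≠ 0) {u : ℕ → Ω → R3 → R3}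
    (hu : ∀ n ω, ContDiff ℝ 1 (u n ω)) (hm : ∀ n x, Measurable fun ω => u n ω x)
    {ε : ℕ → ℝ≥0∞} (hε : ∑' n, 16 ^ n * ε n ≠ ∞)
    (hd : ∀ n, ∀ x ∈ interior Λ, ∀ i j, ∫⁻ ω, ‖(fderiv ℝ (u (n + 1) ω) x (basisVec j)
      - fderiv ℝ (u n ω) x (basisVec j)) i‖ₑ ^ 4 ∂P ≤ ε n)
    (hval : ∀ n i, ∫⁻ ω, ‖(u (n + 1) ω 0 - u n ω 0) i‖ₑ ^ 4 ∂P ≤ ε n) :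
    ∃ W : R3 → Ω → R3, Measurable (Function.uncurry W) ∧
      (∀ ω, ContinuousOn (fun x => W x ω) Λ) ∧
      (∀ᵐ ω ∂P, ∀ x ∈ Λ, Tendsto (fun n => u n ω x) atTop (𝓝 (W x ω))) ∧
      ∀ᵐ ω ∂P, ∀ᵐ z, z ∈ interior Λ → DifferentiableAt ℝ (fun x => W x ω) z := by
  have hΛm : MeasurableSet Λ := hcomp.isClosed.measurableSet
  have hfin : volume Λ ≠ ∞ := hcomp.measure_lt_top.ne
  set Φ : ℕ → R3 → Ω → ℝ≥0∞ := fun n x ω => 27 * ∑ j, (27 * ∑ i,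
    ‖(fderiv ℝ (u (n + 1) ω) x (basisVec j) - fderiv ℝ (u n ω) x (basisVec j)) i‖ₑ ^ 4) with hΦ
  set Ψ : ℕ → Ω → ℝ≥0∞ := fun n ω => 27 * ∑ i, ‖(u (n + 1) ω 0 - u n ω 0) i‖ₑ ^ 4 with hΨ
  have hΦm : ∀ n, Measurable (Function.uncurry (Φ n)) := by
    intro n
    refine Measurable.const_mul (Finset.measurable_sum _ fun j _ =>
      Measurable.const_mul (Finset.measurable_sum _ fun i _ => ?_) _) _
    have h1 := (measurable_fderiv_apply (hu (n + 1)) (hm (n + 1)) (basisVec j)).sub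
      (measurable_fderiv_apply (hu n) (hm n) (basisVec j))
    exact (((EuclideanSpace.proj i : R3 →L[ℝ] ℝ).continuous.measurable.comp h1).enorm).pow_const 4
  have hΨm : ∀ n, Measurable (Ψ n) := by
    intro n
    refine Measurable.const_mul (Finset.measurable_sum _ fun i _ => ?_) _
    have h1 := (hm (n + 1) 0).sub (hm n 0)
    exact (((EuclideanSpace.proj i : R3 →L[ℝ] ℝ).continuous.measurable.comp h1).enorm).pow_const 4
  set S : Ω → ℝ≥0∞ := fun ω => ∑' n, 16 ^ n * ((∫⁻ x in Λ, Φ n x ω) + Ψ n ω) with hS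
  have hIm : ∀ n, Measurable fun ω => ∫⁻ x in Λ, Φ n x ω := fun n =>
    Measurable.lintegral_prod_left' (hΦm n)
  have hIΨ : ∀ n, Measurable fun ω => (∫⁻ x in Λ, Φ n x ω) + Ψ n ω := fun n =>
    (hIm n).add (hΨm n)
  have hSm : Measurable S := Measurable.tsum fun n => (hIΨ n).const_mul _
  -- `S` dominates the series in `exists_regular_limit`; a finite expectation makes it finite almost
  -- surely.
  have hSfin : ∫⁻ ω, S ω ∂P ≠ ∞ := by
    set C : ℝ≥0∞ := 27 * ∑ _j : Fin 3, (27 * ∑ _i : Fin 3, 1) with hC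
    set C' : ℝ≥0∞ := 27 * ∑ _i : Fin 3, 1 with hC'
    have hCt : C * volume Λ + C' ≠ ∞ := by
      refine ENNReal.add_ne_top.2 ⟨ENNReal.mul_ne_top ?_ hfin, ?_⟩ <;> simp [hC, hC'] <;>
        exact ENNReal.mul_ne_top (by norm_num) (by norm_num)
    have hΦi : ∀ n, ∀ x ∈ interior Λ, ∫⁻ ω, Φ n x ω ∂P ≤ C * ε n := by
      intro n x hx
      have hm' : ∀ i j, Measurable fun ω => ‖(fderiv ℝ (u (n + 1) ω) x (basisVec j)
          - fderiv ℝ (u n ω) x (basisVec j)) i‖ₑ ^ 4 := fun i j => by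
        have h1 := ((measurable_fderiv_apply (hu (n + 1)) (hm (n + 1)) (basisVec j)).sub
          (measurable_fderiv_apply (hu n) (hm n) (basisVec j))).comp
            (measurable_prodMk_left (x := x))
        exact (((EuclideanSpace.proj i : R3 →L[ℝ] ℝ).continuous.measurable.comp
          h1).enorm).pow_const 4
      simp only [hΦ]
      rw [lintegral_const_mul _ (by fun_prop), lintegral_finsetSum _ (by fun_prop), hC, mul_assoc,
        Finset.sum_mul]
      gcongr with j _
      rw [lintegral_const_mul _ (by fun_prop), lintegral_finsetSum _ (by fun_prop), mul_assoc,
        Finset.sum_mul]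
      gcongr with i _
      rw [one_mul]
      exact hd n x hx i j
    have hΨi : ∀ n, ∫⁻ ω, Ψ n ω ∂P ≤ C' * ε n := by
      intro n
      have hm' : ∀ i, Measurable fun ω => ‖(u (n + 1) ω 0 - u n ω 0) i‖ₑ ^ 4 := fun i => by
        have h1 := (hm (n + 1) 0).sub (hm n 0)
        exact (((EuclideanSpace.proj i : R3 →L[ℝ] ℝ).continuous.measurable.comp
          h1).enorm).pow_const 4
      simp only [hΨ]
      rw [lintegral_const_mul _ (by fun_prop), lintegral_finsetSum _ (by fun_prop), hC', mul_assoc,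
        Finset.sum_mul]
      gcongr with i _
      rw [one_mul]
      exact hval n i
    -- The boundary of a convex set is a null set, so moment bounds at interior points suffice.
    have hfr : ∀ᵐ x ∂(volume.restrict Λ), x ∈ interior Λ := by
      rw [ae_restrict_iff' hΛm]
      have := (hconv.addHaar_frontier volume)
      filter_upwards [measure_eq_zero_iff_ae_notMem.1 this] with x hx hxΛ
      by_contra h
      exact hx ⟨subset_closure hxΛ, h⟩
    have hone : ∀ n, ∫⁻ ω, 16 ^ n * ((∫⁻ x in Λ, Φ n x ω) + Ψ n ω) ∂P
        ≤ (C * volume Λ + C') * (16 ^ n * ε n) := by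
      intro n
      rw [lintegral_const_mul _ (hIΨ n), lintegral_add_right _ (hΨm n),
        lintegral_lintegral_swap (f := fun ω x => Φ n x ω)
          (hΦm n |>.comp measurable_swap |>.aemeasurable), mul_left_comm]
      gcongr
      rw [add_mul]
      refine add_le_add ?_ (hΨi n)
      calc ∫⁻ x in Λ, ∫⁻ ω, Φ n x ω ∂P ≤ ∫⁻ _ in Λ, C * ε n :=
            lintegral_mono_ae (hfr.mono fun x hx => hΦi n x hx)
        _ = C * volume Λ * ε n := by
            rw [setLIntegral_const]; ring
    rw [hS, lintegral_tsum fun n => ((hIΨ n).const_mul _).aemeasurable]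
    refine ne_top_of_le_ne_top ?_ (ENNReal.tsum_le_tsum hone)
    rw [ENNReal.tsum_mul_left]
    exact ENNReal.mul_ne_top hCt hε
  set G : Set Ω := {ω | S ω ≠ ∞} with hG
  have hGm : MeasurableSet G := (hSm (measurableSet_singleton ∞)).compl
  have hGae : ∀ᵐ ω ∂P, ω ∈ G := (ae_lt_top hSm hSfin).mono fun ω h => h.ne
  have hlim : ∀ ω, ∃ w : R3 → R3, ω ∈ G → (ContinuousOn w Λ ∧
      (∀ x ∈ Λ, Tendsto (fun n => u n ω x) atTop (𝓝 (w x))) ∧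
      ∀ᵐ z, z ∈ interior Λ → DifferentiableAt ℝ w z) := by
    intro ω
    by_cases hω : ω ∈ G
    · obtain ⟨w, hw⟩ := exists_regular_limit hcomp hconv h0 hpos (u := fun n => u n ω)
        (fun n => hu n ω) (by
          refine ne_top_of_le_ne_top hω (ENNReal.tsum_le_tsum fun n => ?_)
          gcongr with x
          · exact enorm_clm_pow_four_le _
          · exact enorm_pow_four_le _)
      exact ⟨w, fun _ => hw⟩
    · exact ⟨0, fun h => absurd h hω⟩
  choose w hw using hlim
  -- The value 0 off `Λ ×ˢ G` makes `W` jointly measurable, and continuous on `Λ` for every `ω`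
  -- rather than almost every one.
  set W : R3 → Ω → R3 := fun x ω => (Λ ×ˢ G).indicator (fun p => w p.2 p.1) (x, ω) with hW
  have hWw : ∀ ω ∈ G, ∀ x ∈ Λ, W x ω = w ω x := fun ω hω x hx => by
    simp [hW, hω, hx]
  refine ⟨W, ?_, ?_, ?_, ?_⟩
  · refine measurable_of_tendsto_metrizable
      (f := fun n => (Λ ×ˢ G).indicator (fun p : R3 × Ω => u n p.2 p.1)) (fun n => ?_) ?_
    · refine Measurable.indicator ?_ (hΛm.prod hGm)
      exact measurable_uncurry_of_continuous_of_measurable (u := fun x ω => u n ω x)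
        (fun ω => (hu n ω).continuous) (hm n)
    · refine tendsto_pi_nhds.2 fun p => ?_
      by_cases hp : p ∈ Λ ×ˢ G
      · have := (hw p.2 hp.2).2.1 p.1 hp.1
        simpa [Function.uncurry, hW, Set.indicator_of_mem hp] using this
      · simp [Function.uncurry, hW, Set.indicator_of_notMem hp]
  · intro ω
    by_cases hω : ω ∈ G
    · exact (hw ω hω).1.congr fun x hx => hWw ω hω x hx
    · simp only [hW]
      have : ∀ x, (Λ ×ˢ G).indicator (fun p : R3 × Ω => w p.2 p.1) (x, ω) = 0 := fun x =>
        Set.indicator_of_notMem (fun h => hω h.2) _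
      simp only [this]
      exact continuousOn_const
  · filter_upwards [hGae] with ω hω x hx
    rw [hWw ω hω x hx]
    exact (hw ω hω).2.1 x hx
  · filter_upwards [hGae] with ω hω
    filter_upwards [(hw ω hω).2.2] with z hz hzΛ
    refine (hz hzΛ).congr_of_eventuallyEq ?_
    filter_upwards [isOpen_interior.mem_nhds hzΛ] with y hy
    exact hWw ω hω y (interior_subset hy)

end Version

section Flow
variable {Ω : Type*} [MeasurableSpace Ω] {P : Measure Ω} [IsProbabilityMeasure P]
  {Λ : Set R3} {E c : ℝ} {f : ℝ → ℝ} {v : Ω → L2Field Λ}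

/-- A jointly measurable version `W` of the flow with continuous paths. -/
structure IsVersion (P : Measure Ω) (Λ : Set R3) (v : Ω → L2Field Λ) (ρ : R3 → ℝ) (s : ℕ → ℝ)
    (W : R3 → Ω → R3) : Prop where
  measurable : Measurable (Function.uncurry W)
  continuousOn : ∀ ω, ContinuousOn (fun x => W x ω) Λ
  ae_differentiableAt : ∀ᵐ ω ∂P, ∀ᵐ z, z ∈ interior Λ → DifferentiableAt ℝ (fun x => W x ω) z
  ae_eq : ∀ᵐ ω ∂P, (fun x => W x ω) =ᵐ[volume.restrict Λ] v ω
  mem_Ioc : ∀ n, s n ∈ Set.Ioc (0 : ℝ) 1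
  tendsto_zero : Tendsto s atTop (𝓝 0)
  ae_tendsto : ∀ᵐ ω ∂P, ∀ x ∈ Λ, Tendsto (fun n => moll Λ ρ (s n) (v ω) x) atTop (𝓝 (W x ω))

/-- The scales are chosen to decrease so fast that the second moments of successive differences are
at most `16⁻ⁿ`. The fourth moments are then of order `16⁻²ⁿ`, summable against the weights `16ⁿ`.
The limit represents `v` because the mollifications also converge to `v` almost everywhere. -/
theorem exists_isVersion (K : KernelDomain Λ E c f) {ρ : R3 → ℝ} (hρ : IsMollifier Λ ρ)
    (hv : IsGaussianFlow P Λ E f v) :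
    ∃ (s : ℕ → ℝ) (W : R3 → Ω → R3), IsVersion P Λ v ρ s W := by
  wlog hsm : StronglyMeasurable v generalizing v
  · obtain ⟨s, W, h⟩ := this (hv.congr hv.aestronglyMeasurable.ae_eq_mk)
      hv.aestronglyMeasurable.stronglyMeasurable_mk
    refine ⟨s, W, h.measurable, h.continuousOn, h.ae_differentiableAt, ?_, h.mem_Ioc,
      h.tendsto_zero, ?_⟩
    · filter_upwards [h.ae_eq, hv.aestronglyMeasurable.ae_eq_mk] with ω h1 h2
      rwa [h2]
    · filter_upwards [h.ae_tendsto, hv.aestronglyMeasurable.ae_eq_mk] with ω h1 h2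
      rwa [h2]
  have hη : ∀ n : ℕ, (0 : ℝ) < (1 / 16) ^ n := fun n => by positivity
  choose δ hδ hδH using fun n => lintegral_fderiv_moll_sub_le K hρ hv (hη n)
  choose δ' hδ' hδH' using fun n => lintegral_moll_sub_le K hρ hv (hη n)
  -- The condition is imposed on all later indices so that both `s n` and `s (n + 1)` lie below the
  -- thresholds of level `n`.
  obtain ⟨φ, hφ, hφH⟩ := extraction_forall_of_eventually
    (P := fun n k => ∀ m ≥ k, 1 / ((m : ℝ) + 1) < min (δ n) (δ' n)) (fun n => by
      have h1 := tendsto_one_div_add_atTop_nhds_zero_nat (𝕜 := ℝ) |>.eventually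
        (Iio_mem_nhds (lt_min (hδ n) (hδ' n)))
      obtain ⟨N, hN⟩ := eventually_atTop.1 h1
      exact eventually_atTop.2 ⟨N, fun k hk m hm => hN m (hk.trans hm)⟩)
  set s : ℕ → ℝ := fun n => 1 / ((φ n : ℝ) + 1) with hs
  have hsI : ∀ n, s n ∈ Set.Ioc (0 : ℝ) 1 := fun n => by
    refine ⟨by positivity, ?_⟩
    rw [hs]
    exact (div_le_one (by positivity)).2 (by linarith [(Nat.cast_nonneg (φ n) : (0 : ℝ) ≤ φ n)])
  have hslim : Tendsto s atTop (𝓝 0) :=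
    (tendsto_one_div_add_atTop_nhds_zero_nat (𝕜 := ℝ)).comp hφ.tendsto_atTop
  have hs1 : ∀ n, s n < min (δ n) (δ' n) := fun n => hφH n _ le_rfl
  have hs2 : ∀ n, s (n + 1) < min (δ n) (δ' n) := fun n => hφH n _ (hφ (Nat.lt_succ_self n)).le
  set ε : ℕ → ℝ≥0∞ := fun n => fourthMoment * ENNReal.ofReal ((1 / 16) ^ n) ^ 2 with hε
  have hεsum : ∑' n, 16 ^ n * ε n ≠ ∞ := by
    have e : ∀ n, 16 ^ n * ε n = fourthMoment * (16⁻¹ : ℝ≥0∞) ^ n := by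
      intro n
      have h16 : ENNReal.ofReal ((1 / 16) ^ n) = (16⁻¹ : ℝ≥0∞) ^ n := by
        rw [ENNReal.ofReal_pow (by norm_num), one_div, ENNReal.ofReal_inv_of_pos (by norm_num)]
        norm_num
      simp only [hε]
      rw [h16, pow_two, mul_left_comm, ← mul_assoc (16 ^ n), ← mul_pow,
        ENNReal.mul_inv_cancel (by norm_num) (by norm_num), one_pow, one_mul]
    simp only [e]
    rw [ENNReal.tsum_mul_left, ENNReal.tsum_geometric]
    refine ENNReal.mul_ne_top fourthMoment_lt_top.ne (ENNReal.inv_ne_top.2 ?_)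
    rw [ne_eq, tsub_eq_zero_iff_le, not_le]
    exact ENNReal.inv_lt_one.2 (by norm_num)
  have hu : ∀ n ω, ContDiff ℝ 1 (moll Λ ρ (s n) (v ω)) := fun n ω =>
    hρ.contDiff_moll (hsI n).1 K.measurableSet (integrableOn_field K _)
  have hm : ∀ n x, Measurable fun ω => moll Λ ρ (s n) (v ω) x := by
    intro n x
    have h1 : ∀ i, Measurable fun ω => moll Λ ρ (s n) (v ω) x i := fun i => by
      have h2 : (fun ω => moll Λ ρ (s n) (v ω) x i)
          = fun ω => inner ℝ (testField K hρ (s n) x (basisVec i)) (v ω) := by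
        funext ω; rw [inner_testField K hρ, inner_basisVec]
      rw [h2]
      exact (stronglyMeasurable_const.inner hsm).measurable
    exact (WithLp.measurable_toLp 2 (Fin 3 → ℝ)).comp (measurable_pi_lambda _ h1)
  obtain ⟨W, hW1, hW2, hW3, hW4⟩ := exists_regular_version (P := P) K.isCompact K.convex K.zero_mem
    K.volume_pos.ne' (u := fun n ω => moll Λ ρ (s n) (v ω)) hu hm hεsum
    (fun n x hx i j => by
      have := hδH n (s (n + 1)) (hsI _) (s n) (hsI _) ((hs2 n).trans_le (min_le_left _ _))
        ((hs1 n).trans_le (min_le_left _ _)) x hx (basisVec j) (basisVec i)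
        (norm_basisVec j).le (norm_basisVec i).le
      simpa only [inner_basisVec] using this)
    (fun n i => by
      have := hδH' n (s (n + 1)) (hsI _) (s n) (hsI _) ((hs2 n).trans_le (min_le_right _ _))
        ((hs1 n).trans_le (min_le_right _ _)) 0 K.zero_mem (basisVec i) (norm_basisVec i).le
      simpa only [inner_basisVec] using this)
  refine ⟨s, W, hW1, hW2, hW4, ?_, hsI, hslim, hW3⟩
  filter_upwards [hW3] with ω hω
  refine (ae_restrict_iff' K.measurableSet).2 ?_
  filter_upwards [hρ.ae_tendsto_moll K.isCompact K.convex (integrableOn_field K (v ω)) hsI hslim]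
    with x hx hxΛ
  exact tendsto_nhds_unique (hω x hxΛ) (hx hxΛ)

end Flow

/-! ### Random variables in the Gaussian space -/

section GaussianVar
variable {Ω : Type*} [MeasurableSpace Ω] {P : Measure Ω}
  {Λ : Set R3} {E : ℝ} {f : ℝ → ℝ} {v : Ω → L2Field Λ} (hv : IsGaussianFlow P Λ E f v)

/-- `X` represents an element of the Gaussian space of the flow. -/
def IsGaussianVar (X : Ω → ℝ) : Prop := ∃ ξ ∈ gaussianSpace hv, ξ =ᵐ[P] X

/-- `X n` converges to `X` in the Gaussian space of the flow. -/
def GaussianTendsto (X : ℕ → Ω → ℝ) (Y : Ω → ℝ) : Prop :=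
  ∃ (ξ : ℕ → Lp ℝ 2 P) (η : Lp ℝ 2 P), (∀ n, ξ n =ᵐ[P] X n) ∧ (η ∈ gaussianSpace hv ∧ η =ᵐ[P] Y) ∧
    Tendsto ξ atTop (𝓝 η)

theorem integral_mul_eq_inner {ξ η : Lp ℝ 2 P} {X Y : Ω → ℝ} (h : ξ =ᵐ[P] X) (h' : η =ᵐ[P] Y) :
    ∫ ω, X ω * Y ω ∂P = inner ℝ ξ η := by
  rw [L2.inner_def]
  refine integral_congr_ae ?_
  filter_upwards [h, h'] with ω h1 h2
  rw [h1, h2, real_inner_eq_re_inner, RCLike.inner_apply]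
  simp [mul_comm]

variable {hv}

theorem isGaussianVar_pairing (φ : L2Field Λ) : IsGaussianVar hv fun ω => inner ℝ φ (v ω) :=
  ⟨_, pairing_mem hv φ, coeFn_pairing hv φ⟩

namespace IsGaussianVar
variable {X Y : Ω → ℝ}

theorem congr (hX : IsGaussianVar hv X) (h : X =ᵐ[P] Y) : IsGaussianVar hv Y := by
  obtain ⟨ξ, h1, h2⟩ := hX
  exact ⟨ξ, h1, h2.trans h⟩

theorem add (hX : IsGaussianVar hv X) (hY : IsGaussianVar hv Y) :
    IsGaussianVar hv fun ω => X ω + Y ω := by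
  obtain ⟨ξ, h1, h2⟩ := hX
  obtain ⟨η, h3, h4⟩ := hY
  exact ⟨ξ + η, Submodule.add_mem _ h1 h3, (Lp.coeFn_add ξ η).trans (h2.add h4)⟩

theorem const_mul (hX : IsGaussianVar hv X) (t : ℝ) : IsGaussianVar hv fun ω => t * X ω := by
  obtain ⟨ξ, h1, h2⟩ := hX
  exact ⟨t • ξ, Submodule.smul_mem _ t h1, (Lp.coeFn_smul t ξ).trans (h2.const_smul t)⟩

theorem sub (hX : IsGaussianVar hv X) (hY : IsGaussianVar hv Y) :
    IsGaussianVar hv fun ω => X ω - Y ω :=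
  (hX.add (hY.const_mul (-1))).congr (Eventually.of_forall fun ω => by ring)

theorem zero : IsGaussianVar hv fun _ : Ω => (0 : ℝ) :=
  ⟨0, Submodule.zero_mem _, Lp.coeFn_zero _ _ _⟩

theorem sum {ι : Type*} (s : Finset ι) {Z : ι → Ω → ℝ} (hZ : ∀ i ∈ s, IsGaussianVar hv (Z i)) :
    IsGaussianVar hv fun ω => ∑ i ∈ s, Z i ω := by
  classical
  induction s using Finset.induction_on with
  | empty => simpa using zero
  | insert i s hi ih =>
    simp only [Finset.sum_insert hi]
    exact (hZ i (Finset.mem_insert_self _ _)).add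
      (ih fun j hj => hZ j (Finset.mem_insert_of_mem hj))

theorem memLp (hX : IsGaussianVar hv X) : MemLp X 2 P := by
  obtain ⟨ξ, h1, h2⟩ := hX
  exact (memLp_congr_ae h2).1 (Lp.memLp ξ)

theorem integrable_mul (hX : IsGaussianVar hv X) (hY : IsGaussianVar hv Y) :
    Integrable (fun ω => X ω * Y ω) P := hX.memLp.integrable_mul hY.memLp

theorem hasGaussianLaw [IsProbabilityMeasure P] (hX : IsGaussianVar hv X) : HasGaussianLaw X P := by
  obtain ⟨ξ, h1, h2⟩ := hX
  exact (centredGaussian_of_mem hv h1).1.congr h2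

theorem integral_eq_zero [IsProbabilityMeasure P] (hX : IsGaussianVar hv X) :
    ∫ ω, X ω ∂P = 0 := by
  obtain ⟨ξ, h1, h2⟩ := hX
  rw [← integral_congr_ae h2]
  exact (centredGaussian_of_mem hv h1).2

end IsGaussianVar

namespace GaussianTendsto
variable {X X' : ℕ → Ω → ℝ} {Y Y' : Ω → ℝ}

theorem isGaussianVar (h : GaussianTendsto hv X Y) : IsGaussianVar hv Y := by
  obtain ⟨ξ, η, -, h, -⟩ := h
  exact ⟨η, h⟩

theorem const (h : IsGaussianVar hv Y) : GaussianTendsto hv (fun _ => Y) Y := by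
  obtain ⟨η, h⟩ := h
  exact ⟨fun _ => η, η, fun _ => h.2, h, tendsto_const_nhds⟩

theorem tendsto_integral_mul (h : GaussianTendsto hv X Y) (h' : GaussianTendsto hv X' Y') :
    Tendsto (fun n => ∫ ω, X n ω * X' n ω ∂P) atTop (𝓝 (∫ ω, Y ω * Y' ω ∂P)) := by
  obtain ⟨ξ, η, h1, h2, h3⟩ := h
  obtain ⟨ξ', η', h1', h2', h3'⟩ := h'
  simp only [integral_mul_eq_inner (h1 _) (h1' _), integral_mul_eq_inner h2.2 h2'.2]
  exact h3.inner h3'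

/-- An almost surely convergent sequence which is Cauchy in `L²` converges in the Gaussian
space. -/
theorem of_ae_tendsto (hX : ∀ n, IsGaussianVar hv (X n))
    (hlim : ∀ᵐ ω ∂P, Tendsto (fun n => X n ω) atTop (𝓝 (Y ω)))
    (hC : ∀ η > 0, ∃ N, ∀ m ≥ N, ∀ n ≥ N, ∫ ω, (X m ω - X n ω) * (X m ω - X n ω) ∂P ≤ η) :
    GaussianTendsto hv X Y := by
  choose ξ hξ hξX using hX
  have hcau : CauchySeq ξ := by
    refine Metric.cauchySeq_iff.2 fun ε hε => ?_
    obtain ⟨N, hN⟩ := hC (ε ^ 2 / 2) (by positivity)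
    refine ⟨N, fun m hm n hn => ?_⟩
    have h1 : ξ m - ξ n =ᵐ[P] fun ω => X m ω - X n ω :=
      (Lp.coeFn_sub _ _).trans ((hξX m).sub (hξX n))
    have h2 := hN m hm n hn
    rw [integral_mul_eq_inner h1 h1, real_inner_self_eq_norm_sq] at h2
    rw [dist_eq_norm]
    refine lt_of_pow_lt_pow_left₀ 2 hε.le ?_
    have : 0 < ε ^ 2 := by positivity
    linarith
  obtain ⟨η, hη⟩ := cauchySeq_tendsto_of_complete hcau
  refine ⟨ξ, η, hξX, ⟨?_, ?_⟩, hη⟩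
  · exact (isClosed_gaussianSpace hv).mem_of_tendsto hη (Eventually.of_forall hξ)
  · obtain ⟨ns, hns, h1⟩ := (tendstoInMeasure_of_tendsto_Lp hη).exists_seq_tendsto_ae
    filter_upwards [h1, hlim, ae_all_iff.2 hξX] with ω h2 h3 h4
    refine tendsto_nhds_unique h2 ?_
    simp only [h4]
    exact h3.comp hns.tendsto_atTop

end GaussianTendsto
end GaussianVar

/-! ### Covariances of the continuous version -/

section Flow
variable {Ω : Type*} [MeasurableSpace Ω] {P : Measure Ω} [IsProbabilityMeasure P]
  {Λ : Set R3} {E c : ℝ} {f : ℝ → ℝ} {v : Ω → L2Field Λ} {ρ : R3 → ℝ} {s : ℕ → ℝ}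
  {W : R3 → Ω → R3}
  (K : KernelDomain Λ E c f) (hρ : IsMollifier Λ ρ) (hv : IsGaussianFlow P Λ E f v)
  (hW : IsVersion P Λ v ρ s W)
include K hρ hW

omit [IsProbabilityMeasure P] in
theorem gaussianTendsto_value {x : R3} (hx : x ∈ Λ) (a : R3) :
    GaussianTendsto hv (fun n ω => inner ℝ a (moll Λ ρ (s n) (v ω) x))
      (fun ω => inner ℝ a (W x ω)) := by
  refine GaussianTendsto.of_ae_tendsto (fun n => ?_) ?_ ?_
  · exact ⟨_, pairing_mem hv _, coeFn_pairing_testField K hρ hv (s n) x a⟩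
  · filter_upwards [hW.ae_tendsto] with ω hω
    exact tendsto_const_nhds.inner (hω x hx)
  · intro η hη
    obtain ⟨δ, hδ, H⟩ := norm_sq_value_sub_le K hρ hv (η := η / (1 + ‖a‖ ^ 2)) (by positivity)
    obtain ⟨N, hN⟩ := eventually_atTop.1 (hW.tendsto_zero.eventually (Iio_mem_nhds hδ))
    refine ⟨N, fun m hm n hn => ?_⟩
    have h1 := H (s m) (hW.mem_Ioc m) (s n) (hW.mem_Ioc n) (hN m hm) (hN n hn) x a hx
    have h2 : (pairing hv (testField K hρ (s m) x a) - pairing hv (testField K hρ (s n) x a)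
        : Lp ℝ 2 P) =ᵐ[P] fun ω => inner ℝ a (moll Λ ρ (s m) (v ω) x)
          - inner ℝ a (moll Λ ρ (s n) (v ω) x) :=
      (Lp.coeFn_sub _ _).trans ((coeFn_pairing_testField K hρ hv (s m) x a).sub
        (coeFn_pairing_testField K hρ hv (s n) x a))
    rw [integral_mul_eq_inner h2 h2, real_inner_self_eq_norm_sq]
    refine h1.trans ?_
    rw [div_mul_eq_mul_div, div_le_iff₀ (by positivity)]
    nlinarith

omit [IsProbabilityMeasure P] in
theorem isGaussianVar_value {x : R3} (hx : x ∈ Λ) (a : R3) :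
    IsGaussianVar hv (fun ω => inner ℝ a (W x ω)) :=
  (gaussianTendsto_value K hρ hv hW hx a).isGaussianVar

include hv in
omit [IsProbabilityMeasure P] in
/-- The covariance of the values of the flow. -/
theorem integral_value_mul_value {x y : R3} (hx : x ∈ Λ) (hy : y ∈ Λ) (a b : R3) :
    ∫ ω, inner ℝ a (W x ω) * inner ℝ b (W y ω) ∂P = ker E f a b (x - y) := by
  have h1 := (gaussianTendsto_value K hρ hv hW hx a).tendsto_integral_mul
    (gaussianTendsto_value K hρ hv hW hy b)
  refine tendsto_nhds_unique h1 ?_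
  have := hρ.isProbabilityMeasure
  have h2 : ∀ n, ∫ ω, inner ℝ a (moll Λ ρ (s n) (v ω) x) * inner ℝ b (moll Λ ρ (s n) (v ω) y) ∂P
      = ∫ p, ker E f a b ((1 - s n) • x + s n • p.1 - ((1 - s n) • y + s n • p.2))
        ∂((mollMeasure ρ).prod (mollMeasure ρ)) := fun n => by
    rw [integral_mul_eq_inner (coeFn_pairing_testField K hρ hv (s n) x a)
      (coeFn_pairing_testField K hρ hv (s n) y b),
      inner_testField_testField K hρ hv (hW.mem_Ioc n) (hW.mem_Ioc n) hx hy]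
  simp only [h2]
  have h3 : ker E f a b (x - y) = ∫ _, ker E f a b (x - y)
      ∂((mollMeasure ρ).prod (mollMeasure ρ)) := by simp
  rw [h3]
  obtain ⟨M, hM0, hM⟩ := K.exists_ker_bound
  refine tendsto_integral_of_dominated_convergence (fun _ => M * (‖a‖ * ‖b‖)) (fun n => ?_)
    (integrable_const _) (fun n => ?_) ?_
  · exact (integrable_ker_contraction K hρ (hW.mem_Ioc n) (hW.mem_Ioc n) hx hy a
      b).aestronglyMeasurable
  · filter_upwards [ae_prod_mem K hρ] with p hp
    exact hM _ (mem_contraction K (hW.mem_Ioc n) hx hp.1) _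
      (mem_contraction K (hW.mem_Ioc n) hy hp.2) a b
  · filter_upwards [ae_prod_mem K hρ] with p hp
    have h4 : ContinuousAt (ker E f a b) (x - y) :=
      continuousAt_ker K.pos (K.contDiffAt x hx y hy)
    refine h4.tendsto.comp ?_
    have hs := hW.tendsto_zero
    have h5 : Tendsto (fun n => (1 - s n) • x + s n • p.1 - ((1 - s n) • y + s n • p.2)) atTop
        (𝓝 ((1 - (0 : ℝ)) • x + (0 : ℝ) • p.1 - ((1 - (0 : ℝ)) • y + (0 : ℝ) • p.2))) := by
      exact ((((hs.const_sub 1).smul_const x).add (hs.smul_const p.1)).sub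
        (((hs.const_sub 1).smul_const y).add (hs.smul_const p.2)))
    simpa using h5

include hv in
/-- Covariances with `⟨φ, v⟩` may be computed pointwise. -/
theorem integral_inner_mul {Y : Ω → ℝ} (hY : IsGaussianVar hv Y) (φ : L2Field Λ) :
    ∫ ω, inner ℝ φ (v ω) * Y ω ∂P = ∫ z in Λ, ∫ ω, inner ℝ (φ z) (W z ω) * Y ω ∂P := by
  have := K.isFiniteMeasure
  have hWm : Measurable fun p : Ω × R3 => W p.2 p.1 := hW.measurable.comp measurable_swap
  have hYm : AEStronglyMeasurable Y P := hY.memLp.aestronglyMeasurable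
  have hφm : AEStronglyMeasurable φ (volume.restrict Λ) := Lp.aestronglyMeasurable φ
  have hsq : ∀ x ∈ Λ, ∀ i, Integrable (fun ω => W x ω i * W x ω i) P ∧
      ∫ ω, W x ω i * W x ω i ∂P = ker E f (basisVec i) (basisVec i) 0 := by
    intro x hx i
    have h1 := isGaussianVar_value K hρ hv hW hx (basisVec i)
    have h2 := integral_value_mul_value K hρ hv hW hx hx (basisVec i) (basisVec i)
    simp only [inner_basisVec, sub_self] at h1 h2
    exact ⟨h1.integrable_mul h1, h2⟩
  have hn : ∀ y : R3, ‖y‖ ^ 2 = ∑ i, y i * y i := fun y => by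
    rw [EuclideanSpace.norm_sq_eq]
    simp [pow_two]
  have hWi : Integrable (fun p : Ω × R3 => ‖W p.2 p.1‖ ^ 2) (P.prod (volume.restrict Λ)) := by
    refine (integrable_prod_iff' (hWm.norm.pow_const 2).aestronglyMeasurable).2 ⟨?_, ?_⟩
    · filter_upwards [ae_restrict_mem K.measurableSet] with x hx
      simp only [hn]
      exact integrable_finsetSum _ fun i _ => (hsq x hx i).1
    · refine (integrable_const (∑ i, ker E f (basisVec i) (basisVec i) 0)).congr ?_
      filter_upwards [ae_restrict_mem K.measurableSet] with x hx
      have e : ∀ ω, ‖‖W x ω‖ ^ 2‖ = ∑ i, W x ω i * W x ω i := fun ω => by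
        rw [norm_pow, norm_norm, hn]
      simp only [e]
      rw [integral_finsetSum _ fun i _ => (hsq x hx i).1]
      exact Finset.sum_congr rfl fun i _ => (hsq x hx i).2.symm
  -- Joint integrability for Fubini: the integrand is bounded by `Y² ‖φ‖² + ‖W‖²`, a product of
  -- integrable functions plus a term whose expectation does not depend on the point.
  have hi : Integrable (fun p : Ω × R3 => inner ℝ (φ p.2) (W p.2 p.1) * Y p.1)
      (P.prod (volume.restrict Λ)) := by
    have h1 : Integrable (fun p : Ω × R3 => Y p.1 ^ 2 * ‖φ p.2‖ ^ 2)
        (P.prod (volume.restrict Λ)) :=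
      Integrable.mul_prod (f := fun ω => Y ω ^ 2) (g := fun z => ‖φ z‖ ^ 2) hY.memLp.integrable_sq
        (Lp.memLp φ).norm.integrable_sq
    refine (h1.add hWi).mono ?_ (Eventually.of_forall fun p => ?_)
    · exact ((hφm.comp_snd).inner hWm.aestronglyMeasurable).mul hYm.comp_fst
    · simp only [norm_mul, Real.norm_eq_abs, Pi.add_apply]
      have h2 := abs_real_inner_le_norm (φ p.2) (W p.2 p.1)
      rw [abs_of_nonneg (by positivity : 0 ≤ Y p.1 ^ 2 * ‖φ p.2‖ ^ 2 + ‖W p.2 p.1‖ ^ 2)]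
      calc _ ≤ ‖φ p.2‖ * ‖W p.2 p.1‖ * |Y p.1| := by gcongr
        _ ≤ _ := by
          rw [← sq_abs (Y p.1)]
          nlinarith [sq_nonneg (|Y p.1| * ‖φ p.2‖ - ‖W p.2 p.1‖), sq_nonneg (‖W p.2 p.1‖),
            sq_nonneg (|Y p.1| * ‖φ p.2‖)]
  rw [← integral_integral_swap (f := fun ω z => inner ℝ (φ z) (W z ω) * Y ω) hi]
  refine integral_congr_ae ?_
  filter_upwards [hW.ae_eq] with ω hω
  rw [integral_mul_const, L2.inner_def]
  congr 1
  exact integral_congr_ae (hω.mono fun z hz => by simp only [hz])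

end Flow

/-! ### Differentiability on convex sets, tested on a countable dense subset -/

/-- If `Λ` contains a ball around `p`, then by convexity it contains small multiples of that ball
arbitrarily near 0. Homogeneity moves the bound to the ball itself, and differences `(p + y) - p`
reach all directions. A linear map is thus controlled by its values on `Λ` near 0, also when 0 is a
boundary point. -/
theorem exists_opNorm_le_of_convex {Λ : Set R3} (hconv : Convex ℝ Λ) (h0 : (0 : R3) ∈ Λ)
    (hint : (interior Λ).Nonempty) : ∃ C > 0, ∀ (M : R3 →L[ℝ] R3) (ε δ : ℝ), 0 ≤ ε → 0 < δ →
    (∀ x ∈ Λ, ‖x‖ < δ → ‖M x‖ ≤ ε * ‖x‖) → ‖M‖ ≤ C * ε := by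
  obtain ⟨p, hp⟩ := hint
  obtain ⟨r, hr, hsub⟩ := Metric.isOpen_iff.1 isOpen_interior p hp
  refine ⟨4 * (‖p‖ + r) / r, by positivity, ?_⟩
  intro M ε δ hε hδ H
  have h1 : ∀ y : R3, ‖y‖ < r → ‖M (p + y)‖ ≤ ε * (‖p‖ + r) := by
    intro y hy
    have hpy : p + y ∈ Λ := interior_subset (hsub (by simpa [dist_eq_norm] using hy))
    have hle : ‖p + y‖ ≤ ‖p‖ + r := (norm_add_le _ _).trans (by linarith)
    have hpos : 0 < ‖p‖ + r := by positivity
    obtain ⟨t, ht0, ht1, htδ⟩ : ∃ t : ℝ, 0 < t ∧ t ≤ 1 ∧ t * (‖p‖ + r) < δ := by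
      refine ⟨min 1 (δ / (2 * (‖p‖ + r))), by positivity, min_le_left _ _, ?_⟩
      calc _ ≤ δ / (2 * (‖p‖ + r)) * (‖p‖ + r) := by gcongr; exact min_le_right _ _
        _ = δ / 2 := by field_simp
        _ < δ := by linarith
    have hn : ‖t • (p + y)‖ = t * ‖p + y‖ := by rw [norm_smul, Real.norm_of_nonneg ht0.le]
    have h2 := H (t • (p + y)) (hconv.smul_mem_of_zero_mem h0 hpy ⟨ht0.le, ht1⟩) (by
      rw [hn]
      exact (by gcongr : t * ‖p + y‖ ≤ t * (‖p‖ + r)).trans_lt htδ)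
    rw [map_smul, norm_smul, hn, Real.norm_of_nonneg ht0.le, mul_left_comm] at h2
    exact (le_of_mul_le_mul_left h2 ht0).trans (by gcongr)
  refine M.opNorm_le_bound (by positivity) fun x => ?_
  rcases eq_or_ne x 0 with rfl | hx
  · simp
  have hx' : 0 < ‖x‖ := norm_pos_iff.2 hx
  set y : R3 := (r / (2 * ‖x‖)) • x with hy
  have hyr : ‖y‖ < r := by
    rw [hy, norm_smul, Real.norm_of_nonneg (by positivity)]
    have : r / (2 * ‖x‖) * ‖x‖ = r / 2 := by field_simp
    linarith
  have h3 : ‖M y‖ ≤ 2 * (ε * (‖p‖ + r)) := by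
    have e : M y = M (p + y) - M (p + 0) := by simp
    rw [e]
    refine (norm_sub_le _ _).trans ?_
    have := h1 y hyr
    have := h1 0 (by simpa using hr)
    linarith
  rw [hy, map_smul, norm_smul, Real.norm_of_nonneg (by positivity), div_mul_eq_mul_div,
    div_le_iff₀ (by positivity)] at h3
  have h4 : ‖M x‖ = r * ‖M x‖ / r := by field_simp
  rw [h4]
  calc r * ‖M x‖ / r ≤ 2 * (ε * (‖p‖ + r)) * (2 * ‖x‖) / r := by gcongr
    _ = _ := by ring

/-- `g` is differentiable at `0` along `D`, with derivatives approximated in a countable family. -/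
def AlmostLinearAtZero (D : Set R3) (g : R3 → R3) : Prop :=
  ∀ m : ℕ, ∃ k n : ℕ, ∀ q ∈ D, ‖q‖ < 1 / ((n : ℝ) + 1) →
    ‖g q - g 0 - TopologicalSpace.denseSeq (R3 →L[ℝ] R3) k q‖ ≤ ‖q‖ / ((m : ℝ) + 1)

theorem almostLinearAtZero_of_differentiableAt (D : Set R3) {g : R3 → R3}
    (hg : DifferentiableAt ℝ g 0) : AlmostLinearAtZero D g := by
  intro m
  obtain ⟨k, hk⟩ := (TopologicalSpace.denseRange_denseSeq (R3 →L[ℝ] R3)).exists_dist_lt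
    (fderiv ℝ g 0) (ε := 1 / (2 * ((m : ℝ) + 1))) (by positivity)
  have h1 := (hasFDerivAt_iff_isLittleO_nhds_zero.1 hg.hasFDerivAt).def
    (c := 1 / (2 * ((m : ℝ) + 1))) (by positivity)
  obtain ⟨δ, hδ, H⟩ := Metric.eventually_nhds_iff.1 h1
  obtain ⟨n, hn⟩ := exists_nat_one_div_lt hδ
  refine ⟨k, n, fun q _ hq => ?_⟩
  have h2 := H (y := q) (by simpa using hq.trans hn)
  have h3 : ‖(fderiv ℝ g 0 - TopologicalSpace.denseSeq (R3 →L[ℝ] R3) k) q‖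
      ≤ 1 / (2 * ((m : ℝ) + 1)) * ‖q‖ :=
    (ContinuousLinearMap.le_opNorm _ _).trans (by gcongr; rw [← dist_eq_norm]; exact hk.le)
  have e : g q - g 0 - TopologicalSpace.denseSeq (R3 →L[ℝ] R3) k q
      = (g (0 + q) - g 0 - fderiv ℝ g 0 q)
        + (fderiv ℝ g 0 - TopologicalSpace.denseSeq (R3 →L[ℝ] R3) k) q := by
    simp
  rw [e]
  calc _ ≤ _ := norm_add_le _ _
    _ ≤ 1 / (2 * ((m : ℝ) + 1)) * ‖q‖ + 1 / (2 * ((m : ℝ) + 1)) * ‖q‖ := add_le_add h2 h3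
    _ = _ := by field_simp; ring

/-- Continuity extends the estimates from the dense set to `Λ`. Any two approximating linear maps
are then close on `Λ` near 0, hence in norm, and their limit is the derivative. -/
theorem AlmostLinearAtZero.differentiableWithinAt {Λ D : Set R3} (hconv : Convex ℝ Λ)
    (h0 : (0 : R3) ∈ Λ) (hint : (interior Λ).Nonempty) (hDΛ : D ⊆ Λ) (hD : Λ ⊆ closure D)
    {r : ℝ} (hr : 0 < r) {w : R3 → R3} (hw : ContinuousOn w Λ)
    (H : AlmostLinearAtZero (D ∩ Metric.ball 0 r) w) : DifferentiableWithinAt ℝ w Λ 0 := by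
  choose k n hkn using H
  set L : ℕ → R3 →L[ℝ] R3 := fun m => TopologicalSpace.denseSeq (R3 →L[ℝ] R3) (k m) with hL
  set δ : ℕ → ℝ := fun m => min r (1 / ((n m : ℝ) + 1)) with hδ
  have hδ0 : ∀ m, 0 < δ m := fun m => lt_min hr (by positivity)
  have hbd : ∀ m, ∀ x ∈ Λ, ‖x‖ < δ m → ‖w x - w 0 - L m x‖ ≤ ‖x‖ / ((m : ℝ) + 1) := by
    intro m x hx hxδ
    have hsub : Metric.ball (0 : R3) (δ m) ∩ D ⊆ Λ := fun y hy => hDΛ hy.2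
    have hcl : x ∈ closure (Metric.ball (0 : R3) (δ m) ∩ D) :=
      Metric.isOpen_ball.inter_closure ⟨by simpa using hxδ, hD hx⟩
    have hwc := (hw x hx).mono hsub
    refine ContinuousWithinAt.closure_le (f := fun x => ‖w x - w 0 - L m x‖)
      (g := fun x => ‖x‖ / ((m : ℝ) + 1)) hcl ?_ ?_ ?_
    · exact ((hwc.sub continuousWithinAt_const).sub
        (L m).continuous.continuousWithinAt).norm
    · exact (Continuous.continuousWithinAt (by fun_prop))
    · rintro y ⟨hy1, hy2⟩
      have hy : ‖y‖ < δ m := by simpa using hy1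
      exact hkn m y ⟨hy2, by simpa using hy.trans_le (min_le_left _ _)⟩
        (hy.trans_le (min_le_right _ _))
  obtain ⟨C, hC0, hC⟩ := exists_opNorm_le_of_convex hconv h0 hint
  have hdist : ∀ m l, ‖L m - L l‖ ≤ C * (1 / ((m : ℝ) + 1) + 1 / ((l : ℝ) + 1)) := by
    intro m l
    refine hC _ _ (min (δ m) (δ l)) (by positivity) (lt_min (hδ0 m) (hδ0 l)) fun x hx hxδ => ?_
    have h1 := hbd m x hx (hxδ.trans_le (min_le_left _ _))
    have h2 := hbd l x hx (hxδ.trans_le (min_le_right _ _))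
    have e : (L m - L l) x = (w x - w 0 - L l x) - (w x - w 0 - L m x) := by simp
    rw [e]
    refine (norm_sub_le _ _).trans ((add_le_add h2 h1).trans_eq ?_)
    ring
  have hcau : CauchySeq L := by
    refine cauchySeq_of_le_tendsto_0 (fun N : ℕ => C * (1 / ((N : ℝ) + 1) + 1 / ((N : ℝ) + 1)))
      (fun m l N hm hl => ?_) ?_
    · rw [dist_eq_norm]
      refine (hdist m l).trans ?_
      gcongr
    · have h1 := tendsto_one_div_add_atTop_nhds_zero_nat (𝕜 := ℝ)
      simpa using (h1.add h1).const_mul C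
  obtain ⟨A, hA⟩ := cauchySeq_tendsto_of_complete hcau
  refine HasFDerivWithinAt.differentiableWithinAt (f' := A) ?_
  refine HasFDerivWithinAt.of_isLittleO (isLittleO_iff.2 fun ε hε => ?_)
  have h1 : Tendsto (fun m : ℕ => 1 / ((m : ℝ) + 1) + ‖L m - A‖) atTop (𝓝 0) := by
    have := (tendsto_one_div_add_atTop_nhds_zero_nat (𝕜 := ℝ)).add
      (tendsto_iff_norm_sub_tendsto_zero.1 hA)
    simpa using this
  obtain ⟨m, hm⟩ := (h1.eventually (Iio_mem_nhds hε)).exists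
  filter_upwards [self_mem_nhdsWithin,
    mem_nhdsWithin_of_mem_nhds (Metric.ball_mem_nhds (0 : R3) (hδ0 m))] with x hx hxδ
  have h2 := hbd m x hx (by simpa using hxδ)
  have h3 := (L m - A).le_opNorm x
  have e : w x - w 0 - A (x - 0) = (w x - w 0 - L m x) + (L m - A) x := by simp
  rw [e, sub_zero]
  calc _ ≤ _ := norm_add_le _ _
    _ ≤ ‖x‖ / ((m : ℝ) + 1) + ‖L m - A‖ * ‖x‖ := add_le_add h2 h3
    _ = (1 / ((m : ℝ) + 1) + ‖L m - A‖) * ‖x‖ := by ring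
    _ ≤ ε * ‖x‖ := mul_le_mul_of_nonneg_right (le_of_lt hm) (norm_nonneg x)

/-! ### Equality of laws -/

section Law
variable {Ω : Type*} [MeasurableSpace Ω] {P : Measure Ω} [IsProbabilityMeasure P]
  {Λ : Set R3} {E : ℝ} {f : ℝ → ℝ} {v : Ω → L2Field Λ} {hv : IsGaussianFlow P Λ E f v}

theorem map_eq_of_integral_mul_eq {X Y : Ω → ℝ} (hX : IsGaussianVar hv X)
    (hY : IsGaussianVar hv Y) (h : ∫ ω, X ω * X ω ∂P = ∫ ω, Y ω * Y ω ∂P) :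
    P.map X = P.map Y := by
  rw [hX.hasGaussianLaw.map_eq_gaussianReal, hY.hasGaussianLaw.map_eq_gaussianReal,
    variance_of_integral_eq_zero hX.hasGaussianLaw.aemeasurable hX.integral_eq_zero,
    variance_of_integral_eq_zero hY.hasGaussianLaw.aemeasurable hY.integral_eq_zero,
    hX.integral_eq_zero, hY.integral_eq_zero]
  simp only [pow_two, h]

theorem dual_pi_apply {ι : Type*} [Fintype ι] [DecidableEq ι] (L : StrongDual ℝ (ι → R3)) :
    ∃ a : ι → R3, ∀ g, L g = ∑ i, inner ℝ (a i) (g i) := by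
  refine ⟨fun i => (InnerProductSpace.toDual ℝ R3).symm
    (L.comp (ContinuousLinearMap.single ℝ (fun _ : ι => R3) i)), fun g => ?_⟩
  simp only [InnerProductSpace.toDual_symm_apply, ContinuousLinearMap.comp_apply,
    ContinuousLinearMap.single_apply]
  rw [← map_sum, Finset.univ_sum_single]

/-- Two countable families in the Gaussian space with the same covariances have the same law. -/
theorem map_pi_eq {ι : Type*} [Countable ι] {X Y : ι → Ω → R3}
    (hXm : ∀ i, Measurable (X i)) (hYm : ∀ i, Measurable (Y i))
    (hX : ∀ i a, IsGaussianVar hv fun ω => inner ℝ a (X i ω))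
    (hY : ∀ i a, IsGaussianVar hv fun ω => inner ℝ a (Y i ω))
    (h : ∀ i j a b, ∫ ω, inner ℝ a (X i ω) * inner ℝ b (X j ω) ∂P
      = ∫ ω, inner ℝ a (Y i ω) * inner ℝ b (Y j ω) ∂P) :
    P.map (fun ω i => X i ω) = P.map (fun ω i => Y i ω) := by
  classical
  rw [map_eq_iff_forall_finset_map_restrict_eq (measurable_pi_lambda _ hXm).aemeasurable
    (measurable_pi_lambda _ hYm).aemeasurable]
  intro I
  have hm : ∀ {Z : ι → Ω → R3}, (∀ i, Measurable (Z i)) →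
      Measurable fun ω => I.restrict (fun i => Z i ω) := fun hZ =>
    measurable_pi_lambda _ fun i => hZ i
  have := Measure.isProbabilityMeasure_map (μ := P) (hm hXm).aemeasurable
  have := Measure.isProbabilityMeasure_map (μ := P) (hm hYm).aemeasurable
  refine Measure.ext_of_charFunDual (funext fun L => ?_)
  obtain ⟨a, ha⟩ := dual_pi_apply L
  rw [charFunDual_eq_charFun_map_one, charFunDual_eq_charFun_map_one,
    Measure.map_map L.continuous.measurable (hm hXm),
    Measure.map_map L.continuous.measurable (hm hYm)]
  congr 1
  have key : ∀ {Z : ι → Ω → R3}, (∀ i a, IsGaussianVar hv fun ω => inner ℝ a (Z i ω)) →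
      IsGaussianVar hv (L ∘ fun ω => I.restrict (fun i => Z i ω)) ∧
      ∫ ω, (L ∘ fun ω => I.restrict (fun i => Z i ω)) ω
        * (L ∘ fun ω => I.restrict (fun i => Z i ω)) ω ∂P
        = ∑ i : I, ∑ j : I, ∫ ω, inner ℝ (a i) (Z i ω) * inner ℝ (a j) (Z j ω) ∂P := by
    intro Z hZ
    have e : (L ∘ fun ω => I.restrict (fun i => Z i ω))
        = fun ω => ∑ i : I, inner ℝ (a i) (Z i ω) := by
      funext ω; simp [ha, Finset.restrict]
    rw [e]
    refine ⟨IsGaussianVar.sum _ fun i _ => hZ i (a i), ?_⟩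
    simp only [Finset.sum_mul_sum]
    rw [integral_finsetSum _ fun (i : I) _ => integrable_finsetSum _ fun (j : I) _ =>
      (hZ i (a i)).integrable_mul (hZ j (a j))]
    refine Finset.sum_congr rfl fun i _ => ?_
    rw [integral_finsetSum _ fun (j : I) _ => (hZ i (a i)).integrable_mul (hZ j (a j))]
  obtain ⟨h1, h2⟩ := key hX
  obtain ⟨h3, h4⟩ := key hY
  refine map_eq_of_integral_mul_eq h1 h3 ?_
  rw [h2, h4]
  simp only [h]

end Law

/-! ### Differentiability at the origin -/

section Flow
variable {Ω : Type*} [MeasurableSpace Ω] {P : Measure Ω} [IsProbabilityMeasure P]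
  {Λ : Set R3} {E c : ℝ} {f : ℝ → ℝ} {v : Ω → L2Field Λ} {ρ : R3 → ℝ} {s : ℕ → ℝ}
  {W : R3 → Ω → R3}
  (K : KernelDomain Λ E c f) (hρ : IsMollifier Λ ρ) (hv : IsGaussianFlow P Λ E f v)
  (hW : IsVersion P Λ v ρ s W)
include K hρ hW hv

/-- The event of differentiability at a point is expressed through countably many values of the
path, so that its probability depends only on their joint law; by stationarity this law is the same
at 0 as at an interior point. -/
theorem ae_differentiableWithinAt :
    ∀ᵐ ω ∂P, DifferentiableWithinAt ℝ (fun x => W x ω) Λ 0 := by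
  obtain ⟨D, hDΛ, hDc, hD⟩ :=
    (TopologicalSpace.IsSeparable.of_separableSpace Λ).exists_countable_dense_subset
  replace hD : Λ ⊆ closure (insert 0 D) := hD.trans (closure_mono (Set.subset_insert _ _))
  set D' := insert 0 D with hD'
  have hD'Λ : D' ⊆ Λ := Set.insert_subset K.zero_mem hDΛ
  have hD'c : D'.Countable := hDc.insert 0
  have hmeas : MeasurableSet {p : Ω × R3 | AlmostLinearAtZero D' fun q => W (p.2 + q) p.1} := by
    simp only [AlmostLinearAtZero, Set.ofPred_forall, Set.ofPred_exists]
    refine MeasurableSet.iInter fun m => MeasurableSet.iUnion fun k => MeasurableSet.iUnion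
      fun n => MeasurableSet.biInter hD'c fun q _ => MeasurableSet.iInter fun _ => ?_
    have h1 : ∀ q : R3, Measurable fun p : Ω × R3 => W (p.2 + q) p.1 := fun q =>
      hW.measurable.comp ((measurable_snd.add_const q).prodMk measurable_fst)
    exact measurableSet_le (((h1 q).sub (h1 0)).sub_const _).norm measurable_const
  have h1 : ∀ᵐ ω ∂P, ∀ᵐ z ∂(volume.restrict (interior Λ)),
      AlmostLinearAtZero D' fun q => W (z + q) ω := by
    filter_upwards [hW.ae_differentiableAt] with ω hω
    refine (ae_restrict_iff' isOpen_interior.measurableSet).2 ?_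
    filter_upwards [hω] with z hz hzΛ
    refine almostLinearAtZero_of_differentiableAt D' ?_
    have h2 : DifferentiableAt ℝ (fun x => W x ω) (z + 0) := by simpa using hz hzΛ
    exact h2.comp (0 : R3) (f := fun q => z + q) (by fun_prop)
  -- Fubini turns "almost surely, at almost every point" into "at almost every point, almost
  -- surely", and one such interior point `z` is fixed.
  have h2 := (Measure.ae_ae_comm hmeas).1 h1
  have hne : (ae (volume.restrict (interior Λ))).NeBot := by
    rw [ae_neBot, ne_eq, Measure.restrict_eq_zero]
    exact (isOpen_interior.measure_pos volume K.interior_nonempty).ne'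
  obtain ⟨z, hz, hzΛ⟩ := (h2.and (ae_restrict_mem isOpen_interior.measurableSet)).exists
  obtain ⟨r, hr, hrΛ⟩ := Metric.isOpen_iff.1 isOpen_interior z hzΛ
  set ι := ↥(D' ∩ Metric.ball (0 : R3) r) with hι
  have : Countable ι := (hD'c.mono Set.inter_subset_left).to_subtype
  let o : ι := ⟨0, Set.mem_insert _ _, by simpa using hr⟩
  have hzq : ∀ q : ι, z + q ∈ Λ := fun q => interior_subset (hrΛ (by
    have := q.2.2
    simpa [dist_eq_norm] using this))
  have hqΛ : ∀ q : ι, (q : R3) ∈ Λ := fun q => hD'Λ q.2.1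
  have hm : ∀ x, Measurable (W x) := fun x => hW.measurable.comp measurable_prodMk_left
  have hlaw := map_pi_eq (hv := hv) (X := fun q : ι => W (z + q)) (Y := fun q : ι => W q)
    (fun q => hm _) (fun q => hm _)
    (fun q a => isGaussianVar_value K hρ hv hW (hzq q) a)
    (fun q a => isGaussianVar_value K hρ hv hW (hqΛ q) a)
    (fun q q' a b => by
      rw [integral_value_mul_value K hρ hv hW (hzq q) (hzq q'),
        integral_value_mul_value K hρ hv hW (hqΛ q) (hqΛ q'), add_sub_add_left_eq_sub])
  set S : Set (ι → R3) := {γ | ∀ m : ℕ, ∃ k n : ℕ, ∀ q : ι, ‖(q : R3)‖ < 1 / ((n : ℝ) + 1) →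
    ‖γ q - γ o - TopologicalSpace.denseSeq (R3 →L[ℝ] R3) k q‖ ≤ ‖(q : R3)‖ / ((m : ℝ) + 1)} with hS
  have hSm : MeasurableSet S := by
    simp only [hS, Set.ofPred_forall, Set.ofPred_exists]
    refine MeasurableSet.iInter fun m => MeasurableSet.iUnion fun k => MeasurableSet.iUnion
      fun n => MeasurableSet.iInter fun q => MeasurableSet.iInter fun _ => ?_
    exact measurableSet_le (((measurable_pi_apply q).sub (measurable_pi_apply o)).sub_const _).norm
      measurable_const
  have hXS : ∀ᵐ ω ∂P, (fun q : ι => W (z + q) ω) ∈ S := by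
    filter_upwards [hz] with ω hω m
    obtain ⟨k, n, H⟩ := hω m
    exact ⟨k, n, fun q hq => H q q.2.1 hq⟩
  have hYS : ∀ᵐ ω ∂P, (fun q : ι => W q ω) ∈ S := by
    have hmX : Measurable fun ω (q : ι) => W (z + q) ω := measurable_pi_lambda _ fun q => hm _
    have hmY : Measurable fun ω (q : ι) => W q ω := measurable_pi_lambda _ fun q => hm _
    have hX := (ae_map_iff (p := fun γ => γ ∈ S) hmX.aemeasurable hSm).2 hXS
    rw [hlaw] at hX
    exact (ae_map_iff (p := fun γ => γ ∈ S) hmY.aemeasurable hSm).1 hX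
  filter_upwards [hYS] with ω hω
  refine AlmostLinearAtZero.differentiableWithinAt K.convex K.zero_mem K.interior_nonempty hD'Λ hD
    hr (hW.continuousOn ω) fun m => ?_
  obtain ⟨k, n, H⟩ := hω m
  exact ⟨k, n, fun q hq hqn => H ⟨q, hq⟩ hqn⟩

end Flow

/-! ### The derivative of the flow at the origin -/

theorem kerD_add_right (E : ℝ) (f : ℝ → ℝ) (a b z h k : R3) :
    kerD E f a b z (h + k) = kerD E f a b z h + kerD E f a b z k := by
  simp only [kerD, inner_add_left, inner_add_right]; ring

theorem kerD_smul_right (E : ℝ) (f : ℝ → ℝ) (t : ℝ) (a b z h : R3) :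
    kerD E f a b z (t • h) = t * kerD E f a b z h := by
  simp only [kerD, inner_smul_left, inner_smul_right, conj_trivial]; ring

theorem kerQ_add_left (E c : ℝ) (a b h h' k : R3) :
    kerQ E c a b (h + h') k = kerQ E c a b h k + kerQ E c a b h' k := by
  simp only [kerQ, inner_add_left]; ring

theorem kerQ_add_right (E c : ℝ) (a b h k k' : R3) :
    kerQ E c a b h (k + k') = kerQ E c a b h k + kerQ E c a b h k' := by
  rw [kerQ_comm, kerQ_add_left, kerQ_comm, kerQ_comm (h := k')]

theorem span_eq_top_of_interior {Λ : Set R3} (hint : (interior Λ).Nonempty) :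
    Submodule.span ℝ Λ = ⊤ :=
  Submodule.eq_top_of_nonempty_interior' _ (hint.mono (interior_mono Submodule.subset_span))

section Flow
variable {Ω : Type*} [MeasurableSpace Ω] {P : Measure Ω} [IsProbabilityMeasure P]
  {Λ : Set R3} {E c : ℝ} {f : ℝ → ℝ} {v : Ω → L2Field Λ} {ρ : R3 → ℝ} {s : ℕ → ℝ}
  {W : R3 → Ω → R3}
  (K : KernelDomain Λ E c f) (hρ : IsMollifier Λ ρ) (hv : IsGaussianFlow P Λ E f v)
  (hW : IsVersion P Λ v ρ s W)

/-- The difference quotient at the origin. -/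
noncomputable def diffQuot (W : R3 → Ω → R3) (a h : R3) (n : ℕ) (ω : Ω) : ℝ :=
  ((n : ℝ) + 1) * (inner ℝ a (W (((n : ℝ) + 1)⁻¹ • h) ω) - inner ℝ a (W 0 ω))

include K in
theorem inv_smul_mem {h : R3} (hh : h ∈ Λ) (n : ℕ) : ((n : ℝ) + 1)⁻¹ • h ∈ Λ :=
  K.convex.smul_mem_of_zero_mem K.zero_mem hh ⟨by positivity, inv_le_one_of_one_le₀ (by simp)⟩

include K hρ hW

omit [IsProbabilityMeasure P] in
theorem isGaussianVar_diffQuot {h : R3} (hh : h ∈ Λ) (a : R3) (n : ℕ) :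
    IsGaussianVar hv (diffQuot W a h n) :=
  ((isGaussianVar_value K hρ hv hW (inv_smul_mem K hh n) a).sub
    (isGaussianVar_value K hρ hv hW K.zero_mem a)).const_mul _

include hv in
omit [IsProbabilityMeasure P] in
theorem integral_diffQuot_mul_value {h x : R3} (hh : h ∈ Λ) (hx : x ∈ Λ) (a b : R3) (n : ℕ) :
    ∫ ω, diffQuot W a h n ω * inner ℝ b (W x ω) ∂P
      = ((n : ℝ) + 1) * (ker E f a b (((n : ℝ) + 1)⁻¹ • h - x) - ker E f a b (0 - x)) := by
  have h1 := inv_smul_mem K hh n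
  rw [← integral_value_mul_value K hρ hv hW h1 hx, ← integral_value_mul_value K hρ hv hW
    K.zero_mem hx, ← integral_sub ((isGaussianVar_value K hρ hv hW h1 a).integrable_mul
      (isGaussianVar_value K hρ hv hW hx b))
    ((isGaussianVar_value K hρ hv hW K.zero_mem a).integrable_mul
      (isGaussianVar_value K hρ hv hW hx b)), ← integral_const_mul]
  congr 1
  funext ω
  simp only [diffQuot]
  ring

include hv in
omit [IsProbabilityMeasure P] in
theorem integral_diffQuot_mul_diffQuot {h k : R3} (hh : h ∈ Λ) (hk : k ∈ Λ) (a b : R3)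
    (n m : ℕ) : ∫ ω, diffQuot W a h n ω * diffQuot W b k m ω ∂P
      = ((n : ℝ) + 1) * ((m : ℝ) + 1) *
        (ker E f a b (0 + ((n : ℝ) + 1)⁻¹ • h + -(((m : ℝ) + 1)⁻¹ • k))
          - ker E f a b (0 + ((n : ℝ) + 1)⁻¹ • h)
          - ker E f a b (0 + -(((m : ℝ) + 1)⁻¹ • k)) + ker E f a b 0) := by
  have hq := isGaussianVar_diffQuot K hρ hv hW hh a n
  have e : ∀ ω, diffQuot W a h n ω * diffQuot W b k m ω
      = ((m : ℝ) + 1) * (diffQuot W a h n ω * inner ℝ b (W (((m : ℝ) + 1)⁻¹ • k) ω)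
        - diffQuot W a h n ω * inner ℝ b (W 0 ω)) := fun ω => by
    simp only [diffQuot]; ring
  simp only [e]
  rw [integral_const_mul, integral_sub (hq.integrable_mul
      (isGaussianVar_value K hρ hv hW (inv_smul_mem K hk m) b))
    (hq.integrable_mul (isGaussianVar_value K hρ hv hW K.zero_mem b)),
    integral_diffQuot_mul_value K hρ hv hW hh (inv_smul_mem K hk m),
    integral_diffQuot_mul_value K hρ hv hW hh K.zero_mem]
  simp only [zero_add, sub_zero, ← sub_eq_add_neg, zero_sub]
  ring

include hv in
omit [IsProbabilityMeasure P] in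
-- The covariance of two difference quotients is a second difference of the kernel divided by both
-- steps. Letting the steps vary independently gives the Cauchy property in `L²` as well as the
-- limiting covariance.
theorem abs_integral_diffQuot_add_kerQ_le {η : ℝ} (hη : 0 < η) {h k : R3} (hh : h ∈ Λ)
    (hk : k ∈ Λ) (a b : R3) : ∃ N, ∀ n ≥ N, ∀ m ≥ N,
    |∫ ω, diffQuot W a h n ω * diffQuot W b k m ω ∂P + kerQ E c a b h k| ≤ η := by
  set B := ‖h‖ * ‖k‖ * (‖a‖ * ‖b‖) + 1 with hB
  have hB0 : 0 < B := by positivity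
  obtain ⟨δ, hδ, H⟩ := ker_second_difference K.pos K.regular (η := η / B) (by positivity)
  have hlim : ∀ h : R3, ∀ᶠ n : ℕ in atTop, ‖((n : ℝ) + 1)⁻¹ • h‖ < δ := by
    intro h
    have h1 := (tendsto_one_div_add_atTop_nhds_zero_nat (𝕜 := ℝ)).smul_const h
    rw [zero_smul] at h1
    have h2 := h1.norm.eventually (Iio_mem_nhds (by simpa using hδ))
    filter_upwards [h2] with n hn
    simpa [one_div] using hn
  obtain ⟨N, hN⟩ := eventually_atTop.1 ((hlim h).and (hlim k))
  refine ⟨N, fun n hn m hm => ?_⟩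
  rw [integral_diffQuot_mul_diffQuot K hρ hv hW hh hk]
  set t := ((n : ℝ) + 1)⁻¹ with ht
  set u := ((m : ℝ) + 1)⁻¹ with hu
  have ht0 : 0 < t := by positivity
  have hu0 : 0 < u := by positivity
  have h1 := H a b 0 (t • h) (-(u • k)) (by simpa using hδ) (hN n hn).1
    (by rw [norm_neg]; exact (hN m hm).2)
  have e1 : kerQ E c a b (t • h) (-(u • k)) = -(t * u * kerQ E c a b h k) := by
    rw [← neg_smul, kerQ_smul_left, kerQ_smul_right]; ring
  rw [e1, norm_neg, norm_smul, norm_smul, Real.norm_of_nonneg ht0.le,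
    Real.norm_of_nonneg hu0.le] at h1
  set S := ker E f a b (0 + t • h + -(u • k)) - ker E f a b (0 + t • h)
    - ker E f a b (0 + -(u • k)) + ker E f a b 0 with hS
  have e2 : ((n : ℝ) + 1) = t⁻¹ := by rw [ht, inv_inv]
  have e3 : ((m : ℝ) + 1) = u⁻¹ := by rw [hu, inv_inv]
  rw [e2, e3]
  have e4 : t⁻¹ * u⁻¹ * S + kerQ E c a b h k
      = t⁻¹ * u⁻¹ * (S - -(t * u * kerQ E c a b h k)) := by field_simp; ring
  rw [e4, abs_mul, abs_of_pos (by positivity)]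
  calc t⁻¹ * u⁻¹ * |S - -(t * u * kerQ E c a b h k)|
      ≤ t⁻¹ * u⁻¹ * (η / B * (t * ‖h‖ * (u * ‖k‖) * (‖a‖ * ‖b‖))) := by gcongr
    _ = η / B * (‖h‖ * ‖k‖ * (‖a‖ * ‖b‖)) := by field_simp
    _ ≤ η / B * B := by gcongr; rw [hB]; linarith
    _ = η := by field_simp

/-- The derivative of the flow at the origin. -/
noncomputable def derivAtZero (Λ : Set R3) (W : R3 → Ω → R3) (ω : Ω) : R3 →L[ℝ] R3 :=
  fderivWithin ℝ (fun x => W x ω) Λ 0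

theorem gaussianTendsto_diffQuot {h : R3} (hh : h ∈ Λ) (a : R3) :
    GaussianTendsto hv (diffQuot W a h) fun ω => inner ℝ a (derivAtZero Λ W ω h) := by
  refine GaussianTendsto.of_ae_tendsto (isGaussianVar_diffQuot K hρ hv hW hh a) ?_ ?_
  · filter_upwards [ae_differentiableWithinAt K hρ hv hW] with ω hω
    have hd := hω.hasFDerivWithinAt
    have h1 : Tendsto (fun n : ℕ => ((n : ℝ) + 1) • (W (0 + ((n : ℝ) + 1)⁻¹ • h) ω - W 0 ω)) atTop
        (𝓝 (derivAtZero Λ W ω h)) := by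
      refine hd.lim (c := fun n : ℕ => (n : ℝ) + 1) (d := fun n : ℕ => ((n : ℝ) + 1)⁻¹ • h)
        (l := atTop) ?_ ?_ ?_
      · simpa [one_div] using
          (tendsto_one_div_add_atTop_nhds_zero_nat (𝕜 := ℝ)).smul_const h
      · exact Eventually.of_forall fun n => by simpa using inv_smul_mem K hh n
      · refine tendsto_const_nhds.congr fun n => ?_
        rw [smul_inv_smul₀ (by positivity)]
    have h2 := (tendsto_const_nhds (x := a)).inner (𝕜 := ℝ) h1
    refine h2.congr fun n => ?_
    simp only [diffQuot, zero_add, inner_smul_right, inner_sub_right]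
  · intro η hη
    obtain ⟨N, hN⟩ := abs_integral_diffQuot_add_kerQ_le K hρ hv hW (η := η / 4) (by positivity)
      hh hh a a
    refine ⟨N, fun m hm n hn => ?_⟩
    have hq := isGaussianVar_diffQuot K hρ hv hW hh a
    have e : ∀ ω, (diffQuot W a h m ω - diffQuot W a h n ω)
        * (diffQuot W a h m ω - diffQuot W a h n ω)
        = (diffQuot W a h m ω * diffQuot W a h m ω - diffQuot W a h m ω * diffQuot W a h n ω)
          - (diffQuot W a h n ω * diffQuot W a h m ω - diffQuot W a h n ω * diffQuot W a h n ω) :=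
      fun ω => by ring
    simp only [e]
    have i1 := fun m n => (hq m).integrable_mul (hq n)
    have i2 : ∀ k, Integrable (fun ω => diffQuot W a h k ω * diffQuot W a h m ω
        - diffQuot W a h k ω * diffQuot W a h n ω) P := fun k => (i1 k m).sub (i1 k n)
    rw [integral_sub (i2 m) (i2 n), integral_sub (i1 m m) (i1 m n),
      integral_sub (i1 n m) (i1 n n)]
    have b1 := abs_le.1 (hN m hm m hm)
    have b2 := abs_le.1 (hN m hm n hn)
    have b3 := abs_le.1 (hN n hn m hm)
    have b4 := abs_le.1 (hN n hn n hn)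
    linarith [b1.2, b2.1, b3.1, b4.2]

include hv in
theorem integral_deriv_mul_value_of_mem {h x : R3} (hh : h ∈ Λ) (hx : x ∈ Λ) (a b : R3) :
    ∫ ω, inner ℝ a (derivAtZero Λ W ω h) * inner ℝ b (W x ω) ∂P = kerD E f a b (-x) h := by
  have h1 := (gaussianTendsto_diffQuot K hρ hv hW hh a).tendsto_integral_mul
    (GaussianTendsto.const (isGaussianVar_value K hρ hv hW hx b))
  refine tendsto_nhds_unique h1 ?_
  have hc : ContDiffAt ℝ 2 f ‖-x + (0 : ℝ) • h‖ := by
    simpa using K.contDiffAt 0 K.zero_mem x hx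
  have h2 := (hasDerivAt_ker_line K.pos K.regular a b (-x) h 0 hc).tendsto_slope_zero
  have htn : Tendsto (fun n : ℕ => ((n : ℝ) + 1)⁻¹) atTop (𝓝[≠] 0) := by
    refine tendsto_nhdsWithin_iff.2 ⟨?_, Eventually.of_forall fun n => ?_⟩
    · simpa [one_div] using tendsto_one_div_add_atTop_nhds_zero_nat (𝕜 := ℝ)
    · exact inv_ne_zero (by positivity)
  have h3 := h2.comp htn
  simp only [zero_smul, add_zero] at h3
  refine h3.congr fun n => ?_
  rw [integral_diffQuot_mul_value K hρ hv hW hh hx]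
  simp only [Function.comp, inv_inv, zero_add, smul_eq_mul, zero_sub, neg_add_eq_sub]

include hv in
theorem integral_deriv_mul_deriv_of_mem {h k : R3} (hh : h ∈ Λ) (hk : k ∈ Λ) (a b : R3) :
    ∫ ω, inner ℝ a (derivAtZero Λ W ω h) * inner ℝ b (derivAtZero Λ W ω k) ∂P
      = -kerQ E c a b h k := by
  have h1 := (gaussianTendsto_diffQuot K hρ hv hW hh a).tendsto_integral_mul
    (gaussianTendsto_diffQuot K hρ hv hW hk b)
  refine tendsto_nhds_unique h1 (Metric.tendsto_atTop.2 fun η hη => ?_)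
  obtain ⟨N, hN⟩ := abs_integral_diffQuot_add_kerQ_le K hρ hv hW (half_pos hη) hh hk a b
  refine ⟨N, fun n hn => ?_⟩
  rw [Real.dist_eq, sub_neg_eq_add]
  exact (hN n hn n hn).trans_lt (by linarith)

/-- For directions in `Λ` the difference quotients stay inside `Λ`. Since `Λ` spans the space,
linearity covers the other directions. -/
theorem isGaussianVar_deriv (a h : R3) :
    IsGaussianVar hv fun ω => inner ℝ a (derivAtZero Λ W ω h) := by
  have hh : h ∈ Submodule.span ℝ Λ := by
    rw [span_eq_top_of_interior K.interior_nonempty]; trivial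
  induction hh using Submodule.span_induction with
  | mem h hh => exact (gaussianTendsto_diffQuot K hρ hv hW hh a).isGaussianVar
  | zero => simpa using IsGaussianVar.zero (hv := hv)
  | add x y _ _ h1 h2 => simpa only [map_add, inner_add_right] using h1.add h2
  | smul t x _ h1 => simpa only [map_smul, inner_smul_right] using h1.const_mul t

include hv in
theorem integral_deriv_mul_value (h : R3) {x : R3} (hx : x ∈ Λ) (a b : R3) :
    ∫ ω, inner ℝ a (derivAtZero Λ W ω h) * inner ℝ b (W x ω) ∂P = kerD E f a b (-x) h := by
  have hh : h ∈ Submodule.span ℝ Λ := by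
    rw [span_eq_top_of_interior K.interior_nonempty]; trivial
  have i := fun h => (isGaussianVar_deriv K hρ hv hW a h).integrable_mul
    (isGaussianVar_value K hρ hv hW hx b)
  induction hh using Submodule.span_induction with
  | mem h hh => exact integral_deriv_mul_value_of_mem K hρ hv hW hh hx a b
  | zero => simp [kerD]
  | add x y _ _ h1 h2 =>
    simp only [map_add, inner_add_right, add_mul]
    rw [integral_add (i _) (i _), h1, h2, kerD_add_right]
  | smul t x _ h1 =>
    simp only [map_smul, inner_smul_right, mul_assoc]
    rw [integral_const_mul, h1, kerD_smul_right]

include hv in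
theorem integral_deriv_mul_deriv (h k a b : R3) :
    ∫ ω, inner ℝ a (derivAtZero Λ W ω h) * inner ℝ b (derivAtZero Λ W ω k) ∂P
      = -kerQ E c a b h k := by
  have i := fun h k => (isGaussianVar_deriv K hρ hv hW a h).integrable_mul
    (isGaussianVar_deriv K hρ hv hW b k)
  have hmem : ∀ h : R3, h ∈ Submodule.span ℝ Λ := fun h => by
    rw [span_eq_top_of_interior K.interior_nonempty]; trivial
  have step : ∀ k ∈ Λ, ∫ ω, inner ℝ a (derivAtZero Λ W ω h) * inner ℝ b (derivAtZero Λ W ω k) ∂P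
      = -kerQ E c a b h k := by
    intro k hk
    have hh := hmem h
    induction hh using Submodule.span_induction with
    | mem h hh => exact integral_deriv_mul_deriv_of_mem K hρ hv hW hh hk a b
    | zero => simp [kerQ]
    | add x y _ _ h1 h2 =>
      simp only [map_add, inner_add_right, add_mul]
      rw [integral_add (i _ _) (i _ _), h1, h2, kerQ_add_left]
      ring
    | smul t x _ h1 =>
      simp only [map_smul, inner_smul_right, mul_assoc]
      rw [integral_const_mul, h1, kerQ_smul_left]
      ring
  have hk := hmem k
  induction hk using Submodule.span_induction with
  | mem k hk => exact step k hk
  | zero => simp [kerQ]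
  | add x y _ _ h1 h2 =>
    simp only [map_add, inner_add_right, mul_add]
    rw [integral_add (i _ _) (i _ _), h1, h2, kerQ_add_right]
    ring
  | smul t x _ h1 =>
    simp only [map_smul, inner_smul_right, mul_left_comm _ t]
    rw [integral_const_mul, h1, kerQ_smul_right]
    ring

end Flow

/-! ### The conditional mean field -/

/-- The field `f(|x|) α + (|x|/2) f'(|x|) [α - (eₓ·α) eₓ]
  + (ℓ/√5) [2 f'(|x|) + (|x|/2) f''(|x|)] (eₓ × β)`. -/
noncomputable def meanField (f : ℝ → ℝ) (ℓ : ℝ) (α β x : R3) : R3 :=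
  f ‖x‖ • α + (‖x‖ / 2 * deriv f ‖x‖) • (α - inner ℝ (‖x‖⁻¹ • x) α • (‖x‖⁻¹ • x))
    + (ℓ / √5 * (2 * deriv f ‖x‖ + ‖x‖ / 2 * deriv (deriv f) ‖x‖)) • cross (‖x‖⁻¹ • x) β

theorem cross_add (x y z : R3) : cross x (y + z) = cross x y + cross x z := by
  simp [cross]

theorem cross_smul (t : ℝ) (x y : R3) : cross x (t • y) = t • cross x y := by
  simp [cross]

theorem smul_cross (t : ℝ) (x y : R3) : cross (t • x) y = t • cross x y := by
  simp [cross]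

theorem cross_zero (x : R3) : cross x 0 = 0 := by
  simp [cross]

theorem inner_cross (z a b : R3) : inner ℝ a (cross z b) = -inner ℝ b (cross z a) := by
  simp [cross, crossProduct, PiLp.inner_apply, Fin.sum_univ_three]
  ring

/-- Indices in `Fin 3` add modulo 3, so all components are covered by one cyclic formula, as in
`curlWithin_apply`. -/
theorem cross_basisVec (z : R3) (i : Fin 3) (b : R3) :
    inner ℝ b (cross z (basisVec i)) = z (i + 2) * b (i + 1) - z (i + 1) * b (i + 2) := by
  fin_cases i <;>
    simp [cross, crossProduct, PiLp.inner_apply, Fin.sum_univ_three, basisVec] <;> ring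

theorem profile_eq_meanField (f : ℝ → ℝ) (ℓ σ : ℝ) (e : R3) :
    profile f ℓ σ e = meanField f ℓ e (σ • e) := by
  funext x
  simp only [profile, meanField, cross_smul, smul_smul]
  congr 2
  ring

theorem meanField_add (f : ℝ → ℝ) (ℓ : ℝ) (α α' β β' x : R3) :
    meanField f ℓ (α + α') (β + β') x = meanField f ℓ α β x + meanField f ℓ α' β' x := by
  simp only [meanField, cross_add, inner_add_right]
  module

theorem meanField_smul (f : ℝ → ℝ) (ℓ t : ℝ) (α β x : R3) :
    meanField f ℓ (t • α) (t • β) x = t • meanField f ℓ α β x := by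
  simp only [meanField, cross_smul, inner_smul_right]
  module

/-- Covariances with the velocity at 0 produce the half of the mean field that depends on its first
vector; the vorticity produces the other half below. -/
theorem ker_eq_inner_meanField (E ℓ : ℝ) (f : ℝ → ℝ) (a b z : R3) :
    ker E f b a z = 2 * E / 3 * inner ℝ b (meanField f ℓ a 0 z) := by
  rcases eq_or_ne z 0 with rfl | hz
  · simp [ker, meanField, cross_zero, inner_smul_right]
    ring
  have hz' : ‖z‖ ≠ 0 := norm_ne_zero_iff.2 hz
  simp only [ker, radial, meanField, cross_zero, inner_add_right, inner_smul_right, inner_sub_right,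
    inner_smul_left, sqrt_norm_sq, smul_zero, inner_zero_right, conj_trivial, real_inner_comm b z]
  field_simp
  ring

theorem kerD_antisymm (E : ℝ) (f : ℝ → ℝ) (a b z h : R3) :
    kerD E f a b z h - kerD E f h b z a
      = E / 3 * (5 * radial f (‖z‖ ^ 2) + 2 * (‖z‖ ^ 2 * radialD f (‖z‖ ^ 2)))
        * (inner ℝ z h * inner ℝ a b - inner ℝ z a * inner ℝ h b) := by
  simp only [kerD, real_inner_comm a h]
  ring

/-- Antisymmetrising leaves the radial factor `5 B + 2 s B' = 4 f'/r + f'' = (2/r)(2 f' + (r/2)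
f'')` times a component of a cross product. The constant on the right compensates the `ℓ / √5` in
`meanField`. -/
theorem kerD_antisymm_eq_inner_meanField (E : ℝ) {ℓ : ℝ} (hℓ : 0 < ℓ) (f : ℝ → ℝ) (i : Fin 3)
    (b z : R3) :
    kerD E f (basisVec (i + 2)) b (-z) (basisVec (i + 1))
      - kerD E f (basisVec (i + 1)) b (-z) (basisVec (i + 2))
      = 2 * √5 * E / (3 * ℓ) * inner ℝ b (meanField f ℓ 0 (basisVec i) z) := by
  rcases eq_or_ne z 0 with rfl | hz
  · simp [kerD_zero, meanField, cross]
  have hz' : ‖z‖ ≠ 0 := norm_ne_zero_iff.2 hz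
  have h5 : √5 ≠ 0 := by positivity
  have e1 : ∀ j, inner ℝ z (basisVec j) = z j := fun j => by
    rw [real_inner_comm, inner_basisVec]
  rw [kerD_neg, kerD_neg, neg_sub_neg, ← neg_sub, kerD_antisymm]
  simp only [meanField, inner_add_right, inner_smul_right, smul_zero, inner_zero_right, sub_zero,
    smul_cross, cross_basisVec, inner_basisVec, e1, radial, radialD, sqrt_norm_sq, zero_smul]
  field_simp
  ring


theorem continuous_cross_left (β : R3) : Continuous fun x : R3 => cross x β := by
  have h := ((crossProduct (R := ℝ)).flip β.ofLp).continuous_of_finiteDimensional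
  exact (PiLp.continuous_toLp 2 _).comp (h.comp (PiLp.continuous_ofLp 2 _))

section MeanField
variable {Λ : Set R3} {E c : ℝ} {f : ℝ → ℝ} (K : KernelDomain Λ E c f)
include K

theorem memLp_meanField (ℓ : ℝ) (α β : R3) :
    MemLp (meanField f ℓ α β) 2 (volume.restrict Λ) := by
  have := K.isFiniteMeasure
  have hC : ∀ x ∈ Λ, ContDiffAt ℝ 2 f ‖x‖ := fun x hx => by
    simpa using K.contDiffAt x hx 0 K.zero_mem
  have hcomp : ∀ {g : ℝ → ℝ}, (∀ x ∈ Λ, ContinuousAt g ‖x‖) →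
      ContinuousOn (fun x : R3 => g ‖x‖) Λ := fun {g} hg x hx =>
    (ContinuousAt.comp (g := g) (hg x hx) continuous_norm.continuousAt).continuousWithinAt
  have c0 : ContinuousOn (fun x : R3 => f ‖x‖) Λ := hcomp fun x hx => (hC x hx).continuousAt
  have c1 : ContinuousOn (fun x : R3 => deriv f ‖x‖) Λ :=
    hcomp fun x hx => (hC x hx).deriv_of_two.continuousAt
  have c2 : ContinuousOn (fun x : R3 => deriv (deriv f) ‖x‖) Λ :=
    hcomp fun x hx => (hC x hx).continuousAt_deriv_deriv
  have cn : ContinuousOn (fun x : R3 => ‖x‖) Λ := continuous_norm.continuousOn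
  have d1 : ContinuousOn (fun x : R3 => ‖x‖ / 2 * deriv f ‖x‖) Λ := (cn.div_const 2).mul c1
  have d2 : ContinuousOn (fun x : R3 => ℓ / √5 * (2 * deriv f ‖x‖
      + ‖x‖ / 2 * deriv (deriv f) ‖x‖)) Λ :=
    continuousOn_const.mul ((continuousOn_const.mul c1).add ((cn.div_const 2).mul c2))
  -- The direction field is discontinuous at 0, but measurability and `‖‖x‖⁻¹ • x‖ ≤ 1` are enough.
  have hdir : Measurable fun x : R3 => ‖x‖⁻¹ • x := measurable_norm.inv.smul measurable_id
  have m0 : Measurable fun x : R3 => inner ℝ (‖x‖⁻¹ • x) α := by fun_prop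
  have m01 : Measurable fun x : R3 => inner ℝ (‖x‖⁻¹ • x) α • (‖x‖⁻¹ • x) := m0.smul hdir
  have m1 : Measurable fun x : R3 => α - inner ℝ (‖x‖⁻¹ • x) α • (‖x‖⁻¹ • x) :=
    m01.const_sub α
  have m2 : Measurable fun x : R3 => cross (‖x‖⁻¹ • x) β :=
    (continuous_cross_left β).measurable.comp hdir
  have hm := K.measurableSet
  have hmeas : AEStronglyMeasurable (meanField f ℓ α β) (volume.restrict Λ) :=
    (((c0.aestronglyMeasurable hm).smul_const α).add
      ((d1.aestronglyMeasurable hm).smul m1.aestronglyMeasurable)).add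
      ((d2.aestronglyMeasurable hm).smul m2.aestronglyMeasurable) |>.congr
      (Eventually.of_forall fun x => rfl)
  obtain ⟨M0, hM0⟩ := K.isCompact.exists_bound_of_continuousOn c0
  obtain ⟨M1, hM1⟩ := K.isCompact.exists_bound_of_continuousOn d1
  obtain ⟨M2, hM2⟩ := K.isCompact.exists_bound_of_continuousOn d2
  obtain ⟨B, hB⟩ := (isCompact_closedBall (0 : R3) 1).exists_bound_of_continuousOn
    (continuous_cross_left β).continuousOn
  refine MemLp.of_bound hmeas (M0 * ‖α‖ + M1 * (‖α‖ + ‖α‖) + M2 * B) ?_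
  filter_upwards [ae_restrict_mem hm] with x hx
  have hd : ‖‖x‖⁻¹ • x‖ ≤ 1 := by
    rw [norm_smul, norm_inv, norm_norm]
    exact inv_mul_le_one
  have h0 := hM0 x hx
  have h1 := hM1 x hx
  have h2 := hM2 x hx
  have h3 := hB (‖x‖⁻¹ • x) (by simpa using hd)
  have h4 : ‖α - inner ℝ (‖x‖⁻¹ • x) α • (‖x‖⁻¹ • x)‖ ≤ ‖α‖ + ‖α‖ := by
    refine (norm_sub_le _ _).trans ?_
    gcongr
    rw [norm_smul]
    have h5 := norm_inner_le_norm (𝕜 := ℝ) (‖x‖⁻¹ • x) α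
    calc _ ≤ (‖‖x‖⁻¹ • x‖ * ‖α‖) * ‖‖x‖⁻¹ • x‖ := by gcongr
      _ ≤ (1 * ‖α‖) * 1 := by gcongr
      _ = ‖α‖ := by ring
  have hM1' : 0 ≤ M1 := (norm_nonneg _).trans h1
  have hM2' : 0 ≤ M2 := (norm_nonneg _).trans h2
  rw [meanField]
  refine (norm_add₃_le).trans ?_
  rw [norm_smul, norm_smul, norm_smul]
  refine add_le_add (add_le_add ?_ ?_) ?_
  · exact mul_le_mul_of_nonneg_right h0 (norm_nonneg _)
  · exact mul_le_mul h1 h4 (norm_nonneg _) hM1'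
  · exact mul_le_mul h2 h3 (norm_nonneg _) hM2'

/-- The mean field as an element of `L²(Λ) ⊗ ℝ³`, linear in its two parameters. -/
noncomputable def meanFieldLp (ℓ : ℝ) : R3 × R3 →ₗ[ℝ] L2Field Λ where
  toFun p := (memLp_meanField K ℓ p.1 p.2).toLp
  map_add' p q := by
    rw [← MemLp.toLp_add]
    exact MemLp.toLp_congr _ _ (Eventually.of_forall fun x => meanField_add f ℓ _ _ _ _ x)
  map_smul' t p := by
    rw [RingHom.id_apply, ← MemLp.toLp_const_smul]
    exact MemLp.toLp_congr _ _ (Eventually.of_forall fun x => meanField_smul f ℓ t _ _ x)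

theorem coeFn_meanFieldLp (ℓ : ℝ) (p : R3 × R3) :
    meanFieldLp K ℓ p =ᵐ[volume.restrict Λ] meanField f ℓ p.1 p.2 :=
  (memLp_meanField K ℓ p.1 p.2).coeFn_toLp

theorem inner_meanFieldLp (ℓ : ℝ) (φ : L2Field Λ) (p : R3 × R3) :
    inner ℝ φ (meanFieldLp K ℓ p) = ∫ z in Λ, inner ℝ (φ z) (meanField f ℓ p.1 p.2 z) := by
  rw [L2.inner_def]
  refine integral_congr_ae ?_
  filter_upwards [coeFn_meanFieldLp K ℓ p] with z hz
  rw [hz]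

end MeanField

/-! ### The velocity and the vorticity at the origin -/

section Flow
variable {Ω : Type*} [MeasurableSpace Ω] {P : Measure Ω} [IsProbabilityMeasure P]
  {Λ : Set R3} {E c : ℝ} {f : ℝ → ℝ} {v : Ω → L2Field Λ} {ρ : R3 → ℝ} {s : ℕ → ℝ}
  {W : R3 → Ω → R3}
  (K : KernelDomain Λ E c f) (hρ : IsMollifier Λ ρ) (hv : IsGaussianFlow P Λ E f v)
  (hW : IsVersion P Λ v ρ s W)

omit [MeasurableSpace Ω] in
theorem curlWithin_apply (ω : Ω) (i : Fin 3) : curlWithin Λ (fun x => W x ω) 0 i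
    = inner ℝ (basisVec (i + 2)) (derivAtZero Λ W ω (basisVec (i + 1)))
      - inner ℝ (basisVec (i + 1)) (derivAtZero Λ W ω (basisVec (i + 2))) := by
  simp only [inner_basisVec]
  fin_cases i <;> simp [curlWithin, partialWithin, derivAtZero, basisVec]

include K hρ hW

omit [IsProbabilityMeasure P] in
theorem isGaussianVar_velocity (i : Fin 3) : IsGaussianVar hv fun ω => W 0 ω i := by
  simpa only [inner_basisVec] using isGaussianVar_value K hρ hv hW K.zero_mem (basisVec i)

theorem isGaussianVar_curl (i : Fin 3) :
    IsGaussianVar hv fun ω => curlWithin Λ (fun x => W x ω) 0 i := by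
  simp only [curlWithin_apply]
  exact (isGaussianVar_deriv K hρ hv hW _ _).sub (isGaussianVar_deriv K hρ hv hW _ _)

include hv

omit [IsProbabilityMeasure P] in
theorem integral_velocity_mul_velocity (hf0 : f 0 = 1) (i j : Fin 3) :
    ∫ ω, W 0 ω i * W 0 ω j ∂P = if i = j then 2 * E / 3 else 0 := by
  have h := integral_value_mul_value K hρ hv hW K.zero_mem K.zero_mem (basisVec i) (basisVec j)
  simp only [inner_basisVec, sub_self] at h
  rw [h]
  simp only [ker, norm_zero, hf0, inner_basisVec, inner_zero_left]
  by_cases hij : i = j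
  · subst hij
    simp
    ring
  · simp [hij]

/-- The gradient of the kernel vanishes at the origin; this is the source of the independence of
velocity and vorticity. -/
theorem integral_velocity_mul_curl (i j : Fin 3) :
    ∫ ω, W 0 ω i * curlWithin Λ (fun x => W x ω) 0 j ∂P = 0 := by
  have i1 := fun a h => (isGaussianVar_value K hρ hv hW K.zero_mem (basisVec i)).integrable_mul
    (isGaussianVar_deriv K hρ hv hW a h)
  have h := fun a h => integral_deriv_mul_value K hρ hv hW h K.zero_mem a (basisVec i)
  simp only [neg_zero, kerD_zero, mul_comm _ (inner ℝ (basisVec i) _)] at h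
  simp only [curlWithin_apply, ← inner_basisVec i, mul_sub]
  rw [integral_sub (i1 _ _) (i1 _ _), h, h, sub_zero]

/-- The variance is `E c` times `4/3 + 4/3` from the two squared derivatives and `1/3 + 1/3` from
their cross terms. -/
theorem integral_curl_mul_curl (i j : Fin 3) :
    ∫ ω, curlWithin Λ (fun x => W x ω) 0 i * curlWithin Λ (fun x => W x ω) 0 j ∂P
      = if i = j then 10 * E * c / 3 else 0 := by
  have i1 := fun a h b k => (isGaussianVar_deriv K hρ hv hW a h).integrable_mul
    (isGaussianVar_deriv K hρ hv hW b k)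
  have h := fun a h b k => integral_deriv_mul_deriv K hρ hv hW h k a b
  simp only [curlWithin_apply, sub_mul, mul_sub]
  rw [integral_sub, integral_sub (i1 _ _ _ _) (i1 _ _ _ _), integral_sub (i1 _ _ _ _) (i1 _ _ _ _),
    h, h, h, h]
  · simp only [kerQ, inner_basisVec]
    fin_cases i <;> fin_cases j <;> simp [basisVec] <;> ring
  · exact (i1 _ _ _ _).sub (i1 _ _ _ _)
  · exact (i1 _ _ _ _).sub (i1 _ _ _ _)

theorem integral_inner_mul_velocity (ℓ : ℝ) (φ : L2Field Λ) (i : Fin 3) :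
    ∫ ω, inner ℝ φ (v ω) * W 0 ω i ∂P
      = 2 * E / 3 * inner ℝ φ (meanFieldLp K ℓ (basisVec i, 0)) := by
  rw [integral_inner_mul K hρ hv hW (isGaussianVar_velocity K hρ hv hW i),
    inner_meanFieldLp, ← integral_const_mul]
  refine setIntegral_congr_fun K.measurableSet fun z hz => ?_
  simp only [← inner_basisVec i]
  rw [integral_value_mul_value K hρ hv hW hz K.zero_mem, sub_zero, ker_eq_inner_meanField]

theorem integral_inner_mul_curl {ℓ : ℝ} (hℓ : 0 < ℓ) (φ : L2Field Λ) (i : Fin 3) :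
    ∫ ω, inner ℝ φ (v ω) * curlWithin Λ (fun x => W x ω) 0 i ∂P
      = 2 * √5 * E / (3 * ℓ) * inner ℝ φ (meanFieldLp K ℓ (0, basisVec i)) := by
  rw [integral_inner_mul K hρ hv hW (isGaussianVar_curl K hρ hv hW i),
    inner_meanFieldLp, ← integral_const_mul]
  refine setIntegral_congr_fun K.measurableSet fun z hz => ?_
  have i1 := fun a h => (isGaussianVar_deriv K hρ hv hW a h).integrable_mul
    (isGaussianVar_value K hρ hv hW hz (φ z))
  simp only [curlWithin_apply, mul_comm (inner ℝ (φ z) (W z _)), sub_mul]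
  rw [integral_sub (i1 _ _) (i1 _ _), integral_deriv_mul_value K hρ hv hW _ hz,
    integral_deriv_mul_value K hρ hv hW _ hz, kerD_antisymm_eq_inner_meanField E hℓ]

end Flow

/-! ### Orthogonal decomposition of the flow -/

theorem map_prod_eq_sum {V : Type*} [AddCommGroup V] [Module ℝ V] (F : R3 × R3 →ₗ[ℝ] V) (α β : R3) :
    F (α, β) = ∑ i, (α i • F (basisVec i, 0) + β i • F (0, basisVec i)) := by
  have e : ((α, β) : R3 × R3)
      = ∑ i, (α i • ((basisVec i, 0) : R3 × R3) + β i • ((0, basisVec i) : R3 × R3)) := by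
    refine Prod.ext ?_ ?_
    · simp only [Prod.fst_sum, Prod.fst_add, Prod.smul_fst, smul_zero, add_zero]
      exact (sum_smul_basisVec α).symm
    · simp only [Prod.snd_sum, Prod.snd_add, Prod.smul_snd, smul_zero, zero_add]
      exact (sum_smul_basisVec β).symm
  conv_lhs => rw [e, map_sum]
  simp only [map_add, map_smul]

section GaussianVar
variable {Ω : Type*} [MeasurableSpace Ω] {P : Measure Ω}
  {Λ : Set R3} {E : ℝ} {f : ℝ → ℝ} {v : Ω → L2Field Λ} {hv : IsGaussianFlow P Λ E f v}

namespace IsGaussianVar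
variable {X X' Y : Ω → ℝ}

theorem integral_add_mul (hX : IsGaussianVar hv X) (hX' : IsGaussianVar hv X')
    (hY : IsGaussianVar hv Y) :
    ∫ ω, (X ω + X' ω) * Y ω ∂P = ∫ ω, X ω * Y ω ∂P + ∫ ω, X' ω * Y ω ∂P := by
  simp only [add_mul]
  exact integral_add (hX.integrable_mul hY) (hX'.integrable_mul hY)

theorem integral_sub_mul (hX : IsGaussianVar hv X) (hX' : IsGaussianVar hv X')
    (hY : IsGaussianVar hv Y) :
    ∫ ω, (X ω - X' ω) * Y ω ∂P = ∫ ω, X ω * Y ω ∂P - ∫ ω, X' ω * Y ω ∂P := by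
  simp only [sub_mul]
  exact integral_sub (hX.integrable_mul hY) (hX'.integrable_mul hY)

theorem integral_sum_mul {ι : Type*} (s : Finset ι) {Z : ι → Ω → ℝ}
    (hZ : ∀ i, IsGaussianVar hv (Z i)) (hY : IsGaussianVar hv Y) :
    ∫ ω, (∑ i ∈ s, Z i ω) * Y ω ∂P = ∑ i ∈ s, ∫ ω, Z i ω * Y ω ∂P := by
  simp only [Finset.sum_mul]
  exact integral_finsetSum _ fun i _ => (hZ i).integrable_mul hY

theorem covariance_eq [IsProbabilityMeasure P] (hX : IsGaussianVar hv X)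
    (hY : IsGaussianVar hv Y) : cov[X, Y; P] = ∫ ω, X ω * Y ω ∂P := by
  rw [covariance_eq_sub hX.memLp hY.memLp, hX.integral_eq_zero, zero_mul, sub_zero]
  rfl

theorem inner {U : Ω → R3} (hU : ∀ i, IsGaussianVar hv fun ω => U ω i) (a : R3) :
    IsGaussianVar hv fun ω => inner ℝ a (U ω) :=
  (IsGaussianVar.sum Finset.univ fun i _ => (hU i).const_mul (a i)).congr
    (Eventually.of_forall fun ω => by simp [PiLp.inner_apply, mul_comm])

theorem integral_inner_mul {U : Ω → R3} (hU : ∀ i, IsGaussianVar hv fun ω => U ω i)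
    (hY : IsGaussianVar hv Y) (a : R3) :
    ∫ ω, Inner.inner ℝ a (U ω) * Y ω ∂P = ∑ i, a i * ∫ ω, U ω i * Y ω ∂P := by
  have e : ∀ ω, Inner.inner ℝ a (U ω) = ∑ i, a i * U ω i := fun ω => by
    simp [PiLp.inner_apply, mul_comm]
  simp only [e]
  rw [integral_sum_mul _ (fun i => (hU i).const_mul (a i)) hY]
  simp only [mul_assoc, integral_const_mul]

theorem integral_inner_mul_inner {U V : Ω → R3} (hU : ∀ i, IsGaussianVar hv fun ω => U ω i)
    (hV : ∀ i, IsGaussianVar hv fun ω => V ω i) {t : ℝ}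
    (h : ∀ i j, ∫ ω, U ω i * V ω j ∂P = if i = j then t else 0) (a b : R3) :
    ∫ ω, Inner.inner ℝ a (U ω) * Inner.inner ℝ b (V ω) ∂P = t * Inner.inner ℝ a b := by
  rw [integral_inner_mul hU (inner hV b)]
  simp only [mul_comm _ (Inner.inner ℝ b _)]
  simp only [integral_inner_mul hV (hU _), mul_comm (V _ _), h]
  simp [PiLp.inner_apply, Finset.mul_sum]
  exact Finset.sum_congr rfl fun i _ => by ring

end IsGaussianVar

theorem hasGaussianLaw_of_dual [IsProbabilityMeasure P] {V : Type*} [NormedAddCommGroup V]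
    [NormedSpace ℝ V] [MeasurableSpace V] [BorelSpace V] {Z : Ω → V} (hZ : AEMeasurable Z P)
    (h : ∀ L : StrongDual ℝ V, IsGaussianVar hv fun ω => L (Z ω)) : HasGaussianLaw Z P := by
  refine ⟨isGaussian_of_isGaussian_map fun L => ?_⟩
  rw [AEMeasurable.map_map_of_aemeasurable L.continuous.measurable.aemeasurable hZ]
  exact (h L).hasGaussianLaw.isGaussian_map

theorem map_eq_stdGaussian [IsProbabilityMeasure P] {X : Ω → R3} (hXm : Measurable X)
    (hX : ∀ a, IsGaussianVar hv fun ω => inner ℝ a (X ω))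
    (hXX : ∀ a b, ∫ ω, inner ℝ a (X ω) * inner ℝ b (X ω) ∂P = inner ℝ a b) :
    P.map X = stdGaussian R3 := by
  have hG : HasGaussianLaw X P := hasGaussianLaw_of_dual (hv := hv) hXm.aemeasurable fun L =>
    (hX ((InnerProductSpace.toDual ℝ R3).symm L)).congr
      (Eventually.of_forall fun ω => by simp)
  have := Measure.isProbabilityMeasure_map (μ := P) hXm.aemeasurable
  refine Measure.ext_of_charFun (funext fun t => ?_)
  rw [hG.charFun_map_eq, charFun_stdGaussian, (hX t).integral_eq_zero,
    variance_of_integral_eq_zero (hX t).hasGaussianLaw.aemeasurable (hX t).integral_eq_zero]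
  simp only [pow_two, hXX, real_inner_self_eq_norm_sq]
  simp
  ring_nf

/-- The components of two jointly Gaussian standard vectors, rotated by `45°`, and the residual of
the regression of the flow on them are independent. -/
theorem independent_decomposition [IsProbabilityMeasure P] {A B : Ω → R3} (hAm : Measurable A)
    (hBm : Measurable B) (hA : ∀ i, IsGaussianVar hv fun ω => A ω i)
    (hB : ∀ i, IsGaussianVar hv fun ω => B ω i)
    (hAA : ∀ i j, ∫ ω, A ω i * A ω j ∂P = if i = j then 1 else 0)
    (hBB : ∀ i j, ∫ ω, B ω i * B ω j ∂P = if i = j then 1 else 0)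
    (hAB : ∀ i j, ∫ ω, A ω i * B ω j ∂P = 0) {σ : ℝ} (F : R3 × R3 →ₗ[ℝ] L2Field Λ)
    (hvA : ∀ φ i, ∫ ω, inner ℝ φ (v ω) * A ω i ∂P = σ * inner ℝ φ (F (basisVec i, 0)))
    (hvB : ∀ φ i, ∫ ω, inner ℝ φ (v ω) * B ω i ∂P = σ * inner ℝ φ (F (0, basisVec i))) :
    P.map (fun ω => (√2)⁻¹ • (A ω + B ω)) = stdGaussian R3 ∧
    P.map (fun ω => (√2)⁻¹ • (A ω - B ω)) = stdGaussian R3 ∧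
    IndepFun (fun ω => (√2)⁻¹ • (A ω + B ω)) (fun ω => (√2)⁻¹ • (A ω - B ω)) P ∧
    AEMeasurable (fun ω => ‖v ω - σ • F (A ω, B ω)‖) P ∧
    IndepFun (fun ω => ((√2)⁻¹ • (A ω + B ω), (√2)⁻¹ • (A ω - B ω)))
      (fun ω => ‖v ω - σ • F (A ω, B ω)‖) P := by
  set r : ℝ := (√2)⁻¹ with hr
  have hr2 : r * r = 1 / 2 := by
    rw [hr, ← mul_inv, Real.mul_self_sqrt (by norm_num)]; norm_num
  set X : Ω → R3 := fun ω => r • (A ω + B ω) with hX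
  set Y : Ω → R3 := fun ω => r • (A ω - B ω) with hY
  set R : Ω → L2Field Λ := fun ω => v ω - σ • F (A ω, B ω) with hR
  have hXm : Measurable X := (hAm.add hBm).const_smul r
  have hYm : Measurable Y := (hAm.sub hBm).const_smul r
  have hRm : AEStronglyMeasurable R P := by
    have h1 : StronglyMeasurable fun ω => F (A ω, B ω) :=
      F.continuous_of_finiteDimensional.comp_stronglyMeasurable (hAm.prodMk hBm).stronglyMeasurable
    exact hv.aestronglyMeasurable.sub (h1.const_smul σ).aestronglyMeasurable
  have gA := IsGaussianVar.inner hA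
  have gB := IsGaussianVar.inner hB
  have cAA := fun a b => IsGaussianVar.integral_inner_mul_inner hA hA hAA a b
  have cBB := fun a b => IsGaussianVar.integral_inner_mul_inner hB hB hBB a b
  have cAB : ∀ a b, ∫ ω, inner ℝ a (A ω) * inner ℝ b (B ω) ∂P = 0 := fun a b => by
    rw [IsGaussianVar.integral_inner_mul_inner hA hB (t := 0) (fun i j => by rw [hAB]; simp),
      zero_mul]
  have cBA : ∀ a b, ∫ ω, inner ℝ a (B ω) * inner ℝ b (A ω) ∂P = 0 := fun a b => by
    simp only [mul_comm _ (inner ℝ b (A _)), cAB]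
  have eX : ∀ a ω, inner ℝ a (X ω) = r * (inner ℝ a (A ω) + inner ℝ a (B ω)) := fun a ω => by
    simp only [hX, inner_smul_right, inner_add_right]
  have eY : ∀ a ω, inner ℝ a (Y ω) = r * (inner ℝ a (A ω) - inner ℝ a (B ω)) := fun a ω => by
    simp only [hY, inner_smul_right, inner_sub_right]
  have gX : ∀ a, IsGaussianVar hv fun ω => inner ℝ a (X ω) := fun a => by
    simp only [eX]; exact ((gA a).add (gB a)).const_mul r
  have gY : ∀ a, IsGaussianVar hv fun ω => inner ℝ a (Y ω) := fun a => by
    simp only [eY]; exact ((gA a).sub (gB a)).const_mul r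
  have pull : ∀ {S T : Ω → ℝ}, ∫ ω, r * S ω * (r * T ω) ∂P = 1 / 2 * ∫ ω, S ω * T ω ∂P := by
    intro S T
    rw [← integral_const_mul, ← hr2]
    congr 1; funext ω; ring
  have cXX : ∀ a b, ∫ ω, inner ℝ a (X ω) * inner ℝ b (X ω) ∂P = inner ℝ a b := fun a b => by
    simp only [eX]
    rw [pull, (gA a).integral_add_mul (gB a) ((gA b).add (gB b))]
    simp only [mul_comm _ (inner ℝ b _ + _)]
    rw [(gA b).integral_add_mul (gB b) (gA a), (gA b).integral_add_mul (gB b) (gB a), cAA, cBB,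
      cAB, cBA, real_inner_comm a b]
    ring
  have cYY : ∀ a b, ∫ ω, inner ℝ a (Y ω) * inner ℝ b (Y ω) ∂P = inner ℝ a b := fun a b => by
    simp only [eY]
    rw [pull, (gA a).integral_sub_mul (gB a) ((gA b).sub (gB b))]
    simp only [mul_comm _ (inner ℝ b _ - _)]
    rw [(gA b).integral_sub_mul (gB b) (gA a), (gA b).integral_sub_mul (gB b) (gB a), cAA, cBB,
      cAB, cBA, real_inner_comm a b]
    ring
  -- The covariances of `A` and of `B` are equal and cancel; this is why both vectors are normalised
  -- before the rotation.
  have cXY : ∀ a b, ∫ ω, inner ℝ a (X ω) * inner ℝ b (Y ω) ∂P = 0 := fun a b => by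
    simp only [eX, eY]
    rw [pull, (gA a).integral_add_mul (gB a) ((gA b).sub (gB b))]
    simp only [mul_comm _ (inner ℝ b _ - _)]
    rw [(gA b).integral_sub_mul (gB b) (gA a), (gA b).integral_sub_mul (gB b) (gB a), cAA, cBB,
      cAB, cBA]
    ring
  have eR : ∀ φ ω, inner ℝ φ (R ω) = inner ℝ φ (v ω) - σ * ∑ i,
      (inner ℝ φ (F (basisVec i, 0)) * A ω i + inner ℝ φ (F (0, basisVec i)) * B ω i) := by
    intro φ ω
    simp only [hR]
    rw [map_prod_eq_sum, inner_sub_right, inner_smul_right, inner_sum]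
    simp only [inner_add_right, inner_smul_right, mul_comm]
  have gterm : ∀ (φ : L2Field Λ) (i : Fin 3), IsGaussianVar hv fun ω =>
      inner ℝ φ (F (basisVec i, 0)) * A ω i + inner ℝ φ (F (0, basisVec i)) * B ω i := fun φ i =>
    ((hA i).const_mul _).add ((hB i).const_mul _)
  have gsum : ∀ φ : L2Field Λ, IsGaussianVar hv fun ω => σ * ∑ i,
      (inner ℝ φ (F (basisVec i, 0)) * A ω i + inner ℝ φ (F (0, basisVec i)) * B ω i) := fun φ =>
    (IsGaussianVar.sum _ fun i _ => gterm φ i).const_mul σ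
  have gR : ∀ φ, IsGaussianVar hv fun ω => inner ℝ φ (R ω) := fun φ => by
    simp only [eR]
    exact (isGaussianVar_pairing φ).sub (gsum φ)
  -- `σ F(A, B)` has the same covariances with `A` and `B` as the flow, so the residual is
  -- uncorrelated with them; joint Gaussianity then gives independence.
  have cRA : ∀ φ j, ∫ ω, inner ℝ φ (R ω) * A ω j ∂P = 0 := by
    intro φ j
    simp only [eR]
    rw [(isGaussianVar_pairing φ).integral_sub_mul (gsum φ) (hA j), hvA]
    simp only [mul_assoc, integral_const_mul]
    rw [IsGaussianVar.integral_sum_mul _ (gterm φ) (hA j)]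
    have : ∀ i, ∫ ω, (inner ℝ φ (F (basisVec i, 0)) * A ω i
        + inner ℝ φ (F (0, basisVec i)) * B ω i) * A ω j ∂P
        = if i = j then inner ℝ φ (F (basisVec i, 0)) else 0 := fun i => by
      rw [((hA i).const_mul _).integral_add_mul ((hB i).const_mul _) (hA j)]
      simp only [mul_assoc, integral_const_mul, mul_comm (B _ i), hAA, hAB]
      simp
    simp only [this]
    simp
  have cRB : ∀ φ j, ∫ ω, inner ℝ φ (R ω) * B ω j ∂P = 0 := by
    intro φ j
    simp only [eR]
    rw [(isGaussianVar_pairing φ).integral_sub_mul (gsum φ) (hB j), hvB]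
    simp only [mul_assoc, integral_const_mul]
    rw [IsGaussianVar.integral_sum_mul _ (gterm φ) (hB j)]
    have : ∀ i, ∫ ω, (inner ℝ φ (F (basisVec i, 0)) * A ω i
        + inner ℝ φ (F (0, basisVec i)) * B ω i) * B ω j ∂P
        = if i = j then inner ℝ φ (F (0, basisVec i)) else 0 := fun i => by
      rw [((hA i).const_mul _).integral_add_mul ((hB i).const_mul _) (hB j)]
      simp only [mul_assoc, integral_const_mul, hBB, hAB]
      simp
    simp only [this]
    simp
  have cAR : ∀ a φ, ∫ ω, inner ℝ a (A ω) * inner ℝ φ (R ω) ∂P = 0 := fun a φ => by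
    rw [IsGaussianVar.integral_inner_mul hA (gR φ)]
    simp only [mul_comm _ (inner ℝ φ _), cRA]
    simp
  have cBR : ∀ a φ, ∫ ω, inner ℝ a (B ω) * inner ℝ φ (R ω) ∂P = 0 := fun a φ => by
    rw [IsGaussianVar.integral_inner_mul hB (gR φ)]
    simp only [mul_comm _ (inner ℝ φ _), cRB]
    simp
  have cXR : ∀ a φ, ∫ ω, inner ℝ a (X ω) * inner ℝ φ (R ω) ∂P = 0 := fun a φ => by
    simp only [eX, mul_assoc, integral_const_mul]
    rw [(gA a).integral_add_mul (gB a) (gR φ), cAR, cBR]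
    simp
  have cYR : ∀ a φ, ∫ ω, inner ℝ a (Y ω) * inner ℝ φ (R ω) ∂P = 0 := fun a φ => by
    simp only [eY, mul_assoc, integral_const_mul]
    rw [(gA a).integral_sub_mul (gB a) (gR φ), cAR, cBR]
    simp
  -- The Borel structure on the field space is needed only inside the proof, since just the norm of
  -- the residual is exported.
  let : MeasurableSpace (L2Field Λ) := borel _
  have : BorelSpace (L2Field Λ) := ⟨rfl⟩
  have : Fact ((2 : ℝ≥0∞) ≠ ∞) := ⟨by norm_num⟩
  have hRm' : AEMeasurable R P := hRm.aemeasurable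
  have dual : ∀ {H : Type _} [NormedAddCommGroup H] [InnerProductSpace ℝ H] [CompleteSpace H]
      (L : StrongDual ℝ H) (x : H), L x = inner ℝ ((InnerProductSpace.toDual ℝ H).symm L) x :=
    fun L x => by simp
  have hXYL : ∀ L : StrongDual ℝ (R3 × R3), ∃ a b : R3, ∀ ω, L (X ω, Y ω)
      = inner ℝ a (X ω) + inner ℝ b (Y ω) := by
    intro L
    refine ⟨(InnerProductSpace.toDual ℝ R3).symm (L.comp (ContinuousLinearMap.inl ℝ R3 R3)),
      (InnerProductSpace.toDual ℝ R3).symm (L.comp (ContinuousLinearMap.inr ℝ R3 R3)), fun ω => ?_⟩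
    simp only [InnerProductSpace.toDual_symm_apply]
    exact (ContinuousLinearMap.comp_inl_add_comp_inr L (X ω, Y ω)).symm
  have hXYlaw : HasGaussianLaw (fun ω => (X ω, Y ω)) P := by
    refine hasGaussianLaw_of_dual (hv := hv) (hXm.prodMk hYm).aemeasurable fun L => ?_
    obtain ⟨a, b, hab⟩ := hXYL L
    simp only [hab]
    exact (gX a).add (gY b)
  have hXYRlaw : HasGaussianLaw (fun ω => ((X ω, Y ω), R ω)) P := by
    refine hasGaussianLaw_of_dual (hv := hv)
      ((hXm.prodMk hYm).aemeasurable.prodMk hRm') fun L => ?_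
    obtain ⟨a, b, hab⟩ := hXYL (L.comp (ContinuousLinearMap.inl ℝ (R3 × R3) (L2Field Λ)))
    have e : ∀ ω, L ((X ω, Y ω), R ω) = inner ℝ a (X ω) + inner ℝ b (Y ω)
        + inner ℝ ((InnerProductSpace.toDual ℝ (L2Field Λ)).symm
          (L.comp (ContinuousLinearMap.inr ℝ (R3 × R3) (L2Field Λ)))) (R ω) := fun ω => by
      rw [← hab, InnerProductSpace.toDual_symm_apply]
      exact (ContinuousLinearMap.comp_inl_add_comp_inr L ((X ω, Y ω), R ω)).symm
    simp only [e]
    exact ((gX a).add (gY b)).add (gR _)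
  refine ⟨map_eq_stdGaussian hXm gX cXX, map_eq_stdGaussian hYm gY cYY, ?_, hRm'.norm, ?_⟩
  · refine hXYlaw.indepFun_of_covariance_inner fun a b => ?_
    rw [(gX a).covariance_eq (gY b), cXY]
  · have h1 : IndepFun (fun ω => (X ω, Y ω)) R P := by
      refine hXYRlaw.indepFun_of_covariance_strongDual fun L₁ L₂ => ?_
      obtain ⟨a, b, hab⟩ := hXYL L₁
      have e1 : (L₁ ∘ fun ω => (X ω, Y ω)) = fun ω => inner ℝ a (X ω) + inner ℝ b (Y ω) :=
        funext hab
      have e2 : (L₂ ∘ R) = fun ω => inner ℝ ((InnerProductSpace.toDual ℝ (L2Field Λ)).symm L₂)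
          (R ω) := funext fun ω => dual L₂ (R ω)
      rw [e1, e2, ((gX a).add (gY b)).covariance_eq (gR _),
        (gX a).integral_add_mul (gY b) (gR _), cXR, cYR, add_zero]
    exact h1.comp (φ := id) (ψ := fun x : L2Field Λ => ‖x‖) measurable_id measurable_norm

end GaussianVar

section Flow
variable {Ω : Type*} [MeasurableSpace Ω] {P : Measure Ω} [IsProbabilityMeasure P]
  {Λ : Set R3} {E : ℝ} {f : ℝ → ℝ} {v : Ω → L2Field Λ}

/-- A representation of the flow in terms of two independent standard Gaussian vectors and an
independent remainder, which also describes the local helicity at the origin. -/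
structure HelicityDecomposition (P : Measure Ω) (Λ : Set R3) (v : Ω → L2Field Λ)
    (F : R3 × R3 →ₗ[ℝ] L2Field Λ) (τ κ : ℝ) (X Y : Ω → R3) (R : Ω → ℝ) : Prop where
  measurable_fst : Measurable X
  measurable_snd : Measurable Y
  map_fst : P.map X = stdGaussian R3
  map_snd : P.map Y = stdGaussian R3
  indepFun : IndepFun X Y P
  aemeasurable : AEMeasurable R P
  indepFun_remainder : IndepFun (fun ω => (X ω, Y ω)) R P
  ae_norm_sub_le : ∀ᵐ ω ∂P, ‖v ω - τ • (F (X ω, X ω) + F (Y ω, -Y ω))‖ ≤ R ω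
  ae_hasLocalHelicity : ∀ᵐ ω ∂P, HasLocalHelicity Λ (v ω) (κ * (‖X ω‖ ^ 2 - ‖Y ω‖ ^ 2))

/-- The velocity and the vorticity at the origin, normalised. -/
theorem exists_normalized_velocity_vorticity {ℓ : ℝ} (hℓ : 0 < ℓ)
    (K : KernelDomain Λ E (1 / ℓ ^ 2) f) (hf0 : f 0 = 1) (hv : IsGaussianFlow P Λ E f v) :
    ∃ (σ ς : ℝ) (A B : Ω → R3), 0 < σ ∧ 0 < ς ∧ Measurable A ∧ Measurable B ∧
      (∀ i, IsGaussianVar hv fun ω => A ω i) ∧ (∀ i, IsGaussianVar hv fun ω => B ω i) ∧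
      (∀ i j, ∫ ω, A ω i * A ω j ∂P = if i = j then 1 else 0) ∧
      (∀ i j, ∫ ω, B ω i * B ω j ∂P = if i = j then 1 else 0) ∧
      (∀ i j, ∫ ω, A ω i * B ω j ∂P = 0) ∧
      (∀ φ i, ∫ ω, inner ℝ φ (v ω) * A ω i ∂P
        = σ * inner ℝ φ (meanFieldLp K ℓ (basisVec i, 0))) ∧
      (∀ φ i, ∫ ω, inner ℝ φ (v ω) * B ω i ∂P
        = σ * inner ℝ φ (meanFieldLp K ℓ (0, basisVec i))) ∧
      ∀ᵐ ω ∂P, HasLocalHelicity Λ (v ω) (σ * ς * inner ℝ (A ω) (B ω)) := by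
  obtain ⟨ρ, hρ⟩ := exists_isMollifier K.interior_nonempty
  obtain ⟨s, W, hW⟩ := exists_isVersion K hρ hv
  have hE := K.pos
  set σ : ℝ := √(2 * E / 3) with hσ
  set ς : ℝ := √(10 * E / 3) / ℓ with hς
  have hσ0 : 0 < σ := by positivity
  have hς0 : 0 < ς := by positivity
  have hσ2 : σ * σ = 2 * E / 3 := Real.mul_self_sqrt (by positivity)
  have hς2 : ς * ς = 10 * E * (1 / ℓ ^ 2) / 3 := by
    rw [hς, div_mul_div_comm, Real.mul_self_sqrt (by positivity)]
    field_simp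
  -- After division by `ς`, the covariance of the flow with the vorticity therefore has the same
  -- coefficient `σ` as the one with the velocity.
  have hσς : 2 * √5 * E / (3 * ℓ) = σ * ς := by
    have h1 : √(10 * E / 3) = √5 * σ := by
      rw [hσ, ← Real.sqrt_mul (by norm_num)]
      congr 1; ring
    have h2 : σ * ς = √5 * (σ * σ) / ℓ := by rw [hς, h1]; ring
    rw [h2, hσ2]
    field_simp
  set C₀ : Ω → R3 := fun ω => curlWithin Λ (fun x => W x ω) 0 with hC₀
  have gC₀ : ∀ i, IsGaussianVar hv fun ω => C₀ ω i := isGaussianVar_curl K hρ hv hW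
  -- The derivative within `Λ` is not shown to be measurable in `ω`; its curl is almost everywhere
  -- measurable because its components represent elements of `L²`. A measurable modification is used
  -- from here on.
  have hC₀m : AEMeasurable C₀ P := by
    have h1 : AEMeasurable (fun ω i => C₀ ω i) P :=
      aemeasurable_pi_lambda _ fun i => (gC₀ i).memLp.aestronglyMeasurable.aemeasurable
    exact (WithLp.measurable_toLp 2 (Fin 3 → ℝ)).comp_aemeasurable h1
  set C : Ω → R3 := hC₀m.mk C₀ with hC
  have hCC₀ : ∀ᵐ ω ∂P, C₀ ω = C ω := hC₀m.ae_eq_mk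
  set A : Ω → R3 := fun ω => σ⁻¹ • W 0 ω with hA
  set B : Ω → R3 := fun ω => ς⁻¹ • C ω with hB
  have hWm : Measurable (W 0) := hW.measurable.comp measurable_prodMk_left
  have hAm : Measurable A := hWm.const_smul σ⁻¹
  have hBm : Measurable B := hC₀m.measurable_mk.const_smul ς⁻¹
  have gA : ∀ i, IsGaussianVar hv fun ω => A ω i := fun i =>
    (isGaussianVar_velocity K hρ hv hW i).const_mul σ⁻¹
  have hBi : ∀ i, (fun ω => ς⁻¹ * C₀ ω i) =ᵐ[P] fun ω => B ω i := fun i => by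
    filter_upwards [hCC₀] with ω hω
    simp [hB, hω]
  have gB : ∀ i, IsGaussianVar hv fun ω => B ω i := fun i =>
    ((gC₀ i).const_mul ς⁻¹).congr (hBi i)
  have hAA : ∀ i j, ∫ ω, A ω i * A ω j ∂P = if i = j then 1 else 0 := by
    intro i j
    have e : ∀ ω, A ω i * A ω j = (σ * σ)⁻¹ * (W 0 ω i * W 0 ω j) := fun ω => by
      simp only [hA, PiLp.smul_apply, smul_eq_mul, mul_inv]; ring
    simp only [e]
    rw [integral_const_mul, integral_velocity_mul_velocity K hρ hv hW hf0, hσ2]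
    split_ifs
    · exact inv_mul_cancel₀ (by positivity)
    · exact mul_zero _
  have hBB : ∀ i j, ∫ ω, B ω i * B ω j ∂P = if i = j then 1 else 0 := by
    intro i j
    have e : ∫ ω, B ω i * B ω j ∂P = ∫ ω, (ς * ς)⁻¹ * (C₀ ω i * C₀ ω j) ∂P := by
      refine integral_congr_ae ?_
      filter_upwards [hBi i, hBi j] with ω h1 h2
      rw [← h1, ← h2, mul_inv]; ring
    rw [e, integral_const_mul, integral_curl_mul_curl K hρ hv hW, hς2]
    split_ifs
    · exact inv_mul_cancel₀ (by positivity)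
    · exact mul_zero _
  have hAB : ∀ i j, ∫ ω, A ω i * B ω j ∂P = 0 := by
    intro i j
    have e : ∫ ω, A ω i * B ω j ∂P = ∫ ω, (σ * ς)⁻¹ * (W 0 ω i * C₀ ω j) ∂P := by
      refine integral_congr_ae ?_
      filter_upwards [hBi j] with ω h2
      rw [← h2, mul_inv]
      simp only [hA, PiLp.smul_apply, smul_eq_mul]; ring
    rw [e, integral_const_mul, integral_velocity_mul_curl K hρ hv hW, mul_zero]
  have hvA : ∀ φ i, ∫ ω, inner ℝ φ (v ω) * A ω i ∂P
      = σ * inner ℝ φ (meanFieldLp K ℓ (basisVec i, 0)) := by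
    intro φ i
    have e : ∀ ω, inner ℝ φ (v ω) * A ω i = σ⁻¹ * (inner ℝ φ (v ω) * W 0 ω i) := fun ω => by
      simp only [hA, PiLp.smul_apply, smul_eq_mul]; ring
    simp only [e]
    rw [integral_const_mul, integral_inner_mul_velocity K hρ hv hW ℓ, ← hσ2]
    field_simp
  have hvB : ∀ φ i, ∫ ω, inner ℝ φ (v ω) * B ω i ∂P
      = σ * inner ℝ φ (meanFieldLp K ℓ (0, basisVec i)) := by
    intro φ i
    have e : ∫ ω, inner ℝ φ (v ω) * B ω i ∂P = ∫ ω, ς⁻¹ * (inner ℝ φ (v ω) * C₀ ω i) ∂P := by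
      refine integral_congr_ae ?_
      filter_upwards [hBi i] with ω h1
      rw [← h1]; ring
    rw [e, integral_const_mul, integral_inner_mul_curl K hρ hv hW hℓ, hσς]
    field_simp
  refine ⟨σ, ς, A, B, hσ0, hς0, hAm, hBm, gA, gB, hAA, hBB, hAB, hvA, hvB, ?_⟩
  filter_upwards [hW.ae_eq, ae_differentiableWithinAt K hρ hv hW, hCC₀] with ω e1 e2 e3
  refine ⟨fun x => W x ω, e1, hW.continuousOn ω, e2, Eq.symm ?_⟩
  have e4 : W 0 ω = σ • A ω := by simp only [hA, smul_inv_smul₀ hσ0.ne']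
  have e5 : C₀ ω = ς • B ω := by rw [e3]; simp only [hB, smul_inv_smul₀ hς0.ne']
  change inner ℝ (W 0 ω) (C₀ ω) = _
  rw [e4, e5, real_inner_smul_left, real_inner_smul_right]; ring

/-- The rotation diagonalises the helicity: `⟨A, B⟩ = (‖X‖² - ‖Y‖²)/2` and `F(A, B) = (F(X, X) +
F(Y, -Y))/√2`. Hence `τ = σ/√2` and `κ = σς/2`. -/
theorem exists_helicityDecomposition {ℓ : ℝ} (hℓ : 0 < ℓ) (K : KernelDomain Λ E (1 / ℓ ^ 2) f)
    (hf0 : f 0 = 1) (hv : IsGaussianFlow P Λ E f v) :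
    ∃ (τ κ : ℝ) (X Y : Ω → R3) (R : Ω → ℝ), 0 < τ ∧ 0 < κ ∧
      HelicityDecomposition P Λ v (meanFieldLp K ℓ) τ κ X Y R := by
  obtain ⟨σ, ς, A, B, hσ0, hς0, hAm, hBm, gA, gB, hAA, hBB, hAB, hvA, hvB, hel⟩ :=
    exists_normalized_velocity_vorticity hℓ K hf0 hv
  obtain ⟨h1, h2, h3, h4, h5⟩ := independent_decomposition hAm hBm gA gB hAA hBB hAB
    (meanFieldLp K ℓ) hvA hvB
  have hr2 : (√2)⁻¹ * (√2)⁻¹ = (1 / 2 : ℝ) := by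
    rw [← mul_inv, Real.mul_self_sqrt (by norm_num)]; norm_num
  refine ⟨σ * (√2)⁻¹, σ * ς / 2, fun ω => (√2)⁻¹ • (A ω + B ω), fun ω => (√2)⁻¹ • (A ω - B ω),
    fun ω => ‖v ω - σ • meanFieldLp K ℓ (A ω, B ω)‖, by positivity, by positivity,
    (hAm.add hBm).const_smul (√2)⁻¹, (hAm.sub hBm).const_smul (√2)⁻¹, h1, h2, h3, h4, h5, ?_, ?_⟩
  · refine Eventually.of_forall fun ω => le_of_eq ?_
    congr 2
    rw [mul_smul]
    congr 1
    rw [← map_add, ← map_smul]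
    congr 1
    refine Prod.ext ?_ ?_
    · simp only [Prod.smul_fst, Prod.fst_add, ← smul_add, smul_smul, hr2]
      module
    · simp only [Prod.smul_snd, Prod.snd_add, ← sub_eq_add_neg, ← smul_sub, smul_smul, hr2]
      module
  · filter_upwards [hel] with ω hω
    convert hω using 1
    rw [← real_inner_self_eq_norm_sq, ← real_inner_self_eq_norm_sq]
    simp only [real_inner_smul_left, real_inner_smul_right, inner_add_left, inner_add_right,
      inner_sub_left, inner_sub_right, real_inner_comm (A ω) (B ω)]
    linear_combination (2 * σ * ς * inner ℝ (A ω) (B ω)) * hr2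

end Flow

/-! ### The direction and the norm of a standard Gaussian vector -/

/-- The density of the standard Gaussian distribution on `ℝ³`, as a function of the norm. -/
noncomputable def gaussWeight (r : ℝ) : ℝ := ((2 * Real.pi) ^ (3 / 2 : ℝ))⁻¹ * Real.exp (-r ^ 2 / 2)

theorem gaussWeight_pos (r : ℝ) : 0 < gaussWeight r := by
  unfold gaussWeight; positivity

theorem measurable_gaussWeight : Measurable gaussWeight := by
  unfold gaussWeight; fun_prop

theorem stdGaussian_eq_withDensity : stdGaussian R3
    = volume.withDensity fun x : R3 => ENNReal.ofReal (gaussWeight ‖x‖) := by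
  have hchar : ∀ t : R3, ∫ x : R3, gaussWeight ‖x‖ • Complex.exp (inner ℝ x t * Complex.I)
      = Complex.exp (-‖t‖ ^ 2 / 2) := by
    intro t
    have h := GaussianFourier.integral_cexp_neg_mul_sq_norm_add (V := R3) (b := 1 / 2) (by norm_num)
      Complex.I t
    have e1 : ∀ x : R3, gaussWeight ‖x‖ • Complex.exp (inner ℝ x t * Complex.I)
        = (((2 * Real.pi) ^ (3 / 2 : ℝ))⁻¹ : ℝ) *
          Complex.exp (-(1 / 2) * ‖x‖ ^ 2 + Complex.I * inner ℝ t x) := fun x => by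
      rw [gaussWeight, Complex.real_smul, Complex.ofReal_mul, Complex.ofReal_exp, mul_assoc,
        ← Complex.exp_add, real_inner_comm]
      congr 2
      push_cast
      ring
    simp only [e1]
    rw [integral_const_mul, h]
    have e2 : ((Real.pi : ℂ) / (1 / 2)) ^ ((Module.finrank ℝ R3 : ℂ) / 2)
        = (((2 * Real.pi) ^ (3 / 2 : ℝ) : ℝ) : ℂ) := by
      rw [Complex.ofReal_cpow (by positivity)]
      congr 1
      · push_cast; ring
      · simp
    rw [e2, ← mul_assoc, ← Complex.ofReal_mul, inv_mul_cancel₀ (by positivity), Complex.ofReal_one,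
      one_mul, Complex.I_sq]
    congr 1
    ring
  -- The integral of a non-integrable function is 0 by convention, while the Fourier transform at 0
  -- equals 1.
  have hint : Integrable fun x : R3 => gaussWeight ‖x‖ := by
    refine Integrable.of_integral_ne_zero fun h0 => ?_
    have h := hchar 0
    simp only [inner_zero_right, Complex.ofReal_zero, zero_mul, Complex.exp_zero] at h
    rw [integral_smul_const, h0] at h
    simp at h
  have hm : Measurable fun x : R3 => gaussWeight ‖x‖ := measurable_gaussWeight.comp measurable_norm
  have : IsFiniteMeasure (volume.withDensity fun x : R3 => ENNReal.ofReal (gaussWeight ‖x‖)) :=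
    isFiniteMeasure_withDensity_ofReal hint.2
  refine Measure.ext_of_charFun (funext fun t => ?_)
  rw [charFun_stdGaussian, charFun_apply, ← hchar t,
    integral_withDensity_eq_integral_toReal_smul hm.ennreal_ofReal
      (Eventually.of_forall fun _ => ENNReal.ofReal_lt_top)]
  exact integral_congr_ae (Eventually.of_forall fun x => by
    simp only [ENNReal.toReal_ofReal (gaussWeight_pos _).le])

instance nonempty_sphere : Nonempty (Metric.sphere (0 : R3) 1) :=
  ⟨⟨basisVec 0, by simp⟩⟩

/-- The direction of a vector, with an arbitrary value at the origin. -/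
noncomputable def direction (x : R3) : Metric.sphere (0 : R3) 1 :=
  if hx : x = 0 then Classical.arbitrary _
  else ⟨‖x‖⁻¹ • x, by simp [norm_smul, hx]⟩

theorem coe_direction {x : R3} (hx : x ≠ 0) : (direction x : R3) = ‖x‖⁻¹ • x := by
  simp [direction, hx]

theorem norm_smul_direction {x : R3} (hx : x ≠ 0) : ‖x‖ • (direction x : R3) = x := by
  rw [coe_direction hx, smul_inv_smul₀ (norm_ne_zero_iff.2 hx)]

theorem measurable_direction : Measurable direction := by
  refine measurable_of_measurable_on_compl_singleton 0 ?_
  have e : Set.domRestrict {x : R3 | x ≠ 0} direction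
      = fun x => ⟨‖(x : R3)‖⁻¹ • (x : R3), by simp [norm_smul, show (x : R3) ≠ 0 from x.2]⟩ :=
    funext fun x => Subtype.ext (coe_direction x.2)
  rw [e]
  refine Measurable.subtype_mk ?_
  exact (measurable_norm.comp measurable_subtype_coe).inv.smul measurable_subtype_coe

/-- Polar coordinates; the arbitrary direction assigned to the origin is irrelevant because a point
has measure zero. -/
theorem lintegral_direction_norm (g : Metric.sphere (0 : R3) 1 × ℝ → ℝ≥0∞) (hg : Measurable g) :
    ∫⁻ x : R3, g (direction x, ‖x‖) = ∫⁻ p, g (p.1, (p.2 : ℝ))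
      ∂((volume : Measure R3).toSphere.prod (Measure.volumeIoiPow (Module.finrank ℝ R3 - 1))) := by
  rw [← (volume : Measure R3).measurePreserving_homeomorphUnitSphereProd.lintegral_comp
    (f := fun p : Metric.sphere (0 : R3) 1 × Set.Ioi (0 : ℝ) => g (p.1, (p.2 : ℝ)))
    (hg.comp (measurable_fst.prodMk (measurable_subtype_coe.comp measurable_snd)))]
  have e : ∫⁻ x : R3, g (direction x, ‖x‖)
      = ∫⁻ x in ({0}ᶜ : Set R3), g (direction x, ‖x‖) := by
    rw [restrict_compl_singleton]
  rw [e, ← lintegral_subtype_comap (measurableSet_singleton _).compl]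
  refine lintegral_congr fun x => ?_
  congr 2
  · ext1
    rw [coe_direction x.2, homeomorphUnitSphereProd_apply_fst_coe]
  · rw [homeomorphUnitSphereProd_apply_snd_coe]

/-- The direction of a standard Gaussian vector is uniform and independent of its norm. -/
theorem stdGaussian_direction_norm {S : Set (Metric.sphere (0 : R3) 1)} (hS : MeasurableSet S)
    {B : Set ℝ} (hB : MeasurableSet B) :
    stdGaussian R3 {x | direction x ∈ S ∧ ‖x‖ ∈ B}
      = uniformSphere S * stdGaussian R3 {x | ‖x‖ ∈ B} := by
  set ν := Measure.volumeIoiPow (Module.finrank ℝ R3 - 1) with hν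
  set J : ℝ≥0∞ := ∫⁻ r : Set.Ioi (0 : ℝ), B.indicator (fun r => ENNReal.ofReal (gaussWeight r)) r ∂ν
    with hJ
  have hw : Measurable fun r : ℝ => ENNReal.ofReal (gaussWeight r) :=
    measurable_gaussWeight.ennreal_ofReal
  have key : ∀ {S : Set (Metric.sphere (0 : R3) 1)}, MeasurableSet S →
      stdGaussian R3 {x | direction x ∈ S ∧ ‖x‖ ∈ B} = (volume : Measure R3).toSphere S * J := by
    intro S hS
    have hm : MeasurableSet {x : R3 | direction x ∈ S ∧ ‖x‖ ∈ B} :=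
      (measurable_direction hS).inter (measurable_norm hB)
    rw [stdGaussian_eq_withDensity, withDensity_apply _ hm, ← lintegral_indicator hm]
    set g : Metric.sphere (0 : R3) 1 × ℝ → ℝ≥0∞ := fun p =>
      S.indicator 1 p.1 * B.indicator (fun r => ENNReal.ofReal (gaussWeight r)) p.2 with hg
    have hgm : Measurable g := ((measurable_one.indicator hS).comp measurable_fst).mul
      ((hw.indicator hB).comp measurable_snd)
    have e : ∀ x : R3, ({x : R3 | direction x ∈ S ∧ ‖x‖ ∈ B}.indicator
        (fun x => ENNReal.ofReal (gaussWeight ‖x‖))) x = g (direction x, ‖x‖) := by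
      intro x
      by_cases h1 : direction x ∈ S <;> by_cases h2 : ‖x‖ ∈ B <;> simp [hg, h1, h2]
    simp only [e]
    rw [lintegral_direction_norm g hgm]
    simp only [hg]
    have : SFinite ν := by rw [hν]; infer_instance
    rw [lintegral_prod_mul (f := S.indicator (1 : Metric.sphere (0 : R3) 1 → ℝ≥0∞))
      (g := fun r : Set.Ioi (0 : ℝ) => B.indicator (fun r => ENNReal.ofReal (gaussWeight r)) (r : ℝ))
      (measurable_one.indicator hS).aemeasurable
      ((hw.indicator hB).comp measurable_subtype_coe).aemeasurable, lintegral_indicator_one hS]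
  have h1 := key hS
  have h2 := key MeasurableSet.univ
  simp only [Set.mem_univ, true_and] at h2
  rw [h1, h2, uniformSphere, Measure.smul_apply, smul_eq_mul]
  have n0 : (volume : Measure R3).toSphere Set.univ ≠ 0 := by
    rw [Measure.measure_univ_ne_zero]
    exact Measure.toSphere_ne_zero _
  have n1 : (volume : Measure R3).toSphere Set.univ ≠ ∞ := measure_ne_top _ _
  rw [mul_comm _ ((volume : Measure R3).toSphere S), mul_assoc, ← mul_assoc _ _ J,
    ENNReal.inv_mul_cancel n0 n1, one_mul]

theorem stdGaussian_pos_of_isOpen {U : Set R3} (hU : IsOpen U) (hne : U.Nonempty) :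
    0 < stdGaussian R3 U := by
  have hac : (volume : Measure R3) ≪ stdGaussian R3 := by
    rw [stdGaussian_eq_withDensity]
    refine withDensity_absolutelyContinuous' ?_ ?_
    · exact (measurable_gaussWeight.comp measurable_norm).ennreal_ofReal.aemeasurable
    · exact Eventually.of_forall fun x => by
        simpa using gaussWeight_pos ‖x‖
  rw [pos_iff_ne_zero]
  exact fun h => (hU.measure_pos volume hne).ne' (hac h)

theorem prod_direction_fst_norm {S : Set (Metric.sphere (0 : R3) 1)} (hS : MeasurableSet S)
    {T : Set (ℝ × ℝ)} (hT : MeasurableSet T) :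
    ((stdGaussian R3).prod (stdGaussian R3)) {p | direction p.1 ∈ S ∧ (‖p.1‖, ‖p.2‖) ∈ T}
      = uniformSphere S
        * ((stdGaussian R3).prod (stdGaussian R3)) {p | (‖p.1‖, ‖p.2‖) ∈ T} := by
  have hT' : MeasurableSet {p : R3 × R3 | (‖p.1‖, ‖p.2‖) ∈ T} :=
    (measurable_norm.comp measurable_fst).prodMk (measurable_norm.comp measurable_snd) hT
  have hST : MeasurableSet {p : R3 × R3 | direction p.1 ∈ S ∧ (‖p.1‖, ‖p.2‖) ∈ T} :=
    ((measurable_direction.comp measurable_fst) hS).inter hT'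
  rw [Measure.prod_apply_symm hST, Measure.prod_apply_symm hT',
    ← lintegral_const_mul _ (measurable_measure_prodMk_right hT')]
  refine lintegral_congr fun y => ?_
  exact stdGaussian_direction_norm hS (B := {r | (r, ‖y‖) ∈ T}) (measurable_prodMk_right hT)

theorem prod_direction_snd_norm {S : Set (Metric.sphere (0 : R3) 1)} (hS : MeasurableSet S)
    {T : Set (ℝ × ℝ)} (hT : MeasurableSet T) :
    ((stdGaussian R3).prod (stdGaussian R3)) {p | direction p.2 ∈ S ∧ (‖p.1‖, ‖p.2‖) ∈ T}
      = uniformSphere S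
        * ((stdGaussian R3).prod (stdGaussian R3)) {p | (‖p.1‖, ‖p.2‖) ∈ T} := by
  have hT' : MeasurableSet {p : R3 × R3 | (‖p.1‖, ‖p.2‖) ∈ T} :=
    (measurable_norm.comp measurable_fst).prodMk (measurable_norm.comp measurable_snd) hT
  have hST : MeasurableSet {p : R3 × R3 | direction p.2 ∈ S ∧ (‖p.1‖, ‖p.2‖) ∈ T} :=
    ((measurable_direction.comp measurable_snd) hS).inter hT'
  rw [Measure.prod_apply hST, Measure.prod_apply hT',
    ← lintegral_const_mul _ (measurable_measure_prodMk_left hT')]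
  refine lintegral_congr fun x => ?_
  exact stdGaussian_direction_norm hS (B := {r | (‖x‖, r) ∈ T}) (measurable_prodMk_left hT)


/-! ### Large values of a difference of two squared norms -/

/-- The direction of the longer one of two vectors. -/
noncomputable def dominantDirection (p : R3 × R3) : Metric.sphere (0 : R3) 1 :=
  if ‖p.2‖ ≤ ‖p.1‖ then direction p.1 else direction p.2

theorem measurable_dominantDirection : Measurable dominantDirection :=
  Measurable.ite (measurableSet_le (measurable_norm.comp measurable_snd)
    (measurable_norm.comp measurable_fst)) (measurable_direction.comp measurable_fst)
    (measurable_direction.comp measurable_snd)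

/-- Which vector is longer is an event of the two norms. On each of the two pieces the selected
direction is uniform and independent of both norms. -/
theorem prod_dominantDirection {S : Set (Metric.sphere (0 : R3) 1)} (hS : MeasurableSet S)
    {T : Set (ℝ × ℝ)} (hT : MeasurableSet T) :
    ((stdGaussian R3).prod (stdGaussian R3)) {p | dominantDirection p ∈ S ∧ (‖p.1‖, ‖p.2‖) ∈ T}
      = uniformSphere S
        * ((stdGaussian R3).prod (stdGaussian R3)) {p | (‖p.1‖, ‖p.2‖) ∈ T} := by
  set Γ := (stdGaussian R3).prod (stdGaussian R3)
  have hD : MeasurableSet {q : ℝ × ℝ | q.2 ≤ q.1} := measurableSet_le measurable_snd measurable_fst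
  have hDn : MeasurableSet {p : R3 × R3 | ‖p.2‖ ≤ ‖p.1‖} :=
    measurableSet_le (measurable_norm.comp measurable_snd) (measurable_norm.comp measurable_fst)
  rw [← measure_inter_add_sdiff {p : R3 × R3 | dominantDirection p ∈ S ∧ (‖p.1‖, ‖p.2‖) ∈ T} hDn,
    ← measure_inter_add_sdiff {p : R3 × R3 | (‖p.1‖, ‖p.2‖) ∈ T} hDn, mul_add]
  congr 1
  · rw [show {p : R3 × R3 | (‖p.1‖, ‖p.2‖) ∈ T} ∩ {p | ‖p.2‖ ≤ ‖p.1‖}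
        = {p | (‖p.1‖, ‖p.2‖) ∈ T ∩ {q | q.2 ≤ q.1}} from rfl,
      ← prod_direction_fst_norm hS (hT.inter hD)]
    congr 1
    ext p
    by_cases hp : ‖p.2‖ ≤ ‖p.1‖ <;> simp [dominantDirection, hp]
  · rw [show {p : R3 × R3 | (‖p.1‖, ‖p.2‖) ∈ T} \ {p | ‖p.2‖ ≤ ‖p.1‖}
        = {p | (‖p.1‖, ‖p.2‖) ∈ T \ {q | q.2 ≤ q.1}} from rfl,
      ← prod_direction_snd_norm hS (hT.diff hD)]
    congr 1
    ext p
    by_cases hp : ‖p.2‖ ≤ ‖p.1‖ <;> simp [dominantDirection, hp, lt_of_not_ge]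

theorem tendsto_tail {ν : Measure ℝ} [IsFiniteMeasure ν] :
    Tendsto (fun t : ℝ => ν (Set.Ioi t)) atTop (𝓝 0) := by
  have h := tendsto_measure_iInter_atTop (μ := ν) (s := fun t : ℝ => Set.Ioi t)
    (fun t => measurableSet_Ioi.nullMeasurableSet) (fun a b h => Set.Ioi_subset_Ioi h)
    ⟨0, measure_ne_top _ _⟩
  rwa [show (⋂ t : ℝ, Set.Ioi t) = ∅ from Set.eq_empty_of_forall_notMem fun x hx =>
    lt_irrefl x (Set.mem_iInter.1 hx x), measure_empty] at h

theorem measurableSet_abs_sq_sub_sq (c : ℝ) : MeasurableSet {q : ℝ × ℝ | c < |q.1 ^ 2 - q.2 ^ 2|} :=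
  measurableSet_lt measurable_const (by fun_prop)

/-- Guarantees that the conditioning event is never null, so that the conditional laws are
probability measures. -/
theorem prod_abs_sq_sub_sq_pos (c : ℝ) : 0 < ((stdGaussian R3).prod (stdGaussian R3))
    {p | c < |‖p.1‖ ^ 2 - ‖p.2‖ ^ 2|} := by
  have hU : IsOpen {x : R3 | |c| + 1 < ‖x‖ ^ 2} := isOpen_lt continuous_const (by fun_prop)
  have hne : {x : R3 | |c| + 1 < ‖x‖ ^ 2}.Nonempty := by
    refine ⟨(|c| + 2) • basisVec 0, ?_⟩
    simp only [Set.mem_ofPred_eq, norm_smul, norm_basisVec, mul_one, Real.norm_eq_abs, sq_abs]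
    nlinarith [abs_nonneg c]
  have h1 := stdGaussian_pos_of_isOpen hU hne
  have h2 := stdGaussian_pos_of_isOpen (Metric.isOpen_ball (x := (0 : R3)) (ε := 1))
    ⟨0, by simp⟩
  refine (ENNReal.mul_pos h1.ne' h2.ne').trans_le ?_
  rw [← Measure.prod_prod]
  refine measure_mono fun p hp => ?_
  simp only [Set.mem_prod, Set.mem_ofPred_eq, mem_ball_zero_iff] at hp ⊢
  refine lt_of_lt_of_le ?_ (le_abs_self _)
  nlinarith [le_abs_self c, norm_nonneg p.2]

/-- If one squared norm exceeds the other one by a large amount, then the smaller one is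
unlikely to be comparable with it. -/
theorem prod_comparable_le {δ c : ℝ} (hδ : 0 < δ) (hc : 1 ≤ δ ^ 2 * c) :
    ((stdGaussian R3).prod (stdGaussian R3))
        {p | c + ‖p.2‖ ^ 2 < ‖p.1‖ ^ 2 ∧ δ * ‖p.1‖ < ‖p.2‖}
      ≤ stdGaussian R3 {y | δ ^ 2 * c < ‖y‖ ^ 2} / stdGaussian R3 (Metric.ball 0 1)
        * ((stdGaussian R3).prod (stdGaussian R3)) {p | c + ‖p.2‖ ^ 2 < ‖p.1‖ ^ 2} := by
  have hb := stdGaussian_pos_of_isOpen (Metric.isOpen_ball (x := (0 : R3)) (ε := 1))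
    ⟨0, by simp⟩
  -- The shorter vector satisfies `‖y‖² > δ² c ≥ 1`, which forces `‖x‖² > c + 1`. The conditioning
  -- event contains `‖x‖² > c + 1` with `‖y‖ < 1`, so the common tail factor cancels in the quotient
  -- and no asymptotics of Gaussian tails are needed.
  have h1 : ((stdGaussian R3).prod (stdGaussian R3))
        {p | c + ‖p.2‖ ^ 2 < ‖p.1‖ ^ 2 ∧ δ * ‖p.1‖ < ‖p.2‖}
      ≤ stdGaussian R3 {x | c + 1 < ‖x‖ ^ 2} * stdGaussian R3 {y | δ ^ 2 * c < ‖y‖ ^ 2} := by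
    rw [← Measure.prod_prod]
    refine measure_mono fun p hp => ?_
    simp only [Set.mem_prod, Set.mem_ofPred_eq] at hp ⊢
    have h2 : δ ^ 2 * ‖p.1‖ ^ 2 < ‖p.2‖ ^ 2 := by
      rw [← mul_pow]
      exact pow_lt_pow_left₀ hp.2 (by positivity) two_ne_zero
    have h3 : δ ^ 2 * c ≤ δ ^ 2 * ‖p.1‖ ^ 2 :=
      mul_le_mul_of_nonneg_left (by nlinarith [sq_nonneg ‖p.2‖, hp.1]) (sq_nonneg δ)
    constructor <;> linarith [hp.1]
  have h2 : stdGaussian R3 {x | c + 1 < ‖x‖ ^ 2} * stdGaussian R3 (Metric.ball 0 1)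
      ≤ ((stdGaussian R3).prod (stdGaussian R3)) {p | c + ‖p.2‖ ^ 2 < ‖p.1‖ ^ 2} := by
    rw [← Measure.prod_prod]
    refine measure_mono fun p hp => ?_
    simp only [Set.mem_prod, Set.mem_ofPred_eq, mem_ball_zero_iff] at hp ⊢
    nlinarith [norm_nonneg p.2]
  calc _ ≤ _ := h1
    _ = stdGaussian R3 {y | δ ^ 2 * c < ‖y‖ ^ 2} / stdGaussian R3 (Metric.ball 0 1)
        * (stdGaussian R3 {x | c + 1 < ‖x‖ ^ 2} * stdGaussian R3 (Metric.ball 0 1)) := by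
      rw [mul_comm (stdGaussian R3 {x | c + 1 < ‖x‖ ^ 2}) (stdGaussian R3 (Metric.ball 0 1)),
        ← mul_assoc, ENNReal.div_mul_cancel hb.ne' (measure_ne_top _ _), mul_comm]
    _ ≤ _ := by gcongr

/-- The event splits according to which norm is larger, and exchanging the two vectors reduces one
case to the other. -/
theorem prod_max_lt_min_le {δ c : ℝ} (hδ : 0 < δ) (hc : 1 ≤ δ ^ 2 * c) :
    ((stdGaussian R3).prod (stdGaussian R3))
        {p | c < |‖p.1‖ ^ 2 - ‖p.2‖ ^ 2| ∧ δ * max ‖p.1‖ ‖p.2‖ < min ‖p.1‖ ‖p.2‖}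
      ≤ stdGaussian R3 {y | δ ^ 2 * c < ‖y‖ ^ 2} / stdGaussian R3 (Metric.ball 0 1)
        * ((stdGaussian R3).prod (stdGaussian R3)) {p | c < |‖p.1‖ ^ 2 - ‖p.2‖ ^ 2|} := by
  have hc0 : 0 < c := pos_of_mul_pos_right (zero_lt_one.trans_le hc) (sq_nonneg δ)
  have hA := prod_comparable_le hδ hc
  set Γ := (stdGaussian R3).prod (stdGaussian R3) with hΓ
  set A := {p : R3 × R3 | c + ‖p.2‖ ^ 2 < ‖p.1‖ ^ 2} with hAd
  set B := {p : R3 × R3 | c + ‖p.1‖ ^ 2 < ‖p.2‖ ^ 2} with hBd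
  set A' := {p : R3 × R3 | c + ‖p.2‖ ^ 2 < ‖p.1‖ ^ 2 ∧ δ * ‖p.1‖ < ‖p.2‖} with hA'
  set B' := {p : R3 × R3 | c + ‖p.1‖ ^ 2 < ‖p.2‖ ^ 2 ∧ δ * ‖p.2‖ < ‖p.1‖} with hB'
  have mA : MeasurableSet A := measurableSet_lt (by fun_prop) (by fun_prop)
  have mB : MeasurableSet B := measurableSet_lt (by fun_prop) (by fun_prop)
  have mA' : MeasurableSet A' := mA.inter (measurableSet_lt
    (f := fun p : R3 × R3 => δ * ‖p.1‖) (g := fun p => ‖p.2‖) (by fun_prop) (by fun_prop))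
  have hsw : ∀ {s : Set (R3 × R3)}, MeasurableSet s → Γ (Prod.swap ⁻¹' s) = Γ s := fun hs => by
    rw [← Measure.map_apply measurable_swap hs, hΓ, Measure.prod_swap]
  have eB : Γ B = Γ A := hsw mA
  have eB' : Γ B' = Γ A' := hsw mA'
  have hu : {p : R3 × R3 | c < |‖p.1‖ ^ 2 - ‖p.2‖ ^ 2|} = A ∪ B := by
    ext p
    simp only [hAd, hBd, Set.mem_ofPred_eq, Set.mem_union, lt_abs]
    constructor <;> rintro (h | h) <;> [left; right; left; right] <;> linarith
  have hdisj : Disjoint A B := Set.disjoint_left.2 fun p h1 h2 => by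
    simp only [hAd, hBd, Set.mem_ofPred_eq] at h1 h2
    linarith
  have hsub : {p : R3 × R3 | c < |‖p.1‖ ^ 2 - ‖p.2‖ ^ 2|
      ∧ δ * max ‖p.1‖ ‖p.2‖ < min ‖p.1‖ ‖p.2‖} ⊆ A' ∪ B' := by
    rintro p ⟨h1, h2⟩
    have h3 : p ∈ A ∪ B := hu ▸ h1
    have h4 := (mul_le_mul_of_nonneg_left (le_max_left ‖p.1‖ ‖p.2‖) hδ.le).trans_lt
      (h2.trans_le (min_le_right _ _))
    have h5 := (mul_le_mul_of_nonneg_left (le_max_right ‖p.1‖ ‖p.2‖) hδ.le).trans_lt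
      (h2.trans_le (min_le_left _ _))
    exact h3.imp (fun h => ⟨h, h4⟩) fun h => ⟨h, h5⟩
  rw [hu, measure_union hdisj mB, mul_add]
  refine (measure_mono hsub).trans ((measure_union_le _ _).trans ?_)
  rw [eB, eB']
  exact add_le_add hA hA

/-! ### Conditioning on a large helicity. -/

namespace HelicityDecomposition

variable {Ω : Type*} [MeasurableSpace Ω] {P : Measure Ω} {Λ : Set R3}
  {v : Ω → L2Field Λ} {F : R3 × R3 →ₗ[ℝ] L2Field Λ} {τ κ : ℝ} {X Y : Ω → R3} {R : Ω → ℝ}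

theorem measurable_prodMk (H : HelicityDecomposition P Λ v F τ κ X Y R) :
    Measurable fun ω => (X ω, Y ω) :=
  H.measurable_fst.prodMk H.measurable_snd

theorem map_prodMk [IsProbabilityMeasure P] (H : HelicityDecomposition P Λ v F τ κ X Y R) :
    P.map (fun ω => (X ω, Y ω)) = (stdGaussian R3).prod (stdGaussian R3) := by
  rw [(indepFun_iff_map_prod_eq_prod_map_map H.measurable_fst.aemeasurable
    H.measurable_snd.aemeasurable).1 H.indepFun, H.map_fst, H.map_snd]

theorem measure_preimage [IsProbabilityMeasure P]
    (H : HelicityDecomposition P Λ v F τ κ X Y R) {s : Set (R3 × R3)}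
    (hs : MeasurableSet s) :
    P {ω | (X ω, Y ω) ∈ s} = ((stdGaussian R3).prod (stdGaussian R3)) s := by
  rw [← H.map_prodMk, Measure.map_apply H.measurable_prodMk hs]
  rfl

theorem measurable_helicity (H : HelicityDecomposition P Λ v F τ κ X Y R) :
    Measurable fun ω => κ * (‖X ω‖ ^ 2 - ‖Y ω‖ ^ 2) := by
  have h1 := H.measurable_fst
  have h2 := H.measurable_snd
  fun_prop

theorem lt_abs_helicity_iff (hκ : 0 < κ) (u : ℝ) (x y : R3) :
    u < |κ * (‖x‖ ^ 2 - ‖y‖ ^ 2)| ↔ u / κ < |‖x‖ ^ 2 - ‖y‖ ^ 2| := by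
  rw [abs_mul, abs_of_pos hκ, div_lt_iff₀' hκ]

/-- Given that the helicity is large, the direction of the longer vector is uniform. -/
theorem map_cond_dominantDirection [IsProbabilityMeasure P]
    (H : HelicityDecomposition P Λ v F τ κ X Y R) (hκ : 0 < κ) (u : ℝ) :
    (P[|{ω | u < |κ * (‖X ω‖ ^ 2 - ‖Y ω‖ ^ 2)|}]).map (fun ω => dominantDirection (X ω, Y ω))
      = uniformSphere := by
  have hT := measurableSet_abs_sq_sub_sq (u / κ)
  have hT' : MeasurableSet {p : R3 × R3 | u / κ < |‖p.1‖ ^ 2 - ‖p.2‖ ^ 2|} :=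
    measurableSet_lt measurable_const (by fun_prop)
  have hm : Measurable fun ω => dominantDirection (X ω, Y ω) :=
    measurable_dominantDirection.comp H.measurable_prodMk
  simp only [lt_abs_helicity_iff hκ]
  ext S hS
  have hM : MeasurableSet {ω | u / κ < |‖X ω‖ ^ 2 - ‖Y ω‖ ^ 2|} := H.measurable_prodMk hT'
  have e1 : P {ω | u / κ < |‖X ω‖ ^ 2 - ‖Y ω‖ ^ 2|} = _ := H.measure_preimage hT'
  have e2 := H.measure_preimage ((measurable_dominantDirection hS).inter hT')
  have e3 : P ({ω | u / κ < |‖X ω‖ ^ 2 - ‖Y ω‖ ^ 2|}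
      ∩ (fun ω => dominantDirection (X ω, Y ω)) ⁻¹' S)
      = uniformSphere S * ((stdGaussian R3).prod (stdGaussian R3))
        {p | u / κ < |‖p.1‖ ^ 2 - ‖p.2‖ ^ 2|} := by
    rw [Set.inter_comm]
    exact e2.trans (prod_dominantDirection hS hT)
  rw [Measure.map_apply hm hS, cond_apply hM, e3, e1, mul_comm, mul_assoc, ENNReal.mul_inv_cancel (prod_abs_sq_sub_sq_pos _).ne'
    (measure_ne_top _ _), mul_one]

/-- Given that the helicity is large, the shorter vector and the remainder are negligible. -/
theorem tendsto_cond_not_negligible [IsProbabilityMeasure P]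
    (H : HelicityDecomposition P Λ v F τ κ X Y R) (hκ : 0 < κ)
    {δ : ℝ} (hδ : 0 < δ) :
    Tendsto (fun u : ℝ => (P[|{ω | u < |κ * (‖X ω‖ ^ 2 - ‖Y ω‖ ^ 2)|}])
      {ω | δ * max ‖X ω‖ ‖Y ω‖ < min ‖X ω‖ ‖Y ω‖ ∨ δ * max ‖X ω‖ ‖Y ω‖ < R ω}) atTop (𝓝 0) := by
  have hb := stdGaussian_pos_of_isOpen (Metric.isOpen_ball (x := (0 : R3)) (ε := 1))
    ⟨0, by simp⟩
  set b := stdGaussian R3 (Metric.ball 0 1) with hbd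
  have hdiv : Tendsto (fun u : ℝ => u / κ) atTop atTop := tendsto_id.atTop_div_const hκ
  have hsq : Measurable fun y : R3 => ‖y‖ ^ 2 := by fun_prop
  have t1 : Tendsto (fun u : ℝ => stdGaussian R3 {y | δ ^ 2 * (u / κ) < ‖y‖ ^ 2} / b) atTop
      (𝓝 0) := by
    have h := (tendsto_tail (ν := (stdGaussian R3).map fun y => ‖y‖ ^ 2)).comp
      (hdiv.const_mul_atTop (pow_pos hδ 2))
    have h2 := ENNReal.Tendsto.div_const h (b := b) (Or.inr hb.ne')
    rw [ENNReal.zero_div] at h2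
    refine h2.congr fun u => ?_
    rw [Function.comp_apply, Measure.map_apply hsq measurableSet_Ioi]
    rfl
  have t2 : Tendsto (fun u : ℝ => P {ω | δ * √(u / κ) < R ω}) atTop (𝓝 0) := by
    have := Measure.isProbabilityMeasure_map (μ := P) H.aemeasurable
    have h := (tendsto_tail (ν := P.map R)).comp
      ((Real.tendsto_sqrt_atTop.comp hdiv).const_mul_atTop hδ)
    refine h.congr fun u => ?_
    rw [Function.comp_apply, Measure.map_apply_of_aemeasurable H.aemeasurable measurableSet_Ioi]
    rfl
  have t := t1.add t2
  rw [add_zero] at t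
  refine tendsto_of_tendsto_of_tendsto_of_le_of_le' tendsto_const_nhds t
    (Eventually.of_forall fun _ => zero_le) ?_
  filter_upwards [(hdiv.const_mul_atTop (pow_pos hδ 2)).eventually_ge_atTop 1] with u hu
  simp only [lt_abs_helicity_iff hκ]
  set c := u / κ with hc
  have hc0 : 0 < c := pos_of_mul_pos_right (zero_lt_one.trans_le hu) (sq_nonneg δ)
  have hT : MeasurableSet {p : R3 × R3 | c < |‖p.1‖ ^ 2 - ‖p.2‖ ^ 2|} :=
    measurableSet_lt measurable_const (by fun_prop)
  have hD : MeasurableSet {p : R3 × R3 | c < |‖p.1‖ ^ 2 - ‖p.2‖ ^ 2|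
      ∧ δ * max ‖p.1‖ ‖p.2‖ < min ‖p.1‖ ‖p.2‖} :=
    hT.inter (measurableSet_lt (f := fun p : R3 × R3 => δ * max ‖p.1‖ ‖p.2‖)
      (g := fun p => min ‖p.1‖ ‖p.2‖) (by fun_prop) (by fun_prop))
  have e1 := H.measure_preimage hT
  have e2 := H.measure_preimage hD
  simp only [Set.mem_ofPred_eq] at e1 e2
  have hM : MeasurableSet {ω | c < |‖X ω‖ ^ 2 - ‖Y ω‖ ^ 2|} := H.measurable_prodMk hT
  rw [cond_apply hM, e1]
  have hM0 : ((stdGaussian R3).prod (stdGaussian R3))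
      {p : R3 × R3 | c < |‖p.1‖ ^ 2 - ‖p.2‖ ^ 2|} ≠ 0 := (prod_abs_sq_sub_sq_pos _).ne'
  set m := ((stdGaussian R3).prod (stdGaussian R3))
      {p : R3 × R3 | c < |‖p.1‖ ^ 2 - ‖p.2‖ ^ 2|} with hm
  -- The remainder is independent of `(X, Y)`, so the conditioning does not affect its tail.
  have e3 : P ({ω | c < |‖X ω‖ ^ 2 - ‖Y ω‖ ^ 2|} ∩ {ω | δ * √c < R ω})
      = m * P {ω | δ * √c < R ω} := by
    rw [← e1]
    exact H.indepFun_remainder.measure_inter_preimage_eq_mul _ _ hT (measurableSet_Ioi (a := δ * √c))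
  have hsub : {ω | c < |‖X ω‖ ^ 2 - ‖Y ω‖ ^ 2|}
      ∩ {ω | δ * max ‖X ω‖ ‖Y ω‖ < min ‖X ω‖ ‖Y ω‖ ∨ δ * max ‖X ω‖ ‖Y ω‖ < R ω}
      ⊆ {ω | c < |‖X ω‖ ^ 2 - ‖Y ω‖ ^ 2| ∧ δ * max ‖X ω‖ ‖Y ω‖ < min ‖X ω‖ ‖Y ω‖}
        ∪ ({ω | c < |‖X ω‖ ^ 2 - ‖Y ω‖ ^ 2|} ∩ {ω | δ * √c < R ω}) := by
    rintro ω ⟨h1, h2 | h2⟩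
    · exact Or.inl ⟨h1, h2⟩
    · refine Or.inr ⟨h1, lt_of_le_of_lt (mul_le_mul_of_nonneg_left ?_ hδ.le) h2⟩
      -- The larger squared norm is at least the difference of the two, which exceeds `c`.
      refine Real.sqrt_le_iff.2 ⟨le_max_of_le_left (norm_nonneg _), ?_⟩
      simp only [Set.mem_ofPred_eq] at h1
      have m1 := pow_le_pow_left₀ (norm_nonneg (X ω)) (le_max_left ‖X ω‖ ‖Y ω‖) 2
      have m2 := pow_le_pow_left₀ (norm_nonneg (Y ω)) (le_max_right ‖X ω‖ ‖Y ω‖) 2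
      rcases lt_abs.1 h1 with h | h <;> nlinarith [sq_nonneg ‖X ω‖, sq_nonneg ‖Y ω‖]
  calc m⁻¹ * _ ≤ m⁻¹ * (stdGaussian R3 {y | δ ^ 2 * c < ‖y‖ ^ 2} / b * m
        + m * P {ω | δ * √c < R ω}) := by
        gcongr
        refine (measure_mono hsub).trans ((measure_union_le _ _).trans ?_)
        rw [e2, e3]
        gcongr
        exact prod_max_lt_min_le hδ hu
    _ = _ := by
      rw [mul_comm _ m, ← mul_add, ← mul_assoc, ENNReal.inv_mul_cancel hM0 (measure_ne_top _ _),
        one_mul]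

end HelicityDecomposition


/-! ### Comparison of the normalized fields -/

/-- The cross product is orthogonal to `e`, so the component along `e` depends on neither `σ` nor
`ℓ`. Near the origin it is close to `f(0) = 1`, which bounds the field below uniformly. -/
theorem inner_meanField_self (f : ℝ → ℝ) (ℓ σ : ℝ) {e : R3} (he : ‖e‖ = 1) (x : R3) :
    inner ℝ e (meanField f ℓ e (σ • e) x)
      = f ‖x‖ + ‖x‖ / 2 * deriv f ‖x‖ * (1 - inner ℝ (‖x‖⁻¹ • x) e ^ 2) := by
  have h1 : inner ℝ e (cross (‖x‖⁻¹ • x) e) = 0 := by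
    have := inner_cross (‖x‖⁻¹ • x) e e
    linarith
  simp only [meanField, cross_smul, inner_add_right, inner_sub_right, inner_smul_right, h1,
    real_inner_self_eq_norm_sq, he, real_inner_comm]
  ring

theorem half_le_norm_meanField {f : ℝ → ℝ} {ℓ σ : ℝ} {e x : R3} (he : ‖e‖ = 1)
    (h1 : |f ‖x‖ - 1| ≤ 1 / 4) (h2 : |‖x‖ / 2 * deriv f ‖x‖| ≤ 1 / 4) :
    1 / 2 ≤ ‖meanField f ℓ e (σ • e) x‖ := by
  have h3 := real_inner_le_norm e (meanField f ℓ e (σ • e) x)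
  rw [he, one_mul, inner_meanField_self f ℓ σ he] at h3
  have h4 : |inner ℝ (‖x‖⁻¹ • x) e| ≤ 1 := by
    refine (abs_real_inner_le_norm _ _).trans ?_
    rw [he, mul_one, norm_smul, norm_inv, norm_norm]
    exact inv_mul_le_one
  have h5 := (sq_le_one_iff_abs_le_one _).2 h4
  have h6 := sq_nonneg (inner ℝ (‖x‖⁻¹ • x) e)
  rw [abs_le] at h1 h2
  nlinarith

/-- The fields `meanField f ℓ e (σ • e)` with a unit vector `e` are bounded away from zero. -/
theorem exists_le_norm_meanFieldLp {Λ : Set R3} {E c : ℝ} {f : ℝ → ℝ} (K : KernelDomain Λ E c f)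
    (hf0 : f 0 = 1) (ℓ : ℝ) :
    ∃ c₀ : ℝ, 0 < c₀ ∧ ∀ (e : R3) (σ : ℝ), ‖e‖ = 1 → c₀ ≤ ‖meanFieldLp K ℓ (e, σ • e)‖ := by
  have hf := K.regular.contDiffAt
  have t1 : Tendsto (fun r => |f r - 1|) (𝓝 0) (𝓝 0) := by
    simpa [hf0] using (hf.continuousAt.tendsto.sub_const 1).abs
  have t2 : Tendsto (fun r => |r / 2 * deriv f r|) (𝓝 0) (𝓝 0) := by
    have h : ContinuousAt (fun r : ℝ => r / 2 * deriv f r) 0 :=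
      (continuousAt_id.div_const 2).mul hf.deriv_of_two.continuousAt
    simpa using h.abs.tendsto
  obtain ⟨δ, hδ, hδf⟩ := Metric.eventually_nhds_iff.1
    ((t1.eventually_le_const (by norm_num : (0 : ℝ) < 1 / 4)).and
      (t2.eventually_le_const (by norm_num : (0 : ℝ) < 1 / 4)))
  set A := Λ ∩ Metric.ball (0 : R3) δ with hA
  have mA : MeasurableSet A := K.measurableSet.inter measurableSet_ball
  have hpos : 0 < volume A := by
    -- The origin may be a boundary point, but interior points accumulate at it, so `Λ` meets every
    -- ball around 0 in positive measure.
    have h0 : (0 : R3) ∈ closure (interior Λ) := by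
      rw [K.convex.closure_interior_eq_closure_of_nonempty_interior K.interior_nonempty]
      exact subset_closure K.zero_mem
    obtain ⟨y, hy1, hy2⟩ := mem_closure_iff.1 h0 _ Metric.isOpen_ball (Metric.mem_ball_self hδ)
    refine ((isOpen_interior.inter Metric.isOpen_ball).measure_pos volume ⟨y, hy2, hy1⟩).trans_le ?_
    exact measure_mono (Set.inter_subset_inter_left _ interior_subset)
  have hfin : (volume.restrict Λ) A ≠ ∞ :=
    (Measure.restrict_apply_le _ _).trans_lt ((measure_mono Set.inter_subset_left).trans_lt K.volume_lt_top) |>.ne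
  refine ⟨‖indicatorConstLp 2 mA hfin (1 / 2 : ℝ)‖, ?_, fun e σ he => ?_⟩
  · rw [norm_indicatorConstLp two_ne_zero ENNReal.ofNat_ne_top]
    refine mul_pos (by norm_num) (Real.rpow_pos_of_pos ?_ _)
    rw [measureReal_def, ENNReal.toReal_pos_iff, Measure.restrict_apply mA,
      Set.inter_eq_left.2 Set.inter_subset_left]
    exact ⟨hpos, (measure_mono Set.inter_subset_left).trans_lt K.volume_lt_top⟩
  · refine Lp.norm_le_norm_of_ae_le ?_
    filter_upwards [indicatorConstLp_coeFn (p := 2) (hs := mA) (hμs := hfin) (c := (1 / 2 : ℝ)),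
      coeFn_meanFieldLp K ℓ (e, σ • e)] with x h1 h2
    rw [h1, h2]
    by_cases hx : x ∈ A
    · rw [Set.indicator_of_mem hx, Real.norm_of_nonneg (by norm_num)]
      have h3 := hδf (y := ‖x‖) (by simpa using hx.2)
      exact half_le_norm_meanField he h3.1 h3.2
    · rw [Set.indicator_of_notMem hx, norm_zero]
      exact norm_nonneg _

/-- Normalisation ignores the positive factor `t`, so `v` is compared with `t • u`. Correcting the
vector and correcting its norm cost the same amount each, whence the factor 2. -/
theorem norm_normalize_sub_normalize_le {V : Type*} [NormedAddCommGroup V] [NormedSpace ℝ V]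
    {u : V} (v : V) {t : ℝ} (ht : 0 < t) (hu : u ≠ 0) :
    ‖‖v‖⁻¹ • v - ‖u‖⁻¹ • u‖ ≤ 2 * ‖v - t • u‖ / (t * ‖u‖) := by
  have hw : ‖t • u‖ = t * ‖u‖ := by rw [norm_smul, Real.norm_of_nonneg ht.le]
  have hpos : 0 < t * ‖u‖ := mul_pos ht (norm_pos_iff.2 hu)
  have hn : ‖u‖⁻¹ • u = ‖t • u‖⁻¹ • t • u := by
    rw [hw, mul_inv, smul_smul, mul_comm t⁻¹, mul_assoc, inv_mul_cancel₀ ht.ne', mul_one]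
  rw [hn, ← hw]
  set w := t • u
  rw [← hw] at hpos
  have e : ‖v‖⁻¹ • v - ‖w‖⁻¹ • w = ‖w‖⁻¹ • (v - w) + (‖v‖⁻¹ - ‖w‖⁻¹) • v := by
    rw [smul_sub, sub_smul]
    abel
  have h2 : ‖(‖v‖⁻¹ - ‖w‖⁻¹) • v‖ ≤ ‖v - w‖ / ‖w‖ := by
    rcases eq_or_ne v 0 with rfl | hv
    · simp only [smul_zero, norm_zero]
      positivity
    have hv' := norm_pos_iff.2 hv
    rw [norm_smul, inv_sub_inv hv'.ne' hpos.ne', norm_div, norm_mul, norm_norm, norm_norm,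
      div_mul_eq_mul_div, mul_comm ‖v‖ ‖w‖, mul_div_mul_right _ _ hv'.ne', Real.norm_eq_abs]
    gcongr
    rw [norm_sub_rev]
    exact abs_norm_sub_norm_le w v
  rw [e]
  refine (norm_add_le _ _).trans ((add_le_add_right h2 _).trans_eq ?_)
  rw [norm_smul, norm_inv, norm_norm]
  ring

theorem eLpNorm_normalized_sub {Λ : Set R3} {E c : ℝ} {f : ℝ → ℝ} (K : KernelDomain Λ E c f)
    (ℓ σ : ℝ) (e : R3) (g : L2Field Λ) :
    eLpNorm (fun x => normalized Λ g x - normalized Λ (profile f ℓ σ e) x) 2 (volume.restrict Λ)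
      = ENNReal.ofReal ‖‖g‖⁻¹ • g
          - ‖meanFieldLp K ℓ (e, σ • e)‖⁻¹ • meanFieldLp K ℓ (e, σ • e)‖ := by
  set U := meanFieldLp K ℓ (e, σ • e) with hU
  have hp : U =ᵐ[volume.restrict Λ] profile f ℓ σ e := by
    rw [profile_eq_meanField]
    exact coeFn_meanFieldLp K ℓ (e, σ • e)
  rw [Lp.norm_def, ENNReal.ofReal_toReal (Lp.eLpNorm_ne_top _)]
  refine eLpNorm_congr_ae ?_
  filter_upwards [hp, Lp.coeFn_sub (‖g‖⁻¹ • g) (‖U‖⁻¹ • U), Lp.coeFn_smul ‖g‖⁻¹ g,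
    Lp.coeFn_smul ‖U‖⁻¹ U] with x h1 h2 h3 h4
  rw [h2, Pi.sub_apply, h3, h4, Pi.smul_apply, Pi.smul_apply, h1, normalized, normalized,
    Lp.norm_def, Lp.norm_def, eLpNorm_congr_ae hp]

/-- The longer vector `z` contributes `τ ‖z‖` times a field of norm at least `c₀`. The shorter
vector and the remainder contribute at most `(τ C + 1) δ ‖z‖`, and `‖z‖` cancels in the quotient.
The sign of the helicity tells which vector is longer. -/
theorem norm_normalize_sub_meanFieldLp_le {Λ : Set R3} {E c : ℝ} {f : ℝ → ℝ}
    (K : KernelDomain Λ E c f) {ℓ τ κ δ c₀ C r : ℝ} (hτ : 0 < τ) (hκ : 0 < κ) (hc₀ : 0 < c₀)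
    (hlow : ∀ (e : R3) (σ : ℝ), ‖e‖ = 1 → c₀ ≤ ‖meanFieldLp K ℓ (e, σ • e)‖)
    (hC0 : 0 ≤ C) (hC : ∀ p, ‖meanFieldLp K ℓ p‖ ≤ C * ‖p‖) {x y : R3} {g : L2Field Λ}
    (hg : ‖g - τ • (meanFieldLp K ℓ (x, x) + meanFieldLp K ℓ (y, -y))‖ ≤ r) (hxy : ‖x‖ ≠ ‖y‖)
    (hmin : min ‖x‖ ‖y‖ ≤ δ * max ‖x‖ ‖y‖) (hr : r ≤ δ * max ‖x‖ ‖y‖) :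
    ‖‖g‖⁻¹ • g - ‖meanFieldLp K ℓ ((dominantDirection (x, y) : R3),
        Real.sign (κ * (‖x‖ ^ 2 - ‖y‖ ^ 2)) • (dominantDirection (x, y) : R3))‖⁻¹
      • meanFieldLp K ℓ ((dominantDirection (x, y) : R3),
        Real.sign (κ * (‖x‖ ^ 2 - ‖y‖ ^ 2)) • (dominantDirection (x, y) : R3))‖
      ≤ 2 * (τ * C + 1) * δ / (τ * c₀) := by
  -- both cases are instances of the following estimate
  have key : ∀ (z w : R3) (σ ρ : ℝ), z ≠ 0 → |ρ| = 1 → ‖w‖ ≤ δ * ‖z‖ → r ≤ δ * ‖z‖ →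
      ‖g - τ • (meanFieldLp K ℓ (z, σ • z) + meanFieldLp K ℓ (w, ρ • w))‖ ≤ r →
      ‖‖g‖⁻¹ • g - ‖meanFieldLp K ℓ ((direction z : R3), σ • (direction z : R3))‖⁻¹
        • meanFieldLp K ℓ ((direction z : R3), σ • (direction z : R3))‖
        ≤ 2 * (τ * C + 1) * δ / (τ * c₀) := by
    intro z w σ ρ hz hρ hw hrz hgz
    have hz' := norm_pos_iff.2 hz
    have hlz := hlow (direction z) σ (norm_eq_of_mem_sphere _)
    set U := meanFieldLp K ℓ ((direction z : R3), σ • (direction z : R3)) with hUd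
    have hU : U ≠ 0 := norm_pos_iff.1 (hc₀.trans_le hlz)
    have hzU : meanFieldLp K ℓ (z, σ • z) = ‖z‖ • U := by
      rw [hUd, ← map_smul, Prod.smul_mk, smul_comm, norm_smul_direction hz]
    have hFw : ‖meanFieldLp K ℓ (w, ρ • w)‖ ≤ C * ‖w‖ := by
      refine (hC _).trans_eq ?_
      rw [Prod.norm_mk, norm_smul, Real.norm_eq_abs, hρ, one_mul, max_self]
    have hrem : ‖g - (τ * ‖z‖) • U‖ ≤ (τ * C + 1) * δ * ‖z‖ := by
      have e : g - (τ * ‖z‖) • U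
          = (g - τ • (meanFieldLp K ℓ (z, σ • z) + meanFieldLp K ℓ (w, ρ • w)))
            + τ • meanFieldLp K ℓ (w, ρ • w) := by
        rw [hzU, smul_add, smul_smul]
        abel
      rw [e]
      refine (norm_add_le _ _).trans ?_
      rw [norm_smul, Real.norm_of_nonneg hτ.le]
      have h1 : τ * ‖meanFieldLp K ℓ (w, ρ • w)‖ ≤ τ * (C * (δ * ‖z‖)) := by
        gcongr
        exact hFw.trans (by gcongr)
      nlinarith
    refine (norm_normalize_sub_normalize_le g (mul_pos hτ hz') hU).trans ?_
    rw [div_le_div_iff₀ (by positivity) (by positivity)]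
    have hδ : 0 ≤ (τ * C + 1) * δ * ‖z‖ := (norm_nonneg _).trans hrem
    calc 2 * ‖g - (τ * ‖z‖) • U‖ * (τ * c₀) ≤ 2 * ((τ * C + 1) * δ * ‖z‖) * (τ * ‖U‖) := by gcongr
      _ = _ := by ring
  rcases hxy.lt_or_gt with h | h
  · have hs : Real.sign (κ * (‖x‖ ^ 2 - ‖y‖ ^ 2)) = -1 :=
      Real.sign_of_neg (mul_neg_of_pos_of_neg hκ (by nlinarith [norm_nonneg x]))
    rw [min_eq_left h.le, max_eq_right h.le] at hmin
    rw [max_eq_right h.le] at hr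
    rw [hs, show dominantDirection (x, y) = direction y from if_neg h.not_ge]
    refine key y x (-1) 1 (norm_pos_iff.1 ((norm_nonneg x).trans_lt h)) abs_one hmin hr ?_
    rwa [neg_one_smul, one_smul, add_comm]
  · have hs : Real.sign (κ * (‖x‖ ^ 2 - ‖y‖ ^ 2)) = 1 :=
      Real.sign_of_pos (mul_pos hκ (by nlinarith [norm_nonneg y]))
    rw [min_eq_right h.le, max_eq_left h.le] at hmin
    rw [max_eq_left h.le] at hr
    rw [hs, show dominantDirection (x, y) = direction x from if_pos h.le]
    refine key x y 1 (-1) (norm_pos_iff.1 ((norm_nonneg y).trans_lt h)) (by simp) hmin hr ?_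
    rwa [neg_one_smul, one_smul]

/-- Given that the helicity is large, the normalized field is close to the normalized profile
in the direction of the longer vector. -/
theorem HelicityDecomposition.tendsto_cond_normalized {Ω : Type*} [MeasurableSpace Ω]
    {P : Measure Ω} [IsProbabilityMeasure P] {Λ : Set R3} {E c ℓ τ κ : ℝ} {f : ℝ → ℝ}
    (K : KernelDomain Λ E c f) (hf0 : f 0 = 1) {v : Ω → L2Field Λ} {X Y : Ω → R3} {R : Ω → ℝ}
    (H : HelicityDecomposition P Λ v (meanFieldLp K ℓ) τ κ X Y R) (hτ : 0 < τ) (hκ : 0 < κ)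
    {ε : ℝ} (hε : 0 < ε) :
    Tendsto (fun u : ℝ => (P[|{ω | u < |κ * (‖X ω‖ ^ 2 - ‖Y ω‖ ^ 2)|}])
      {ω | ENNReal.ofReal ε < eLpNorm (fun x => normalized Λ (v ω) x
        - normalized Λ (profile f ℓ (Real.sign (κ * (‖X ω‖ ^ 2 - ‖Y ω‖ ^ 2)))
            (dominantDirection (X ω, Y ω))) x) 2 (volume.restrict Λ)}) atTop (𝓝 0) := by
  obtain ⟨c₀, hc₀, hlow⟩ := exists_le_norm_meanFieldLp K hf0 ℓ
  set C := ‖(meanFieldLp K ℓ).toContinuousLinearMap‖ with hCd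
  have hC0 : 0 ≤ C := norm_nonneg _
  have hC : ∀ p, ‖meanFieldLp K ℓ p‖ ≤ C * ‖p‖ :=
    (meanFieldLp K ℓ).toContinuousLinearMap.le_opNorm
  -- Chosen so that the bound of `norm_normalize_sub_meanFieldLp_le` equals `ε`.
  set δ := ε * (τ * c₀) / (2 * (τ * C + 1)) with hδd
  have hδ : 0 < δ := by positivity
  have hδε : 2 * (τ * C + 1) * δ / (τ * c₀) = ε := by
    rw [hδd]
    field_simp
  refine tendsto_of_tendsto_of_tendsto_of_le_of_le' tendsto_const_nhds
    (H.tendsto_cond_not_negligible hκ hδ) (Eventually.of_forall fun _ => zero_le) ?_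
  -- For `u ≥ 0` the conditioning event excludes zero helicity, hence equal norms, where the
  -- dominant vector is ambiguous.
  filter_upwards [eventually_ge_atTop 0] with u hu
  have hM : MeasurableSet {ω | u < |κ * (‖X ω‖ ^ 2 - ‖Y ω‖ ^ 2)|} :=
    measurableSet_lt measurable_const H.measurable_helicity.abs
  refine measure_mono_ae ?_
  filter_upwards [cond_absolutelyContinuous.ae_le H.ae_norm_sub_le, ae_cond_mem hM]
    with ω h1 h2 h3
  by_contra h4
  change ¬(_ ∨ _) at h4
  push Not at h4
  have hxy : ‖X ω‖ ≠ ‖Y ω‖ := fun h => by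
    rw [h, sub_self, mul_zero, abs_zero] at h2
    exact h2.not_ge hu
  refine (not_le.2 h3) ?_
  rw [eLpNorm_normalized_sub K]
  refine ENNReal.ofReal_le_ofReal ?_
  rw [← hδε]
  exact norm_normalize_sub_meanFieldLp_le K hτ hκ hc₀ hlow hC0 hC h1 hxy h4.1 h4.2

end GaussianFlow

/-! ### Assembly of the theorem. -/

theorem proposition4 {Ω : Type*} [MeasurableSpace Ω] (P : Measure Ω) [IsProbabilityMeasure P]
    (Λ : Set GaussianFlow.R3) (hclosed : IsClosed Λ) (hconv : Convex ℝ Λ)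
    (hbdd : Bornology.IsBounded Λ) (h0 : (0 : GaussianFlow.R3) ∈ Λ)
    (hint : (interior Λ).Nonempty)
    (E ℓ : ℝ) (hE : 0 < E) (hℓ : 0 < ℓ) (f : ℝ → ℝ)
    (hf_even : ∀ r, f (-r) = f r)
    (hf_C2 : ∀ x ∈ Λ, ∀ y ∈ Λ, ContDiffAt ℝ 2 f ‖x - y‖)
    (hf_taylor : (fun r : ℝ => f r - (1 - r ^ 2 / (2 * ℓ ^ 2))) =o[𝓝 0] fun r : ℝ => r ^ 2)
    (hf_third : ∀ᶠ r in 𝓝[≠] (0 : ℝ), DifferentiableAt ℝ (deriv (deriv f)) r)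
    (hf_third_lim : Tendsto (fun r : ℝ => r * deriv (deriv (deriv f)) r) (𝓝[≠] 0) (𝓝 0))
    (v : Ω → GaussianFlow.L2Field Λ) (hv : GaussianFlow.IsGaussianFlow P Λ E f v) :
    -- the local helicity at the origin exists almost surely
    ∃ h : Ω → ℝ, Measurable h ∧ (∀ᵐ ω ∂P, GaussianFlow.HasLocalHelicity Λ (v ω) (h ω)) ∧
      -- a random unit vector, uniform under each conditional law given `|h(0)| > u`
      -- (for `u < 0` this conditional law is `P` itself)
      ∃ e : Ω → Metric.sphere (0 : GaussianFlow.R3) 1, Measurable e ∧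
        (∀ u : ℝ, (P[|{ω | u < |h ω|}]).map e = GaussianFlow.uniformSphere) ∧
        -- convergence in `L²` norm, in conditional probability, as `|h(0)|` becomes large
        ∀ ε : ℝ, 0 < ε →
          Tendsto
            (fun u : ℝ => (P[|{ω | u < |h ω|}])
              {ω | ENNReal.ofReal ε <
                eLpNorm (fun x => GaussianFlow.normalized Λ (v ω) x
                  - GaussianFlow.normalized Λ
                      (GaussianFlow.profile f ℓ (Real.sign (h ω)) (e ω)) x)
                  2 (volume.restrict Λ)})
            atTop (𝓝 0) := by
  have K : GaussianFlow.KernelDomain Λ E (1 / ℓ ^ 2) f :=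
    ⟨hclosed, hconv, hbdd, h0, hint, hE, GaussianFlow.regularAtZero hℓ hf_even
      (by simpa using hf_C2 0 h0 0 h0) hf_taylor hf_third hf_third_lim, hf_C2⟩
  have hf0 : f 0 = 1 := GaussianFlow.taylor_value_zero hf_taylor
  obtain ⟨τ, κ, X, Y, R, hτ, hκ, H⟩ := GaussianFlow.exists_helicityDecomposition hℓ K hf0 hv
  exact ⟨_, H.measurable_helicity, H.ae_hasLocalHelicity, _,
    GaussianFlow.measurable_dominantDirection.comp H.measurable_prodMk,
    H.map_cond_dominantDirection hκ, fun _ hε => H.tendsto_cond_normalized K hf0 hτ hκ hε⟩
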